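/- Identify $\mathbb R^2=\mathbb C$. For an integer $n\ge 0$ let $\mathcal K^{n}$ be the real Hilbert space of odd curves $\eta:(-1,1)\to\mathbb C$ (i.e. $\eta(-s)=-\eta(s)$), modulo equality almost everywhere, whose weak derivatives satisfy $$\|\eta\|_{\mathcal K^n}^2=\sum_{j=0}^{n}\int_{-1}^1(1-s^2)^{j}\,|\eta^{(j)}(s)|^2\,ds<\infty .$$ For $m\ge 0$ and $\mathbb F\in\{\mathbb R,\mathbb C\}$ let $\mathcal F^m_{\rm ev}[\mathbb F]$ be the real Hilbert space of even functions $f:(-1,1)\to\mathbb F$ whose weak derivatives satisfy $$\|f\|^2=\sum_{j=0}^m\int_{-1}^1(1-s^2)^{j+1}\,|f^{(j)}(s)|^2\,ds<\infty .$$ Let $\mathcal A^{m+1}=\{\eta\in\mathcal K^{m+1}:\ |\eta'|= 1 \text{ a.e. on }(-1,1)\}$, with the subspace topology of $\mathcal K^{m+1}$. **Theorem.** The spaces $\mathcal K^{m+1}$, $\mathcal F^m_{\rm ev}[\mathbb R]$ and $\mathcal F^m_{\rm ev}[\mathbb C]$ are complete, and the following hold. 1. If $m\ge 1$, then $\mathcal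 A^{m+1}$ is a $C^\infty$ Hilbert manifold modelled on $\mathcal F^m_{\rm ev}[\mathbb R]$: it has a $C^\infty$ atlas consisting of homeomorphisms $\eta\mapsto\theta$ from open subsets of $\mathcal A^{m+1}$ onto open subsets of $\mathcal F^m_{\rm ev}[\mathbb R]$ such that $\eta'=e^{i\theta}$. 2. If $m\ge 3$, then $\mathcal A^{m+1}$ is a $C^\infty$ Hilbert submanifold of $\mathcal K^{m+1}$: every $\eta_0\in\mathcal A^{m+1}$ has an open neighbourhood $U$ in $\mathcal K^{m+1}$ with a $C^\infty$ diffeomorphism $\Phi:\eta\mapsto\xi$ from $U$ onto an open subset $V$ of $\mathcal F^m_{\rm ev}[\mathbb C]$ such that $\eta'=e^{\xi}$ for all $\eta\in U$, and $\Phi(U\cap\mathcal A^{m+1})=V\cap\{\xi:\operatorname{Re}\xi=0\}$, where $\{\xi:\operatorname{Re}\xi=0\}$ is a closed subspace of $\mathcal F^m_{\rm ev}[\mathbb C]$. Moreover, the manifold structure in part 1 can be chosen so that, if $m\ge3$, the inclusion $\mathcal A^{m+1}\hookrightarrow\mathcal K^{m+1}$ is a $C^\infty$ embedding (a topological embedding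 and an immersion). -/

import Mathlib

open MeasureTheory Set
open scoped ContDiff Manifold

noncomputable section

namespace ArcSpace

/-- Lebesgue measure on the open interval `(-1, 1)`. -/
abbrev intervalMeasure : Measure ℝ := volume.restrict (Ioo (-1 : ℝ) 1)

/-- The weighted measure `(1 - s ^ 2) ^ k ds` on `(-1, 1)`. -/
def weightMeasure (k : ℕ) : Measure ℝ :=
  intervalMeasure.withDensity fun s => ENNReal.ofReal ((1 - s ^ 2) ^ k)

lemma weightMeasure_ac (k : ℕ) : weightMeasure k ≪ intervalMeasure :=
  withDensity_absolutelyContinuous _ _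

lemma ac_weightMeasure (k : ℕ) : intervalMeasure ≪ weightMeasure k := by
  refine withDensity_absolutelyContinuous' (by fun_prop) ?_
  refine (ae_restrict_iff' measurableSet_Ioo).2 (Filter.Eventually.of_forall fun s hs => ?_)
  have h : 0 < 1 - s ^ 2 := by nlinarith [hs.1, hs.2]
  exact (ENNReal.ofReal_pos.2 (pow_pos h k)).ne'

lemma measurePreserving_neg_interval :
    MeasurePreserving (fun s : ℝ => -s) intervalMeasure intervalMeasure := by
  have h := (Measure.measurePreserving_neg (volume : Measure ℝ)).restrict_preimage
    (measurableSet_Ioo (a := (-1 : ℝ)) (b := 1))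
  have e : (Neg.neg ⁻¹' Ioo (-1 : ℝ) 1) = Ioo (-1 : ℝ) 1 := by
    ext s
    simp only [mem_preimage, mem_Ioo]
    constructor <;> rintro ⟨h1, h2⟩ <;> constructor <;> linarith
  rw [e] at h
  exact h

variable {E : Type*} [NormedAddCommGroup E] [InnerProductSpace ℝ E]

/-- `g` is the weak (distributional) derivative of `f` on `(-1, 1)`: both are locally integrable
there, and `∫ φ' f = - ∫ φ g` for every smooth `φ` with compact support in `(-1, 1)`. -/
def IsWeakDeriv (f g : ℝ → E) : Prop :=
  LocallyIntegrableOn f (Ioo (-1 : ℝ) 1) ∧ LocallyIntegrableOn g (Ioo (-1 : ℝ) 1) ∧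
    ∀ φ : ℝ → ℝ, ContDiff ℝ ∞ φ → HasCompactSupport φ → tsupport φ ⊆ Ioo (-1 : ℝ) 1 →
      ∫ s in Ioo (-1 : ℝ) 1, deriv φ s • f s = - ∫ s in Ioo (-1 : ℝ) 1, φ s • g s

lemma integrableOn_smul_test {f : ℝ → E} {φ : ℝ → ℝ}
    (hf : LocallyIntegrableOn f (Ioo (-1 : ℝ) 1)) (hφ : Continuous φ) (hc : HasCompactSupport φ)
    (hs : tsupport φ ⊆ Ioo (-1 : ℝ) 1) :
    IntegrableOn (fun s => φ s • f s) (Ioo (-1 : ℝ) 1) := by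
  have h1 : IntegrableOn (fun s => φ s • f s) (tsupport φ) :=
    (hf.integrableOn_compact_subset hs hc).continuousOn_smul hφ.continuousOn hc
  refine (integrableOn_iff_integrable_of_support_subset (s := tsupport φ) ?_).1 h1 |>.integrableOn
  intro s hsup
  refine subset_tsupport φ ?_
  intro h0
  exact hsup (by simp [h0])

lemma IsWeakDeriv.congr {f f' g g' : ℝ → E} (h : IsWeakDeriv f g)
    (hf : f =ᵐ[intervalMeasure] f') (hg : g =ᵐ[intervalMeasure] g') : IsWeakDeriv f' g' := by
  refine ⟨?_, ?_, fun φ h1 h2 h3 => ?_⟩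
  · rw [locallyIntegrableOn_iff isOpen_Ioo.isLocallyClosed]
    intro k hk hkc
    exact (h.1.integrableOn_compact_subset hk hkc).congr_fun_ae
      (ae_restrict_of_ae_restrict_of_subset hk hf)
  · rw [locallyIntegrableOn_iff isOpen_Ioo.isLocallyClosed]
    intro k hk hkc
    exact (h.2.1.integrableOn_compact_subset hk hkc).congr_fun_ae
      (ae_restrict_of_ae_restrict_of_subset hk hg)
  · have e1 : ∫ s in Ioo (-1 : ℝ) 1, deriv φ s • f' s = ∫ s in Ioo (-1 : ℝ) 1, deriv φ s • f s :=
      integral_congr_ae (by filter_upwards [hf] with s hs; rw [hs])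
    have e2 : ∫ s in Ioo (-1 : ℝ) 1, φ s • g' s = ∫ s in Ioo (-1 : ℝ) 1, φ s • g s :=
      integral_congr_ae (by filter_upwards [hg] with s hs; rw [hs])
    rw [e1, e2, h.2.2 φ h1 h2 h3]

lemma IsWeakDeriv.zero : IsWeakDeriv (0 : ℝ → E) 0 :=
  ⟨(locallyIntegrable_zero).locallyIntegrableOn _,
    (locallyIntegrable_zero).locallyIntegrableOn _, fun φ _ _ _ => by simp⟩

lemma IsWeakDeriv.add {f f' g g' : ℝ → E} (h : IsWeakDeriv f g) (h' : IsWeakDeriv f' g') :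
    IsWeakDeriv (f + f') (g + g') := by
  refine ⟨h.1.add h'.1, h.2.1.add h'.2.1, fun φ h1 h2 h3 => ?_⟩
  have hd : Continuous (deriv φ) := h1.continuous_deriv (by simp)
  have hds : tsupport (deriv φ) ⊆ Ioo (-1 : ℝ) 1 := (tsupport_deriv_subset).trans h3
  simp only [Pi.add_apply, smul_add]
  rw [integral_add (integrableOn_smul_test h.1 hd h2.deriv hds)
      (integrableOn_smul_test h'.1 hd h2.deriv hds),
    integral_add (integrableOn_smul_test h.2.1 h1.continuous h2 h3)
      (integrableOn_smul_test h'.2.1 h1.continuous h2 h3),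
    h.2.2 φ h1 h2 h3, h'.2.2 φ h1 h2 h3, neg_add]

lemma IsWeakDeriv.smul {f g : ℝ → E} (c : ℝ) (h : IsWeakDeriv f g) :
    IsWeakDeriv (c • f) (c • g) := by
  refine ⟨h.1.smul c, h.2.1.smul c, fun φ h1 h2 h3 => ?_⟩
  simp only [Pi.smul_apply, smul_comm _ c]
  rw [integral_smul, integral_smul, h.2.2 φ h1 h2 h3, smul_neg]

variable (E) in
/-- Families `(f₀, …, fₙ)` with `f_j` in the weighted space `L²((1 - s ^ 2) ^ (a + j) ds)`, with
the Hilbert norm `‖f‖ ^ 2 = ∑ j, ∫ (1 - s ^ 2) ^ (a + j) * |f_j| ^ 2 ds`. -/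
abbrev JetSpace (a n : ℕ) : Type _ :=
  PiLp 2 fun j : Fin (n + 1) => Lp E 2 (weightMeasure (a + j))

set_option linter.unusedSectionVars false in
lemma coeFn_add_interval {k : ℕ} (f g : Lp E 2 (weightMeasure k)) :
    ⇑(f + g) =ᵐ[intervalMeasure] ⇑f + ⇑g :=
  (ac_weightMeasure k).ae_eq (Lp.coeFn_add f g)

lemma coeFn_smul_interval {k : ℕ} (c : ℝ) (f : Lp E 2 (weightMeasure k)) :
    ⇑(c • f) =ᵐ[intervalMeasure] c • ⇑f :=
  (ac_weightMeasure k).ae_eq (Lp.coeFn_smul c f)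

set_option linter.unusedSectionVars false in
lemma coeFn_zero_interval {k : ℕ} :
    ⇑(0 : Lp E 2 (weightMeasure k)) =ᵐ[intervalMeasure] 0 :=
  (ac_weightMeasure k).ae_eq (Lp.coeFn_zero E 2 (weightMeasure k))

variable (E) in
/-- The weighted Sobolev space of all `f : (-1, 1) → E` whose weak derivatives `f⁽ʲ⁾` satisfy
`∫ (1 - s ^ 2) ^ (a + j) * |f⁽ʲ⁾| ^ 2 ds < ∞` for `0 ≤ j ≤ n`. A function `f` is recorded together
with its (uniquely determined) derivatives, as the family `(f, f', …, f⁽ⁿ⁾)`. -/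
def weightedSobolev (a n : ℕ) : Submodule ℝ (JetSpace E a n) where
  carrier := {f | ∀ j : Fin n, IsWeakDeriv (f j.castSucc) (f j.succ)}
  zero_mem' := fun _ =>
    IsWeakDeriv.zero.congr coeFn_zero_interval.symm coeFn_zero_interval.symm
  add_mem' := fun hf hg j =>
    ((hf j).add (hg j)).congr (coeFn_add_interval _ _).symm (coeFn_add_interval _ _).symm
  smul_mem' := fun c _ hf j =>
    ((hf j).smul c).congr (coeFn_smul_interval _ _).symm (coeFn_smul_interval _ _).symm

variable (E) in
/-- The families whose zeroth member satisfies `f (-s) = ε * f s` for almost every `s`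
(odd functions for `ε = -1`, even functions for `ε = 1`). -/
def paritySubmodule (ε : ℝ) (a n : ℕ) : Submodule ℝ (JetSpace E a n) where
  carrier := {f | ∀ᵐ s ∂intervalMeasure, f 0 (-s) = ε • f 0 s}
  zero_mem' := by
    have h := coeFn_zero_interval (E := E) (k := a + ((0 : Fin (n + 1)) : ℕ))
    filter_upwards [h, measurePreserving_neg_interval.quasiMeasurePreserving.ae h] with s h1 h2
    change (0 : Lp E 2 (weightMeasure _)) (-s) = ε • (0 : Lp E 2 (weightMeasure _)) s
    rw [h1, h2, Pi.zero_apply, Pi.zero_apply, smul_zero]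
  add_mem' := fun {f g} hf hg => by
    have h := coeFn_add_interval (f 0) (g 0)
    filter_upwards [hf, hg, h, measurePreserving_neg_interval.quasiMeasurePreserving.ae h]
      with s h1 h2 h3 h4
    change (f 0 + g 0) (-s) = ε • (f 0 + g 0) s
    rw [h3, h4, Pi.add_apply, Pi.add_apply, h1, h2, smul_add]
  smul_mem' := fun c f hf => by
    have h := coeFn_smul_interval c (f 0)
    filter_upwards [hf, h, measurePreserving_neg_interval.quasiMeasurePreserving.ae h]
      with s h1 h2 h3
    change (c • f 0) (-s) = ε • (c • f 0) s
    rw [h2, h3, Pi.smul_apply, Pi.smul_apply, h1, smul_comm]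

/-- The space `K^n` of odd plane curves `η : (-1, 1) → ℂ = ℝ²` with
`∫ (1 - s ^ 2) ^ j * |η⁽ʲ⁾| ^ 2 ds < ∞` for `0 ≤ j ≤ n`. -/
abbrev curveSpace (n : ℕ) : Submodule ℝ (JetSpace ℂ 0 n) :=
  weightedSobolev ℂ 0 n ⊓ paritySubmodule ℂ (-1) 0 n

variable (E) in
/-- The even functions in the space `F^m[E]` of all `f : (-1, 1) → E` with
`∫ (1 - s ^ 2) ^ (j + 1) * |f⁽ʲ⁾| ^ 2 ds < ∞` for `0 ≤ j ≤ m`. -/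
abbrev evenSpace (m : ℕ) : Submodule ℝ (JetSpace E 1 m) :=
  weightedSobolev E 1 m ⊓ paritySubmodule E 1 1 m

/-- The derivative `η'` of a curve `η ∈ K^(m+1)`. -/
def velocity {m : ℕ} (η : curveSpace (m + 1)) : ℝ → ℂ := η.1 1

/-- The function underlying an element of `F^m[E]`. -/
def toFun {m : ℕ} (ξ : evenSpace E m) : ℝ → E := ξ.1 0

/-- The arc space `A^(m+1)`: the curves `η ∈ K^(m+1)` with `|η'| ≡ 1`, as a subset (hence, with
the subspace topology) of `K^(m+1)`. -/
def arcSpace (m : ℕ) : Set (curveSpace (m + 1)) :=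
  {η | ∀ᵐ s ∂intervalMeasure, ‖velocity η s‖ = 1}

lemma coe_add_ae {m : ℕ} (ξ ζ : evenSpace E m) :
    toFun (ξ + ζ) =ᵐ[intervalMeasure] toFun ξ + toFun ζ :=
  coeFn_add_interval (ξ.1 0) (ζ.1 0)

lemma coe_smul_ae {m : ℕ} (c : ℝ) (ξ : evenSpace E m) :
    toFun (c • ξ) =ᵐ[intervalMeasure] c • toFun ξ :=
  coeFn_smul_interval c (ξ.1 0)

lemma coe_zero_ae {m : ℕ} : toFun (0 : evenSpace E m) =ᵐ[intervalMeasure] 0 :=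
  coeFn_zero_interval

/-- The subspace of the purely imaginary functions `ξ = i θ` in the even part of `F^m[ℂ]`. -/
def imaginarySubspace (m : ℕ) : Submodule ℝ (evenSpace ℂ m) where
  carrier := {ξ | ∀ᵐ s ∂intervalMeasure, (toFun ξ s).re = 0}
  zero_mem' := by
    filter_upwards [coe_zero_ae (E := ℂ) (m := m)] with s h
    simp [h]
  add_mem' := fun {ξ ζ} hξ hζ => by
    filter_upwards [hξ, hζ, coe_add_ae ξ ζ] with s h1 h2 h3
    simp [h1, h2, h3]
  smul_mem' := fun c ξ hξ => by
    filter_upwards [hξ, coe_smul_ae c ξ] with s h1 h2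
    simp [h1, h2]

/-- `Φ` is a `C^∞` submanifold chart for the subset `S` of the normed space `X`: a `C^∞`
diffeomorphism from an open subset of `X` onto an open subset of the normed space `Y` which maps
the part of `S` in its domain onto the part of the closed linear subspace `L` in its range. -/
structure IsSliceChart {X Y : Type*} [NormedAddCommGroup X] [NormedSpace ℝ X]
    [NormedAddCommGroup Y] [NormedSpace ℝ Y] (S : Set X) (L : Submodule ℝ Y)
    (Φ : OpenPartialHomeomorph X Y) : Prop where
  isClosed : IsClosed (L : Set Y)
  contDiffOn : ContDiffOn ℝ ∞ Φ Φ.source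
  contDiffOn_symm : ContDiffOn ℝ ∞ Φ.symm Φ.target
  image_eq : Φ '' (Φ.source ∩ S) = Φ.target ∩ (L : Set Y)

end ArcSpace

end

open MeasureTheory Set Filter
open scoped ContDiff Manifold Topology NNReal ENNReal Interval

set_option linter.unusedSectionVars false

noncomputable section

namespace ArcSpace

variable {E : Type*} [NormedAddCommGroup E] [InnerProductSpace ℝ E]
variable {E' : Type*} [NormedAddCommGroup E'] [InnerProductSpace ℝ E']

/-! Differentiation is an isomorphism of K^{m+1} onto F^m_ev[ℂ] (`derivEquiv`): an odd curve is the
integral from 0 of its even velocity, and a primitive of a function in L²((1 - s²) ds) is square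
integrable. So the arcs become the unimodular functions f in F^m_ev[ℂ], and everything rests on the
equation f = e^{iθ}.

For m ≥ 3 the space F^m_ev[ℂ] is a commutative algebra. Cauchy–Schwarz estimates make (1 - s²)^{i/2}
f⁽ⁱ⁾ bounded for i ≤ m - 2 (`exists_bound_of_ladder`), and in every term of the Leibniz formula the
factor of lower order is of this kind (`memLp_mul_of_ladder`). The exponential of the algebra is
then smooth, and e^{ξ+ζ} = e^ξ e^ζ makes it a local diffeomorphism (`hasFDerivAt_expMap`). Since
|e^ξ| = 1 exactly when Re ξ = 0, local logarithms of the velocity are slice charts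
(`exists_sliceChart`).

For every m ≥ 1 the manifold structure comes from the map p taking θ to the arc with velocity e^{iθ}
(`phaseMap`). It is continuous, open and onto, and its fibres are the cosets of the constants 2πℤ.
Hence it is a local homeomorphism, two local inverses differ locally by a constant translation, and
the atlas is smooth without any differentiability of p.

The analytic work for m ≤ 2 uses f' = iθ' f, f'' = (iθ'' - θ'²) f and, conversely, θ' = Im (f' conj
f), θ'' = Im (f'' conj f). The only nonlinear term θ'² is controlled by a weighted Hardy inequality
(`IsPrimitive.memLp_one_of_memLp`) and a pointwise bound. Multiplication by bounded factors that
converge almost everywhere preserves L² convergence (`tendsto_mul_of_bounded`), so convergence of f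
and of the derivatives of θ imply each other along subsequences; θ itself converges after
subtraction of multiples of 2π (`exists_int_tendsto_sub`).

Boundedness of linear and bilinear operations is never estimated: an operation defined pointwise has
closed graph (`exists_clm_of_pointwise`, `exists_bilin_of_pointwise`). For m ≥ 3 the slice charts
also give the embedding, because in them the inclusion composed with p is θ ↦ iθ, whose range is
complemented by the real functions. -/

/-- `F` is an indefinite integral on `(-1, 1)` of the locally integrable function `g`. -/
def IsPrimitive (F g : ℝ → E) : Prop :=
  LocallyIntegrableOn g (Ioo (-1 : ℝ) 1) ∧
    ∀ s ∈ Ioo (-1 : ℝ) 1, F s = F 0 + ∫ t in (0 : ℝ)..s, g t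

/-! ### Absolute continuity on compact subintervals -/

lemma zero_mem_interval : (0 : ℝ) ∈ Ioo (-1 : ℝ) 1 := by norm_num

lemma uIcc_subset_interval {a b : ℝ} (ha : a ∈ Ioo (-1 : ℝ) 1) (hb : b ∈ Ioo (-1 : ℝ) 1) :
    uIcc a b ⊆ Ioo (-1 : ℝ) 1 :=
  ordConnected_Ioo.uIcc_subset ha hb

lemma intervalIntegrable_of_locallyIntegrableOn {g : ℝ → E}
    (hg : LocallyIntegrableOn g (Ioo (-1 : ℝ) 1)) {a b : ℝ}
    (ha : a ∈ Ioo (-1 : ℝ) 1) (hb : b ∈ Ioo (-1 : ℝ) 1) : IntervalIntegrable g volume a b :=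
  intervalIntegrable_iff.2 <|
    (hg.integrableOn_compact_subset (uIcc_subset_interval ha hb) isCompact_uIcc).mono_set
      uIoc_subset_uIcc

/-- A function whose increments are dominated by those of absolutely continuous functions is
absolutely continuous. -/
lemma absolutelyContinuousOnInterval_of_dist_le_add {X Y Z : Type*} [PseudoMetricSpace X]
    [PseudoMetricSpace Y] [PseudoMetricSpace Z] {F : ℝ → X} {G : ℝ → Y} {H : ℝ → Z} {a b K L : ℝ}
    (hG : AbsolutelyContinuousOnInterval G a b) (hH : AbsolutelyContinuousOnInterval H a b)
    (h : ∀ x ∈ uIcc a b, ∀ y ∈ uIcc a b,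
      dist (F x) (F y) ≤ K * dist (G x) (G y) + L * dist (H x) (H y)) :
    AbsolutelyContinuousOnInterval F a b := by
  unfold AbsolutelyContinuousOnInterval at hG hH ⊢
  refine squeeze_zero' (Eventually.of_forall fun _ => Finset.sum_nonneg fun _ _ => dist_nonneg) ?_
    (by simpa using (hG.const_mul K).add (hH.const_mul L))
  rw [eventually_inf_principal]
  filter_upwards with e he
  rw [Finset.mul_sum, Finset.mul_sum, ← Finset.sum_add_distrib]
  refine Finset.sum_le_sum fun i hi => ?_
  exact h _ (he.1 i hi).1 _ (he.1 i hi).2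

lemma absolutelyContinuousOnInterval_of_dist_le {X Y : Type*} [PseudoMetricSpace X]
    [PseudoMetricSpace Y] {F : ℝ → X} {G : ℝ → Y} {a b K : ℝ}
    (hG : AbsolutelyContinuousOnInterval G a b)
    (h : ∀ x ∈ uIcc a b, ∀ y ∈ uIcc a b, dist (F x) (F y) ≤ K * dist (G x) (G y)) :
    AbsolutelyContinuousOnInterval F a b :=
  absolutelyContinuousOnInterval_of_dist_le_add (L := 0) hG hG (by simpa using h)

/-- The increments of ∫ g are bounded by those of the scalar function ∫ ‖g‖, for which the claim is
classical. -/
lemma absolutelyContinuousOnInterval_integral {g : ℝ → E}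
    (hg : LocallyIntegrableOn g (Ioo (-1 : ℝ) 1)) {a b : ℝ}
    (ha : a ∈ Ioo (-1 : ℝ) 1) (hb : b ∈ Ioo (-1 : ℝ) 1) :
    AbsolutelyContinuousOnInterval (fun s => ∫ t in (0 : ℝ)..s, g t) a b := by
  have hn : LocallyIntegrableOn (fun t => ‖g t‖) (Ioo (-1 : ℝ) 1) := hg.norm
  have h1 := (intervalIntegrable_of_locallyIntegrableOn hn ha hb
    ).absolutelyContinuousOnInterval_intervalIntegral left_mem_uIcc
  refine absolutelyContinuousOnInterval_of_dist_le (K := 1) h1 fun x hx y hy => ?_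
  have hx' := uIcc_subset_interval ha hb hx
  have hy' := uIcc_subset_interval ha hb hy
  rw [one_mul, dist_comm, dist_comm (∫ v in a..x, ‖g v‖), dist_eq_norm, dist_eq_norm,
    intervalIntegral.integral_interval_sub_left
      (intervalIntegrable_of_locallyIntegrableOn hg zero_mem_interval hy')
      (intervalIntegrable_of_locallyIntegrableOn hg zero_mem_interval hx'),
    intervalIntegral.integral_interval_sub_left
      (intervalIntegrable_of_locallyIntegrableOn hn ha hy')
      (intervalIntegrable_of_locallyIntegrableOn hn ha hx')]
  exact intervalIntegral.norm_integral_le_abs_integral_norm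

/-- Countably many compact symmetric intervals exhaust (-1, 1), so the exceptional null sets can be
collected. -/
lemma ae_interval_of_forall_Icc {p : ℝ → Prop}
    (h : ∀ a ∈ Ioo (-1 : ℝ) 1, ∀ b ∈ Ioo (-1 : ℝ) 1, ∀ᵐ s : ℝ, s ∈ uIcc a b → p s) :
    ∀ᵐ s ∂intervalMeasure, p s := by
  rw [ae_restrict_iff' measurableSet_Ioo]
  have hr : ∀ n : ℕ, (1 : ℝ) - 1 / (n + 1) ∈ Ioo (-1 : ℝ) 1 := fun n => by
    have h1 : (0 : ℝ) < 1 / (n + 1) := by positivity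
    have h2 : (1 : ℝ) / (n + 1) ≤ 1 := by
      rw [div_le_one (by positivity)]; linarith [(Nat.cast_nonneg n : (0 : ℝ) ≤ n)]
    constructor <;> linarith
  have hr' : ∀ n : ℕ, -((1 : ℝ) - 1 / (n + 1)) ∈ Ioo (-1 : ℝ) 1 := fun n => by
    have := hr n
    constructor <;> linarith [this.1, this.2]
  have H : ∀ᵐ s : ℝ, ∀ n : ℕ, s ∈ uIcc (-((1 : ℝ) - 1 / (n + 1))) (1 - 1 / (n + 1)) → p s :=
    ae_all_iff.2 fun n => h _ (hr' n) _ (hr n)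
  filter_upwards [H] with s hs hsI
  have hpos : 0 < 1 - |s| := by
    have := abs_lt.2 hsI
    linarith
  obtain ⟨n, hn⟩ := exists_nat_one_div_lt hpos
  refine hs n ?_
  have h2 : |s| ≤ 1 - 1 / ((n : ℝ) + 1) := by linarith
  exact Icc_subset_uIcc (abs_le.1 h2)

lemma exists_radius_of_tsupport_subset {φ : ℝ → ℝ} (h2 : HasCompactSupport φ)
    (h3 : tsupport φ ⊆ Ioo (-1 : ℝ) 1) :
    ∃ r : ℝ, 0 < r ∧ r < 1 ∧ ∀ s, r ≤ |s| → s ∉ tsupport φ := by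
  rcases (tsupport φ).eq_empty_or_nonempty with he | hne
  · refine ⟨1 / 2, by norm_num, by norm_num, fun s _ => by simp [he]⟩
  · obtain ⟨x, hx, hm⟩ := h2.isCompact.exists_isMaxOn hne continuous_abs.continuousOn
    have hx1 : |x| < 1 := abs_lt.2 (h3 hx)
    refine ⟨(|x| + 1) / 2, by positivity, by linarith, fun s hs hs' => ?_⟩
    have : |s| ≤ |x| := hm hs'
    linarith

/-! ### Calculus of indefinite integrals -/

namespace IsPrimitive

variable {F F' G g g' h : ℝ → E}

lemma sub_eq (hF : IsPrimitive F g) {a b : ℝ} (ha : a ∈ Ioo (-1 : ℝ) 1)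
    (hb : b ∈ Ioo (-1 : ℝ) 1) : F b - F a = ∫ t in a..b, g t := by
  rw [hF.2 a ha, hF.2 b hb, add_sub_add_left_eq_sub,
    intervalIntegral.integral_interval_sub_left
      (intervalIntegrable_of_locallyIntegrableOn hF.1 zero_mem_interval hb)
      (intervalIntegrable_of_locallyIntegrableOn hF.1 zero_mem_interval ha)]

lemma absolutelyContinuousOnInterval (hF : IsPrimitive F g) {a b : ℝ} (ha : a ∈ Ioo (-1 : ℝ) 1)
    (hb : b ∈ Ioo (-1 : ℝ) 1) : AbsolutelyContinuousOnInterval F a b := by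
  refine absolutelyContinuousOnInterval_of_dist_le (K := 1)
    (absolutelyContinuousOnInterval_integral hF.1 ha hb) fun x hx y hy => ?_
  have hx' := uIcc_subset_interval ha hb hx
  have hy' := uIcc_subset_interval ha hb hy
  rw [hF.2 x hx', hF.2 y hy', one_mul, dist_add_left]

lemma continuousOn (hF : IsPrimitive F g) : ContinuousOn F (Ioo (-1 : ℝ) 1) := by
  intro s hs
  have ha : (-1 + s) / 2 ∈ Ioo (-1 : ℝ) 1 := by constructor <;> linarith [hs.1, hs.2]
  have hb : (1 + s) / 2 ∈ Ioo (-1 : ℝ) 1 := by constructor <;> linarith [hs.1, hs.2]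
  have h1 := (hF.absolutelyContinuousOnInterval ha hb).continuousOn
  have h2 : uIcc ((-1 + s) / 2) ((1 + s) / 2) ∈ 𝓝 s := by
    rw [uIcc_of_le (by linarith)]
    exact Icc_mem_nhds (by linarith [hs.1]) (by linarith [hs.2])
  exact (h1.continuousAt h2).continuousWithinAt

lemma ae_hasDerivAt [CompleteSpace E] (hF : IsPrimitive F g) :
    ∀ᵐ s ∂intervalMeasure, HasDerivAt F (g s) s := by
  have h1 : ∀ᵐ s ∂intervalMeasure, HasDerivAt (fun x => ∫ t in (0 : ℝ)..x, g t) (g s) s := by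
    refine ae_interval_of_forall_Icc fun a ha b hb => ?_
    -- The endpoints are enlarged so that the interval contains the base point 0 of the integral.
    have hm : min a 0 ∈ Ioo (-1 : ℝ) 1 :=
      ⟨lt_min ha.1 (by norm_num), (min_le_right _ _).trans_lt (by norm_num)⟩
    have hM : max b 0 ∈ Ioo (-1 : ℝ) 1 :=
      ⟨(show (-1 : ℝ) < 0 by norm_num).trans_le (le_max_right _ _),
        max_lt hb.2 (by norm_num)⟩
    have hm' : min (min a b) 0 ∈ Ioo (-1 : ℝ) 1 := by
      rcases min_choice a b with e | e <;> rw [e]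
      · exact hm
      · exact ⟨lt_min hb.1 (by norm_num), (min_le_right _ _).trans_lt (by norm_num)⟩
    have hM' : max (max a b) 0 ∈ Ioo (-1 : ℝ) 1 := by
      rcases max_choice a b with e | e <;> rw [e]
      · exact ⟨(show (-1 : ℝ) < 0 by norm_num).trans_le (le_max_right _ _),
          max_lt ha.2 (by norm_num)⟩
      · exact hM
    filter_upwards [(intervalIntegrable_of_locallyIntegrableOn hF.1 hm' hM'
      ).ae_hasDerivAt_integral] with s hs hsI
    have hle : min (min a b) 0 ≤ max (max a b) 0 := (min_le_right _ _).trans (le_max_right _ _)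
    refine hs ?_ 0 ?_
    · rw [uIcc_of_le hle]
      exact ⟨(min_le_left _ _).trans hsI.1, hsI.2.trans (le_max_left _ _)⟩
    · rw [uIcc_of_le hle]
      exact ⟨min_le_right _ _, le_max_right _ _⟩
  filter_upwards [h1, ae_restrict_mem measurableSet_Ioo] with s hs hsI
  refine (hs.const_add (F 0)).congr_of_eventuallyEq ?_
  filter_upwards [isOpen_Ioo.mem_nhds hsI] with x hx using hF.2 x hx

/-- The difference of F and ∫ g is absolutely continuous with derivative zero almost everywhere,
hence constant. This reduces product and chain rules to pointwise differentiation. -/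
lemma of_absolutelyContinuous [CompleteSpace E]
    (hF : ∀ a ∈ Ioo (-1 : ℝ) 1, ∀ b ∈ Ioo (-1 : ℝ) 1, AbsolutelyContinuousOnInterval F a b)
    (hg : LocallyIntegrableOn g (Ioo (-1 : ℝ) 1))
    (hd : ∀ᵐ s ∂intervalMeasure, HasDerivAt F (g s) s) : IsPrimitive F g := by
  refine ⟨hg, fun s hs => ?_⟩
  have hG : IsPrimitive (fun x => ∫ t in (0 : ℝ)..x, g t) g := ⟨hg, fun x _ => by simp⟩
  have hd' : ∀ᵐ x : ℝ, x ∈ uIcc 0 s →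
      HasDerivAt (fun x => F x - ∫ t in (0 : ℝ)..x, g t) 0 x := by
    have h1 := (ae_restrict_iff' measurableSet_Ioo).1 (hd.and hG.ae_hasDerivAt)
    filter_upwards [h1] with x hx hxs
    have h2 := hx (uIcc_subset_interval zero_mem_interval hs hxs)
    simpa using h2.1.fun_sub h2.2
  obtain ⟨C, hC⟩ := ((hF 0 zero_mem_interval s hs).fun_sub
    (hG.absolutelyContinuousOnInterval zero_mem_interval hs)).const_of_ae_hasDerivAt_zero hd'
  have e1 := hC 0 left_mem_uIcc
  have e2 := hC s right_mem_uIcc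
  simp only [intervalIntegral.integral_same, sub_zero] at e1
  rw [e1, ← e2]
  abel

lemma congr_right (hF : IsPrimitive F g) (hg : g =ᵐ[intervalMeasure] g') : IsPrimitive F g' := by
  have hl : LocallyIntegrableOn g' (Ioo (-1 : ℝ) 1) := by
    rw [locallyIntegrableOn_iff isOpen_Ioo.isLocallyClosed]
    intro k hk hkc
    exact (hF.1.integrableOn_compact_subset hk hkc).congr_fun_ae
      (ae_restrict_of_ae_restrict_of_subset hk hg)
  refine ⟨hl, fun s hs => ?_⟩
  rw [hF.2 s hs]
  congr 1
  refine intervalIntegral.integral_congr_ae ?_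
  filter_upwards [(ae_restrict_iff' measurableSet_Ioo).1 hg] with x hx hxs
  exact hx (uIcc_subset_interval zero_mem_interval hs (uIoc_subset_uIcc hxs))

lemma ae_unique [CompleteSpace E] (hF : IsPrimitive F g) (hF' : IsPrimitive F g') :
    g =ᵐ[intervalMeasure] g' := by
  filter_upwards [hF.ae_hasDerivAt, hF'.ae_hasDerivAt] with s h1 h2 using h1.unique h2

lemma congr_left (hF : IsPrimitive F g) (h : EqOn F F' (Ioo (-1 : ℝ) 1)) : IsPrimitive F' g :=
  ⟨hF.1, fun s hs => by rw [← h hs, ← h zero_mem_interval, hF.2 s hs]⟩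

lemma eqOn_of_ae_eq (hF : IsPrimitive F g) (hF' : IsPrimitive F' g')
    (h : F =ᵐ[intervalMeasure] F') : EqOn F F' (Ioo (-1 : ℝ) 1) :=
  Measure.eqOn_of_ae_eq h hF.continuousOn hF'.continuousOn
    (by rw [interior_Ioo]; exact subset_closure)

lemma locallyIntegrableOn_bilin {E₁ E₂ E₃ : Type*} [NormedAddCommGroup E₁] [NormedSpace ℝ E₁]
    [NormedAddCommGroup E₂] [NormedSpace ℝ E₂] [NormedAddCommGroup E₃] [NormedSpace ℝ E₃]
    (B : E₁ →L[ℝ] E₂ →L[ℝ] E₃) {F : ℝ → E₁} {h : ℝ → E₂}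
    (hF : ContinuousOn F (Ioo (-1 : ℝ) 1)) (hh : LocallyIntegrableOn h (Ioo (-1 : ℝ) 1)) :
    LocallyIntegrableOn (fun s => B (F s) (h s)) (Ioo (-1 : ℝ) 1) := by
  rw [locallyIntegrableOn_iff isOpen_Ioo.isLocallyClosed]
  intro k hk hkc
  obtain ⟨C, hC⟩ := hkc.exists_bound_of_continuousOn (hF.mono hk)
  have hi := hh.integrableOn_compact_subset hk hkc
  refine Integrable.mono' (hi.norm.const_mul (‖B‖ * C)) ?_ ?_
  · exact B.aestronglyMeasurable_comp₂
      ((hF.mono hk).aestronglyMeasurable_of_isCompact hkc hkc.measurableSet) hi.1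
  · filter_upwards [ae_restrict_mem hkc.measurableSet] with s hs
    refine (B.le_opNorm₂ _ _).trans ?_
    gcongr
    exact hC s hs

/-- The product rule. -/
lemma bilin {E₁ E₂ E₃ : Type*} [NormedAddCommGroup E₁] [InnerProductSpace ℝ E₁]
    [NormedAddCommGroup E₂] [InnerProductSpace ℝ E₂] [NormedAddCommGroup E₃]
    [InnerProductSpace ℝ E₃] [CompleteSpace E₁] [CompleteSpace E₂] [CompleteSpace E₃]
    (B : E₁ →L[ℝ] E₂ →L[ℝ] E₃) {F g : ℝ → E₁} {G h : ℝ → E₂}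
    (hF : IsPrimitive F g) (hG : IsPrimitive G h) :
    IsPrimitive (fun s => B (F s) (G s)) (fun s => B (F s) (h s) + B (g s) (G s)) := by
  refine of_absolutelyContinuous (fun a ha b hb => ?_) ?_ ?_
  · have hFa := hF.absolutelyContinuousOnInterval ha hb
    have hGa := hG.absolutelyContinuousOnInterval ha hb
    obtain ⟨C, hC⟩ := hFa.exists_bound
    obtain ⟨D, hD⟩ := hGa.exists_bound
    refine absolutelyContinuousOnInterval_of_dist_le_add (K := ‖B‖ * D) (L := ‖B‖ * C) hFa hGa
      fun x hx y hy => ?_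
    have e : B (F x) (G x) - B (F y) (G y)
        = B (F x - F y) (G x) + B (F y) (G x - G y) := by
      simp only [map_sub, sub_apply]; abel
    rw [dist_eq_norm, e]
    refine (norm_add_le _ _).trans (add_le_add ?_ ?_)
    · refine (B.le_opNorm₂ _ _).trans ?_
      rw [mul_assoc, mul_assoc, dist_eq_norm, mul_comm D]
      gcongr
      exact hD x hx
    · refine (B.le_opNorm₂ _ _).trans ?_
      rw [dist_eq_norm (G x)]
      gcongr
      exact hC y hy
  · exact (locallyIntegrableOn_bilin B hF.continuousOn hG.1).add
      (locallyIntegrableOn_bilin B.flip hG.continuousOn hF.1)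
  · filter_upwards [hF.ae_hasDerivAt, hG.ae_hasDerivAt] with s h1 h2
    exact B.hasDerivAt_of_bilinear (fun _ => h1) (fun _ => h2)

lemma of_contDiff [CompleteSpace E] {φ : ℝ → E} (hφ : ContDiff ℝ 1 φ) :
    IsPrimitive φ (deriv φ) := by
  have hc : Continuous (deriv φ) := hφ.continuous_deriv le_rfl
  refine ⟨hc.locallyIntegrable.locallyIntegrableOn _, fun s _ => ?_⟩
  rw [intervalIntegral.integral_deriv_eq_sub
    (fun x _ => hφ.differentiable one_ne_zero x) (hc.intervalIntegrable _ _)]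
  abel

lemma const (c : E) : IsPrimitive (fun _ => c) 0 :=
  ⟨(locallyIntegrable_zero).locallyIntegrableOn _, fun s _ => by simp⟩

lemma add (hF : IsPrimitive F g) (hG : IsPrimitive G h) : IsPrimitive (F + G) (g + h) := by
  refine ⟨hF.1.add hG.1, fun s hs => ?_⟩
  simp only [Pi.add_apply]
  rw [intervalIntegral.integral_add
    (intervalIntegrable_of_locallyIntegrableOn hF.1 zero_mem_interval hs)
    (intervalIntegrable_of_locallyIntegrableOn hG.1 zero_mem_interval hs), hF.2 s hs, hG.2 s hs]
  abel

lemma clm [CompleteSpace E] [CompleteSpace E'] (L : E →L[ℝ] E') (hF : IsPrimitive F g) :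
    IsPrimitive (fun s => L (F s)) (fun s => L (g s)) := by
  refine ⟨?_, fun s hs => ?_⟩
  · rw [locallyIntegrableOn_iff isOpen_Ioo.isLocallyClosed]
    intro k hk hkc
    exact L.integrable_comp (hF.1.integrableOn_compact_subset hk hkc)
  · rw [L.intervalIntegral_comp_comm
      (intervalIntegrable_of_locallyIntegrableOn hF.1 zero_mem_interval hs), ← map_add,
      ← hF.2 s hs]

/-- The chain rule for a function with locally Lipschitz dependence on its argument. -/
lemma comp_exp {F g : ℝ → ℂ} (hF : IsPrimitive F g) :
    IsPrimitive (fun s => Complex.exp (F s)) (fun s => g s * Complex.exp (F s)) := by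
  refine of_absolutelyContinuous (fun a ha b hb => ?_) ?_ ?_
  · have hFa := hF.absolutelyContinuousOnInterval ha hb
    obtain ⟨C, hC⟩ := hFa.exists_bound
    -- The values of F on the compact interval lie in the ball of radius C, where |exp' z| = e^{Re
    -- z} ≤ e^C.
    have hL : LipschitzOnWith (Real.exp C).toNNReal Complex.exp (Metric.closedBall 0 C) := by
      refine (convex_closedBall (0 : ℂ) C).lipschitzOnWith_of_nnnorm_deriv_le (𝕜 := ℂ)
        (fun x _ => Complex.differentiable_exp x) fun x hx => ?_
      rw [Complex.deriv_exp, ← NNReal.coe_le_coe, coe_nnnorm, Real.coe_toNNReal _ (Real.exp_nonneg _),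
        Complex.norm_exp]
      exact Real.exp_le_exp.2 ((Complex.re_le_norm x).trans (mem_closedBall_zero_iff.1 hx))
    refine absolutelyContinuousOnInterval_of_dist_le (K := (Real.exp C).toNNReal) hFa fun x hx y hy => ?_
    exact hL.dist_le_mul _ (mem_closedBall_zero_iff.2 (hC x hx)) _
      (mem_closedBall_zero_iff.2 (hC y hy))
  · exact locallyIntegrableOn_bilin (ContinuousLinearMap.mul ℝ ℂ).flip
      (Complex.continuous_exp.comp_continuousOn hF.continuousOn) hF.1
  · filter_upwards [hF.ae_hasDerivAt] with s h1
    simpa [mul_comm] using h1.cexp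

/-- Integration by parts: φF is a primitive of φg + φ'F and vanishes at ±r once the support of φ
lies in (-r, r). -/
lemma isWeakDeriv [CompleteSpace E] (hF : IsPrimitive F g) : IsWeakDeriv F g := by
  refine ⟨hF.continuousOn.locallyIntegrableOn measurableSet_Ioo, hF.1, fun φ h1 h2 h3 => ?_⟩
  obtain ⟨r, hr0, hr1, hr⟩ := exists_radius_of_tsupport_subset h2 h3
  have hrI : r ∈ Ioo (-1 : ℝ) 1 := ⟨by linarith, hr1⟩
  have hrI' : -r ∈ Ioo (-1 : ℝ) 1 := ⟨by linarith, by linarith⟩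
  have hφ : IsPrimitive φ (deriv φ) := of_contDiff (h1.of_le (by simp))
  have hB := bilin (ContinuousLinearMap.lsmul ℝ ℝ : ℝ →L[ℝ] E →L[ℝ] E) hφ hF
  have h0 : ∫ t in (-r)..r, (φ t • g t + deriv φ t • F t) = 0 := by
    have := hB.sub_eq hrI' hrI
    simp only [ContinuousLinearMap.lsmul_apply] at this
    rw [← this, image_eq_zero_of_notMem_tsupport (hr r (le_abs_self r)),
      image_eq_zero_of_notMem_tsupport (hr (-r) (by rw [abs_neg]; exact le_abs_self r))]
    simp
  have hds : tsupport (deriv φ) ⊆ Ioo (-1 : ℝ) 1 := (tsupport_deriv_subset).trans h3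
  have hi1 := integrableOn_smul_test hF.1 h1.continuous h2 h3
  have hi2 := integrableOn_smul_test (hF.continuousOn.locallyIntegrableOn measurableSet_Ioo)
    (h1.continuous_deriv (by simp)) h2.deriv hds
  rw [eq_neg_iff_add_eq_zero, add_comm, ← integral_add hi1 hi2, ← h0,
    intervalIntegral.integral_of_le (by linarith)]
  refine setIntegral_eq_of_subset_of_forall_sdiff_eq_zero measurableSet_Ioo ?_ ?_
  · exact fun x hx => ⟨by linarith [hx.1], by linarith [hx.2]⟩
  · intro x hx
    have hx' : r ≤ |x| := by
      by_contra hlt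
      have := abs_lt.1 (not_le.1 hlt)
      exact hx.2 ⟨this.1, this.2.le⟩
    have hφx := image_eq_zero_of_notMem_tsupport (hr x hx')
    have hdx : deriv φ x = 0 := by
      have h4 : x ∉ tsupport (deriv φ) := fun hxt => hr x hx' (tsupport_deriv_subset hxt)
      exact image_eq_zero_of_notMem_tsupport h4
    simp [hφx, hdx]

end IsPrimitive

/-! ### Weak derivatives and indefinite integrals -/

/-- A test function on `(-1, 1)` with vanishing integral is the derivative of a test function. -/
lemma exists_test_primitive {χ : ℝ → ℝ} (h1 : ContDiff ℝ ∞ χ) (h2 : HasCompactSupport χ)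
    (h3 : tsupport χ ⊆ Ioo (-1 : ℝ) 1) (h0 : ∫ s in Ioo (-1 : ℝ) 1, χ s = 0) :
    ∃ φ : ℝ → ℝ, ContDiff ℝ ∞ φ ∧ HasCompactSupport φ ∧ tsupport φ ⊆ Ioo (-1 : ℝ) 1 ∧
      deriv φ = χ := by
  have hc := h1.continuous
  have hd : ∀ s, HasDerivAt (fun s => ∫ t in (-1 : ℝ)..s, χ t) (χ s) s := fun s =>
    intervalIntegral.integral_hasDerivAt_right (hc.intervalIntegrable _ _)
      hc.stronglyMeasurable.stronglyMeasurableAtFilter hc.continuousAt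
  have hder : deriv (fun s => ∫ t in (-1 : ℝ)..s, χ t) = χ := funext fun s => (hd s).deriv
  obtain ⟨r, hr0, hr1, hr⟩ := exists_radius_of_tsupport_subset h2 h3
  have hz : ∀ s, r ≤ |s| → χ s = 0 := fun s hs => image_eq_zero_of_notMem_tsupport (hr s hs)
  -- Left of the support the integrand vanishes; right of it the whole integral of χ, which is zero,
  -- has been collected.
  have hsupp : ∀ s, s ∉ Icc (-r) r → ∫ t in (-1 : ℝ)..s, χ t = 0 := by
    intro s hs
    have hs' : s < -r ∨ r < s := by
      by_contra hcon
      push Not at hcon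
      exact hs hcon
    rcases hs' with hs' | hs'
    · refine (intervalIntegral.integral_congr (g := fun _ => (0 : ℝ)) fun t ht => ?_).trans
        (by simp)
      refine hz t ?_
      have : t ≤ -r := ht.2.trans (max_le (by linarith) hs'.le)
      rw [abs_of_nonpos (by linarith)]; linarith
    · have e : ∫ t in (1 : ℝ)..s, χ t = 0 := by
        refine (intervalIntegral.integral_congr (g := fun _ => (0 : ℝ)) fun t ht => ?_).trans
          (by simp)
        refine hz t ?_
        have : r ≤ t := (le_min hr1.le hs'.le).trans ht.1
        exact this.trans (le_abs_self t)
      rw [← intervalIntegral.integral_add_adjacent_intervals (b := 1)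
        (hc.intervalIntegrable _ _) (hc.intervalIntegrable _ _), e, add_zero,
        intervalIntegral.integral_of_le (by norm_num), integral_Ioc_eq_integral_Ioo, h0]
  have ht : tsupport (fun s => ∫ t in (-1 : ℝ)..s, χ t) ⊆ Icc (-r) r := by
    refine closure_minimal (fun s hs => ?_) isClosed_Icc
    by_contra hcon
    exact hs (hsupp s hcon)
  refine ⟨fun s => ∫ t in (-1 : ℝ)..s, χ t, ?_, ?_, ?_, hder⟩
  · rw [contDiff_infty_iff_deriv, hder]
    exact ⟨fun s => (hd s).differentiableAt, h1⟩
  · exact isCompact_Icc.of_isClosed_subset (isClosed_tsupport _) ht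
  · exact ht.trans fun s hs => ⟨by linarith [hs.1], by linarith [hs.2]⟩

/-- A locally integrable function on `(-1, 1)` whose weak derivative vanishes is constant. -/
lemma ae_eq_const_of_isWeakDeriv_zero [CompleteSpace E] {u : ℝ → E} (h : IsWeakDeriv u 0) :
    ∃ c : E, u =ᵐ[intervalMeasure] fun _ => c := by
  let b : ContDiffBump (0 : ℝ) := ⟨1 / 4, 1 / 2, by norm_num, by norm_num⟩
  have hb1 : ContDiff ℝ ∞ (b.normed volume) := b.contDiff_normed
  have hb2 : HasCompactSupport (b.normed volume) := b.hasCompactSupport_normed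
  have hb3 : tsupport (b.normed volume) ⊆ Ioo (-1 : ℝ) 1 := by
    rw [b.tsupport_normed_eq]
    intro x hx
    have h1 : |x| ≤ b.rOut := by simpa using hx
    have h2 := abs_le.1 (h1.trans_eq (show b.rOut = 1 / 2 from rfl))
    constructor <;> linarith
  have hb4 : ∫ s in Ioo (-1 : ℝ) 1, b.normed volume s = 1 := by
    rw [setIntegral_eq_integral_of_forall_compl_eq_zero, b.integral_normed]
    exact fun x hx => image_eq_zero_of_notMem_tsupport fun hx' => hx (hb3 hx')
  set ψ := b.normed volume with hψ
  set c := ∫ s in Ioo (-1 : ℝ) 1, ψ s • u s with hcdef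
  refine ⟨c, ?_⟩
  have hcl : LocallyIntegrableOn (fun s => u s - c) (Ioo (-1 : ℝ) 1) :=
    h.1.sub ((locallyIntegrable_const c).locallyIntegrableOn _)
  have key := isOpen_Ioo.ae_eq_zero_of_integral_contDiff_smul_eq_zero hcl fun φ h1 h2 h3 => ?_
  · rw [Filter.EventuallyEq, ae_restrict_iff' measurableSet_Ioo]
    filter_upwards [key] with s hs hsI using sub_eq_zero.1 (hs hsI)
  · set a := ∫ s in Ioo (-1 : ℝ) 1, φ s with ha
    have hφi : IntegrableOn φ (Ioo (-1 : ℝ) 1) :=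
      (h1.continuous.integrable_of_hasCompactSupport h2).integrableOn
    have hψi : IntegrableOn ψ (Ioo (-1 : ℝ) 1) :=
      (hb1.continuous.integrable_of_hasCompactSupport hb2).integrableOn
    have hts : tsupport (fun s => φ s - a * ψ s) ⊆ tsupport φ ∪ tsupport ψ := by
      refine closure_minimal (fun s hs => ?_)
        ((isClosed_tsupport _).union (isClosed_tsupport _))
      by_contra hcon
      rw [mem_union, not_or] at hcon
      refine hs ?_
      simp [image_eq_zero_of_notMem_tsupport hcon.1, image_eq_zero_of_notMem_tsupport hcon.2]
    -- As ψ has integral one, φ - (∫ φ) ψ has integral zero and is therefore the derivative of a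
    -- test function; pairing with u gives ∫ φ u = (∫ φ) c.
    obtain ⟨χ, k1, k2, k3, k4⟩ := exists_test_primitive (χ := fun s => φ s - a * ψ s)
      (h1.sub (contDiff_const.mul hb1))
      ((h2.isCompact.union hb2.isCompact).of_isClosed_subset (isClosed_tsupport _) hts)
      (hts.trans (union_subset h3 hb3))
      (by rw [integral_sub hφi (hψi.const_mul a), integral_const_mul, hb4, ← ha]; ring)
    have := h.2.2 χ k1 k2 k3
    rw [k4] at this
    have i1 := integrableOn_smul_test h.1 h1.continuous h2 h3
    have i2 := integrableOn_smul_test h.1 hb1.continuous hb2 hb3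
    have e1 : ∫ s in Ioo (-1 : ℝ) 1, φ s • u s = a • c := by
      simp only [sub_smul, mul_smul, Pi.zero_apply, smul_zero, integral_zero, neg_zero] at this
      have i3 : IntegrableOn (fun s => a • ψ s • u s) (Ioo (-1 : ℝ) 1) := i2.smul a
      rw [integral_sub i1 i3, integral_smul] at this
      exact sub_eq_zero.1 this
    have e2 : ∫ s, φ s • (u s - c) = ∫ s in Ioo (-1 : ℝ) 1, φ s • (u s - c) := by
      rw [setIntegral_eq_integral_of_forall_compl_eq_zero]
      intro x hx
      rw [image_eq_zero_of_notMem_tsupport fun hx' => hx (h3 hx'), zero_smul]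
    rw [e2]
    simp only [smul_sub]
    rw [integral_sub i1 (hφi.smul_const c), e1, integral_smul_const, ← ha, sub_self]

/-- The representation of a function with a weak derivative as an indefinite integral. -/
lemma IsWeakDeriv.exists_isPrimitive [CompleteSpace E] {f g : ℝ → E} (h : IsWeakDeriv f g) :
    ∃ F : ℝ → E, f =ᵐ[intervalMeasure] F ∧ IsPrimitive F g := by
  have hG : IsPrimitive (fun x => ∫ t in (0 : ℝ)..x, g t) g := ⟨h.2.1, fun x _ => by simp⟩
  have h0 : IsWeakDeriv (f + (-1 : ℝ) • fun x => ∫ t in (0 : ℝ)..x, g t) 0 := by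
    refine (h.add (hG.isWeakDeriv.smul (-1))).congr (Eventually.of_forall fun _ => rfl) ?_
    exact Eventually.of_forall fun s => by simp
  obtain ⟨c, hc⟩ := ae_eq_const_of_isWeakDeriv_zero h0
  refine ⟨fun s => c + ∫ t in (0 : ℝ)..s, g t, ?_, h.2.1, fun s _ => by simp⟩
  filter_upwards [hc] with s hs
  simp only [Pi.add_apply, neg_smul, one_smul, Pi.neg_apply] at hs
  rw [← hs]; abel

/-! ### The weight and weighted square integrability -/

/-- The square root `√(1 - s ^ 2)` of the weight. -/
def sqrtWeight (s : ℝ) : ℝ := √(1 - s ^ 2)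

lemma one_sub_sq_pos {s : ℝ} (hs : s ∈ Ioo (-1 : ℝ) 1) : 0 < 1 - s ^ 2 := by
  nlinarith [hs.1, hs.2]

lemma sqrtWeight_pos {s : ℝ} (hs : s ∈ Ioo (-1 : ℝ) 1) : 0 < sqrtWeight s :=
  Real.sqrt_pos.2 (one_sub_sq_pos hs)

lemma sqrtWeight_sq {s : ℝ} (hs : s ∈ Ioo (-1 : ℝ) 1) : sqrtWeight s ^ 2 = 1 - s ^ 2 :=
  Real.sq_sqrt (one_sub_sq_pos hs).le

lemma sqrtWeight_le_one (s : ℝ) : sqrtWeight s ≤ 1 := by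
  rw [sqrtWeight, Real.sqrt_le_iff]
  constructor <;> nlinarith [sq_nonneg s]

lemma sqrtWeight_nonneg (s : ℝ) : 0 ≤ sqrtWeight s := Real.sqrt_nonneg _

lemma sqrtWeight_neg (s : ℝ) : sqrtWeight (-s) = sqrtWeight s := by simp [sqrtWeight]

lemma continuous_sqrtWeight : Continuous sqrtWeight := by unfold sqrtWeight; fun_prop

section Measure

lemma aestronglyMeasurable_weight_iff {f : ℝ → E} {k : ℕ} :
    AEStronglyMeasurable f (weightMeasure k) ↔ AEStronglyMeasurable f intervalMeasure :=
  ⟨fun h => h.mono_ac (ac_weightMeasure k), fun h => h.mono_ac (weightMeasure_ac k)⟩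

/-- On the interval (1 - s²)^k = w^{2k} with w = √(1 - s²), so half of the exponent goes into the
function. All later powers of `sqrtWeight` follow this count. -/
lemma eLpNorm_weight (f : ℝ → E) (k : ℕ) :
    eLpNorm f 2 (weightMeasure k) = eLpNorm (fun s => sqrtWeight s ^ k • f s) 2 intervalMeasure := by
  rw [eLpNorm_eq_lintegral_rpow_enorm_toReal (by norm_num) (by norm_num),
    eLpNorm_eq_lintegral_rpow_enorm_toReal (by norm_num) (by norm_num), weightMeasure,
    lintegral_withDensity_eq_lintegral_mul_non_measurable _ (by fun_prop)
      (Eventually.of_forall fun _ => ENNReal.ofReal_lt_top)]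
  congr 1
  refine setLIntegral_congr_fun measurableSet_Ioo fun s hs => ?_
  have h1 : ‖sqrtWeight s ^ k‖ₑ = ENNReal.ofReal (sqrtWeight s ^ k) :=
    Real.enorm_of_nonneg (pow_nonneg (sqrtWeight_nonneg s) k)
  simp only [Pi.mul_apply, enorm_smul, h1, ENNReal.toReal_ofNat]
  rw [ENNReal.mul_rpow_of_nonneg _ _ (by norm_num)]
  congr 1
  rw [ENNReal.ofReal_rpow_of_nonneg (pow_nonneg (sqrtWeight_nonneg s) k) (by norm_num)]
  congr 1
  rw [← sqrtWeight_sq hs, Real.rpow_two, pow_right_comm]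

lemma memLp_weight_iff {f : ℝ → E} {k : ℕ} : MemLp f 2 (weightMeasure k) ↔
    AEStronglyMeasurable f intervalMeasure ∧
      MemLp (fun s => sqrtWeight s ^ k • f s) 2 intervalMeasure := by
  constructor
  · intro h
    have h1 := aestronglyMeasurable_weight_iff.1 h.1
    refine ⟨h1, ?_, by rw [← eLpNorm_weight]; exact h.2⟩
    exact (continuous_sqrtWeight.pow k).aestronglyMeasurable.smul h1
  · rintro ⟨h1, h2⟩
    exact ⟨aestronglyMeasurable_weight_iff.2 h1, by rw [eLpNorm_weight]; exact h2.2⟩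

lemma exists_le_mul_sqrtWeight_pow {K : Set ℝ} (hK : IsCompact K) (hs : K ⊆ Ioo (-1 : ℝ) 1)
    {ψ : ℝ → ℝ} (hψ : ContinuousOn ψ K) (k : ℕ) :
    ∃ C : ℝ, 0 ≤ C ∧ ∀ s ∈ K, ‖ψ s‖ ≤ C * sqrtWeight s ^ k := by
  have hc : ContinuousOn (fun s => ψ s / sqrtWeight s ^ k) K :=
    hψ.div (continuous_sqrtWeight.pow k).continuousOn
      fun s h => (pow_pos (sqrtWeight_pos (hs h)) k).ne'
  obtain ⟨C, hC⟩ := hK.exists_bound_of_continuousOn hc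
  refine ⟨max C 0, le_max_right _ _, fun s h => ?_⟩
  have hp := pow_pos (sqrtWeight_pos (hs h)) k
  have h1 := (hC s h).trans (le_max_left C 0)
  rwa [norm_div, Real.norm_of_nonneg hp.le, div_le_iff₀ hp] at h1

lemma locallyIntegrableOn_of_memLp_weight {f : ℝ → E} {k : ℕ} (hf : MemLp f 2 (weightMeasure k)) :
    LocallyIntegrableOn f (Ioo (-1 : ℝ) 1) := by
  rw [locallyIntegrableOn_iff isOpen_Ioo.isLocallyClosed]
  intro K hs hK
  obtain ⟨h1, h2⟩ := memLp_weight_iff.1 hf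
  obtain ⟨C, hC0, hC⟩ := exists_le_mul_sqrtWeight_pow hK hs (ψ := fun _ => 1) continuousOn_const k
  have h3 : IntegrableOn (fun s => sqrtWeight s ^ k • f s) K :=
    IntegrableOn.mono_set (t := Ioo (-1 : ℝ) 1) (h2.integrable one_le_two) hs
  refine Integrable.mono' (h3.norm.const_mul C) (h1.mono_measure (Measure.restrict_mono hs le_rfl))
    ?_
  filter_upwards [ae_restrict_mem hK.measurableSet] with s hsK
  have := hC s hsK
  rw [norm_smul, Real.norm_of_nonneg (pow_nonneg (sqrtWeight_nonneg s) k), ← mul_assoc]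
  refine le_mul_of_one_le_left (norm_nonneg _) (by simpa using this)

/-- On the support of ψ the weight is bounded below, so weighted L² convergence gives L¹ convergence
of the products with ψ. Weak derivative identities thus pass to limits. -/
lemma tendsto_integral_test {k : ℕ} {u : ℕ → Lp E 2 (weightMeasure k)} {f : Lp E 2 (weightMeasure k)}
    (h : Tendsto u atTop (𝓝 f)) {ψ : ℝ → ℝ} (hψ : Continuous ψ) (hc : HasCompactSupport ψ)
    (hs : tsupport ψ ⊆ Ioo (-1 : ℝ) 1) :
    Tendsto (fun n => ∫ s in Ioo (-1 : ℝ) 1, ψ s • u n s) atTop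
      (𝓝 (∫ s in Ioo (-1 : ℝ) 1, ψ s • f s)) := by
  have hi : ∀ g : Lp E 2 (weightMeasure k), IntegrableOn (fun s => ψ s • g s) (Ioo (-1 : ℝ) 1) :=
    fun g => integrableOn_smul_test (locallyIntegrableOn_of_memLp_weight (Lp.memLp g)) hψ hc hs
  refine tendsto_integral_of_L1' _ (hi f).1 (Eventually.of_forall fun n => hi (u n)) ?_
  obtain ⟨C, hC0, hC⟩ := exists_le_mul_sqrtWeight_pow hc hs hψ.continuousOn k
  have h1 := (Lp.tendsto_Lp_iff_tendsto_eLpNorm'' (fun n => u n) (fun n => Lp.memLp (u n)) f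
    (Lp.memLp f)).1 (by simpa using h)
  have h2 : ∀ n, eLpNorm ((fun s => ψ s • u n s) - fun s => ψ s • f s) 1 intervalMeasure ≤
      ENNReal.ofReal C * (eLpNorm (⇑(u n) - ⇑f) 2 (weightMeasure k) *
        (intervalMeasure univ) ^ (1 / (1 : ℝ≥0∞).toReal - 1 / (2 : ℝ≥0∞).toReal)) := by
    intro n
    have hm := (memLp_weight_iff.1 ((Lp.memLp (u n)).sub (Lp.memLp f))).2
    rw [eLpNorm_weight]
    refine le_trans ?_ (mul_le_mul_right
      (eLpNorm_le_eLpNorm_mul_rpow_measure_univ one_le_two hm.1) _)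
    refine eLpNorm_le_mul_eLpNorm_of_ae_le_mul (Eventually.of_forall fun s => ?_) 1
    simp only [Pi.sub_apply, ← smul_sub, norm_smul]
    rw [← mul_assoc]
    refine mul_le_mul_of_nonneg_right ?_ (norm_nonneg _)
    rw [Real.norm_of_nonneg (pow_nonneg (sqrtWeight_nonneg s) k)]
    by_cases hsu : s ∈ tsupport ψ
    · exact hC s hsu
    · rw [image_eq_zero_of_notMem_tsupport hsu, norm_zero]
      exact mul_nonneg hC0 (pow_nonneg (sqrtWeight_nonneg s) k)
  refine tendsto_of_tendsto_of_tendsto_of_le_of_le tendsto_const_nhds ?_ (fun _ => zero_le) h2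
  have hfin : (intervalMeasure univ) ^ (1 / (1 : ℝ≥0∞).toReal - 1 / (2 : ℝ≥0∞).toReal) ≠ ⊤ :=
    ENNReal.rpow_ne_top_of_nonneg (by norm_num) (measure_ne_top _ _)
  have := ENNReal.Tendsto.const_mul (ENNReal.Tendsto.mul_const h1 (Or.inr hfin))
    (Or.inr (ENNReal.ofReal_ne_top (r := C)))
  simpa using this

lemma exists_subseq_tendsto_ae {k : ℕ} {u : ℕ → Lp E 2 (weightMeasure k)}
    {f : Lp E 2 (weightMeasure k)} (h : Tendsto u atTop (𝓝 f)) :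
    ∃ φ : ℕ → ℕ, StrictMono φ ∧
      ∀ᵐ s ∂intervalMeasure, Tendsto (fun n => u (φ n) s) atTop (𝓝 (f s)) := by
  obtain ⟨φ, h1, h2⟩ := (tendstoInMeasure_of_tendsto_Lp h).exists_seq_tendsto_ae
  exact ⟨φ, h1, (ac_weightMeasure k).ae_le h2⟩

end Measure

/-! ### Jets: uniqueness of derivatives, construction, completeness -/

section Jets

variable {a n : ℕ}

/-- The `j`-th derivative recorded by a jet, as a function on the line (zero if `j > n`). -/
def jet (f : JetSpace E a n) (j : ℕ) : ℝ → E := if h : j < n + 1 then f ⟨j, h⟩ else 0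

lemma jet_of_lt (f : JetSpace E a n) {j : ℕ} (h : j < n + 1) : jet f j = f ⟨j, h⟩ := dif_pos h

lemma jet_of_le (f : JetSpace E a n) {j : ℕ} (h : j ≤ n) :
    jet f j = f ⟨j, Nat.lt_succ_of_le h⟩ := jet_of_lt f _

lemma toFun_eq_jet {m : ℕ} (ξ : evenSpace E m) : toFun ξ = jet ξ.1 0 := by
  rw [jet_of_le _ (Nat.zero_le m)]; rfl

lemma velocity_eq_jet {m : ℕ} (η : curveSpace (m + 1)) : velocity η = jet η.1 1 := by
  rw [jet_of_le _ (Nat.le_add_left 1 m)]; rfl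

lemma memLp_jet (f : JetSpace E a n) (j : ℕ) : MemLp (jet f j) 2 (weightMeasure (a + j)) := by
  by_cases h : j < n + 1
  · rw [jet_of_lt f h]; exact Lp.memLp (f ⟨j, h⟩)
  · rw [jet, dif_neg h]; exact MemLp.zero

lemma isWeakDeriv_jet {f : JetSpace E a n} (hf : f ∈ weightedSobolev E a n) {j : ℕ} (hj : j < n) :
    IsWeakDeriv (jet f j) (jet f (j + 1)) := by
  rw [jet_of_le f hj.le, jet_of_le f (Nat.succ_le_of_lt hj)]
  exact hf ⟨j, hj⟩

lemma jet_add (f g : JetSpace E a n) (j : ℕ) :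
    jet (f + g) j =ᵐ[intervalMeasure] jet f j + jet g j := by
  by_cases h : j < n + 1
  · rw [jet_of_lt _ h, jet_of_lt _ h, jet_of_lt _ h]
    exact coeFn_add_interval (f ⟨j, h⟩) (g ⟨j, h⟩)
  · simp only [jet, dif_neg h]
    exact Eventually.of_forall fun s => by simp

lemma jet_smul (c : ℝ) (f : JetSpace E a n) (j : ℕ) :
    jet (c • f) j =ᵐ[intervalMeasure] c • jet f j := by
  by_cases h : j < n + 1
  · rw [jet_of_lt _ h, jet_of_lt _ h]
    exact coeFn_smul_interval c (f ⟨j, h⟩)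
  · simp only [jet, dif_neg h]
    exact Eventually.of_forall fun s => by simp

lemma IsWeakDeriv.ae_unique [CompleteSpace E] {f f' g g' : ℝ → E} (h : IsWeakDeriv f g)
    (h' : IsWeakDeriv f' g') (e : f =ᵐ[intervalMeasure] f') : g =ᵐ[intervalMeasure] g' := by
  obtain ⟨F, h1, h2⟩ := h.exists_isPrimitive
  obtain ⟨F', h1', h2'⟩ := h'.exists_isPrimitive
  exact h2.ae_unique (h2'.congr_left (h2'.eqOn_of_ae_eq h2 ((h1'.symm.trans e.symm).trans h1)))

/-- Uniqueness of weak derivatives propagates equality upwards. The starting order i is free so that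
curves can be compared from their velocities on. -/
lemma jet_ae_eq [CompleteSpace E] {f g : JetSpace E a n} (hf : f ∈ weightedSobolev E a n)
    (hg : g ∈ weightedSobolev E a n) {i : ℕ} (h : jet f i =ᵐ[intervalMeasure] jet g i) :
    ∀ j, i ≤ j → jet f j =ᵐ[intervalMeasure] jet g j := by
  intro j hj
  induction j, hj using Nat.le_induction with
  | base => exact h
  | succ j hj ih =>
    by_cases hjn : j < n
    · exact (isWeakDeriv_jet hf hjn).ae_unique (isWeakDeriv_jet hg hjn) ih
    · have : ¬ j + 1 < n + 1 := by omega
      simp only [jet, dif_neg this]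
      rfl

lemma ext_of_jet {f g : JetSpace E a n} (h : ∀ j ≤ n, jet f j =ᵐ[intervalMeasure] jet g j) :
    f = g := by
  refine PiLp.ext fun j => Lp.ext ?_
  have h1 := h j (Nat.le_of_lt_succ j.2)
  rw [jet_of_lt f j.2, jet_of_lt g j.2] at h1
  exact (weightMeasure_ac _).ae_eq h1

lemma evenSpace_ext [CompleteSpace E] {m : ℕ} {ξ ζ : evenSpace E m}
    (h : toFun ξ =ᵐ[intervalMeasure] toFun ζ) : ξ = ζ := by
  rw [toFun_eq_jet, toFun_eq_jet] at h
  exact Subtype.ext (ext_of_jet fun j _ => jet_ae_eq ξ.2.1 ζ.2.1 h j (Nat.zero_le j))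

lemma exists_mem_weightedSobolev (u : ℕ → ℝ → E)
    (hu : ∀ j ≤ n, MemLp (u j) 2 (weightMeasure (a + j)))
    (hd : ∀ j < n, IsWeakDeriv (u j) (u (j + 1))) :
    ∃ f ∈ weightedSobolev E a n, ∀ j ≤ n, jet f j =ᵐ[intervalMeasure] u j := by
  let f : JetSpace E a n := WithLp.toLp 2 fun j => (hu j (Nat.le_of_lt_succ j.2)).toLp (u j)
  have h : ∀ j (hj : j ≤ n), jet f j =ᵐ[intervalMeasure] u j := fun j hj => by
    rw [jet_of_le f hj]
    exact (ac_weightMeasure _).ae_eq (hu j hj).coeFn_toLp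
  refine ⟨f, fun j => ?_, h⟩
  have h1 := h j j.2.le
  have h2 := h (j + 1) j.2
  rw [jet_of_le f j.2.le] at h1
  rw [jet_of_le f (Nat.succ_le_of_lt j.2)] at h2
  exact (hd j j.2).congr h1.symm h2.symm

lemma exists_evenSpace {m : ℕ} (u : ℕ → ℝ → E)
    (hu : ∀ j ≤ m, MemLp (u j) 2 (weightMeasure (1 + j)))
    (hd : ∀ j < m, IsWeakDeriv (u j) (u (j + 1)))
    (he : ∀ᵐ s ∂intervalMeasure, u 0 (-s) = u 0 s) :
    ∃ ξ : evenSpace E m, ∀ j ≤ m, jet ξ.1 j =ᵐ[intervalMeasure] u j := by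
  obtain ⟨f, h1, h2⟩ := exists_mem_weightedSobolev u hu hd
  refine ⟨⟨f, h1, ?_⟩, h2⟩
  have h3 := h2 0 (Nat.zero_le m)
  rw [jet_of_le f (Nat.zero_le m)] at h3
  filter_upwards [h3, measurePreserving_neg_interval.quasiMeasurePreserving.ae h3, he]
    with s k1 k2 k3
  change f ⟨0, _⟩ (-s) = (1 : ℝ) • f ⟨0, _⟩ s
  rw [k1, k2, k3, one_smul]

lemma ae_even {m : ℕ} (ξ : evenSpace E m) : ∀ᵐ s ∂intervalMeasure, toFun ξ (-s) = toFun ξ s := by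
  filter_upwards [ξ.2.2] with s hs
  rw [one_smul] at hs
  exact hs

lemma tendsto_jet_component {u : ℕ → JetSpace E a n} {f : JetSpace E a n}
    (h : Tendsto u atTop (𝓝 f)) (j : Fin (n + 1)) :
    Tendsto (fun k => u k j) atTop (𝓝 (f j)) :=
  ((PiLp.continuous_apply 2 _ j).tendsto f).comp h

lemma exists_subseq_tendsto_ae_jet {u : ℕ → JetSpace E a n} {f : JetSpace E a n}
    (h : Tendsto u atTop (𝓝 f)) {j : ℕ} (hj : j ≤ n) :
    ∃ φ : ℕ → ℕ, StrictMono φ ∧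
      ∀ᵐ s ∂intervalMeasure, Tendsto (fun k => jet (u (φ k)) j s) atTop (𝓝 (jet f j s)) := by
  obtain ⟨φ, h1, h2⟩ := exists_subseq_tendsto_ae
    (tendsto_jet_component h ⟨j, Nat.lt_succ_of_le hj⟩)
  exact ⟨φ, h1, by simpa only [jet_of_le _ hj] using h2⟩

lemma isClosed_weightedSobolev : IsClosed (weightedSobolev E a n : Set (JetSpace E a n)) := by
  refine IsSeqClosed.isClosed fun u f hu h j => ?_
  refine ⟨locallyIntegrableOn_of_memLp_weight (Lp.memLp _),
    locallyIntegrableOn_of_memLp_weight (Lp.memLp _), fun φ h1 h2 h3 => ?_⟩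
  have hds : tsupport (deriv φ) ⊆ Ioo (-1 : ℝ) 1 := (tsupport_deriv_subset).trans h3
  refine tendsto_nhds_unique (tendsto_integral_test (tendsto_jet_component h j.castSucc)
    (h1.continuous_deriv (by simp)) h2.deriv hds) ?_
  refine (tendsto_integral_test (tendsto_jet_component h j.succ) h1.continuous h2 h3).neg.congr
    fun k => ?_
  exact ((hu k j).2.2 φ h1 h2 h3).symm

/-- A subsequence converges almost everywhere, and reflection preserves null sets, so the limit can
be taken at s and at -s together. -/
lemma isClosed_paritySubmodule (ε : ℝ) :
    IsClosed (paritySubmodule E ε a n : Set (JetSpace E a n)) := by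
  refine IsSeqClosed.isClosed fun u f hu h => ?_
  obtain ⟨φ, -, h2⟩ := exists_subseq_tendsto_ae (tendsto_jet_component h 0)
  have h3 : ∀ᵐ s ∂intervalMeasure, ∀ k, u (φ k) 0 (-s) = ε • u (φ k) 0 s :=
    ae_all_iff.2 fun k => hu (φ k)
  filter_upwards [h2, measurePreserving_neg_interval.quasiMeasurePreserving.ae h2, h3]
    with s k1 k2 k3
  exact tendsto_nhds_unique k2 ((k1.const_smul ε).congr fun k => (k3 k).symm)

instance completeSpace_evenSpace [CompleteSpace E] (m : ℕ) : CompleteSpace (evenSpace E m) :=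
  (isClosed_weightedSobolev.inter (isClosed_paritySubmodule 1)).completeSpace_coe

instance completeSpace_curveSpace (n : ℕ) : CompleteSpace (curveSpace n) :=
  (isClosed_weightedSobolev.inter (isClosed_paritySubmodule (-1))).completeSpace_coe

end Jets

/-! ### Parity of derivatives -/

section Parity

lemma neg_mem_interval {s : ℝ} (hs : s ∈ Ioo (-1 : ℝ) 1) : -s ∈ Ioo (-1 : ℝ) 1 :=
  ⟨by linarith [hs.2], by linarith [hs.1]⟩

lemma ae_comp_neg {p : ℝ → Prop} (h : ∀ᵐ s ∂intervalMeasure, p s) :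
    ∀ᵐ s ∂intervalMeasure, p (-s) :=
  measurePreserving_neg_interval.quasiMeasurePreserving.ae h

lemma IsPrimitive.comp_neg [CompleteSpace E] {F g : ℝ → E} (hF : IsPrimitive F g) :
    IsPrimitive (fun s => F (-s)) (fun s => -g (-s)) := by
  refine ⟨?_, fun s hs => ?_⟩
  · refine LocallyIntegrableOn.neg ?_
    rw [locallyIntegrableOn_iff isOpen_Ioo.isLocallyClosed]
    intro K hK hKc
    have hK' : -K ⊆ Ioo (-1 : ℝ) 1 := fun s hs => by
      simpa using neg_mem_interval (hK hs)
    have h1 := hF.1.integrableOn_compact_subset hK' hKc.neg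
    have h2 := ((Measure.measurePreserving_neg (volume : Measure ℝ)).integrableOn_comp_preimage
      (Homeomorph.neg ℝ).measurableEmbedding (s := -K)).2 h1
    simpa [Function.comp_def] using h2
  · have h1 := hF.2 (-s) (neg_mem_interval hs)
    have h2 : ∫ t in (0 : ℝ)..s, -g (-t) = ∫ t in (0 : ℝ)..(-s), g t := by
      rw [intervalIntegral.integral_neg, intervalIntegral.integral_comp_neg, neg_zero,
        intervalIntegral.integral_symm, neg_neg]
    simp only [neg_zero]
    rw [h1, h2]

/-- The reflected function s ↦ f (-s) has weak derivative -g (-s), and as ε f it has weak derivative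
ε g. -/
lemma IsWeakDeriv.ae_parity [CompleteSpace E] {f g : ℝ → E} (h : IsWeakDeriv f g) {ε : ℝ}
    (hf : ∀ᵐ s ∂intervalMeasure, f (-s) = ε • f s) :
    ∀ᵐ s ∂intervalMeasure, g (-s) = (-ε) • g s := by
  obtain ⟨F, h1, h2⟩ := h.exists_isPrimitive
  have h3 : (fun s => F (-s)) =ᵐ[intervalMeasure] ε • f := by
    filter_upwards [ae_comp_neg h1, hf] with s k1 k2
    rw [← k1, k2]; rfl
  filter_upwards [h2.comp_neg.isWeakDeriv.ae_unique (h.smul ε) h3] with s hs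
  rw [neg_smul, ← neg_eq_iff_eq_neg]
  exact hs

end Parity

/-! ### Continuous representatives -/

section Representatives

variable {a n : ℕ}

/-- The derivatives of order `< n` of a function in a weighted Sobolev space have continuous
representatives, each an indefinite integral of the next one. -/
lemma exists_representatives [CompleteSpace E] {f : JetSpace E a n}
    (hf : f ∈ weightedSobolev E a n) :
    ∃ F : ℕ → ℝ → E, (∀ j, jet f j =ᵐ[intervalMeasure] F j) ∧
      ∀ j < n, IsPrimitive (F j) (F (j + 1)) := by
  have h : ∀ j, ∃ G : ℝ → E, jet f j =ᵐ[intervalMeasure] G ∧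
      (j < n → IsPrimitive G (jet f (j + 1))) := fun j => by
    by_cases hj : j < n
    · obtain ⟨G, h1, h2⟩ := (isWeakDeriv_jet hf hj).exists_isPrimitive
      exact ⟨G, h1, fun _ => h2⟩
    · exact ⟨jet f j, EventuallyEq.rfl, fun h => absurd h hj⟩
  choose F h1 h2 using h
  exact ⟨F, h1, fun j hj => (h2 j hj).congr_right (h1 (j + 1))⟩

lemma memLp_representative {f : JetSpace E a n} {j : ℕ} {G : ℝ → E}
    (h : jet f j =ᵐ[intervalMeasure] G) : MemLp G 2 (weightMeasure (a + j)) :=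
  (memLp_congr_ae ((weightMeasure_ac _).ae_eq h)).1 (memLp_jet f j)

end Representatives

/-! ### Boundedness of pointwise operations by the closed graph theorem -/

section FunctionSpaces

variable {X Y Z : Type*} [NormedAddCommGroup X] [NormedSpace ℝ X] [NormedAddCommGroup Y]
  [NormedSpace ℝ Y] [NormedAddCommGroup Z] [NormedSpace ℝ Z]
variable {E₁ E₂ E₃ : Type*} [NormedAddCommGroup E₁] [NormedSpace ℝ E₁] [NormedAddCommGroup E₂]
  [NormedSpace ℝ E₂] [NormedAddCommGroup E₃] [NormedSpace ℝ E₃]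

/-- `c` realizes the elements of the normed space `X` as functions on `(-1, 1)`, linearly, and in
such a way that convergent sequences have subsequences converging almost everywhere. -/
structure IsRealization (c : X → ℝ → E₁) : Prop where
  add : ∀ x y, c (x + y) =ᵐ[intervalMeasure] c x + c y
  smul : ∀ (r : ℝ) x, c (r • x) =ᵐ[intervalMeasure] r • c x
  exists_subseq : ∀ (u : ℕ → X) x, Tendsto u atTop (𝓝 x) → ∃ φ : ℕ → ℕ, StrictMono φ ∧
    ∀ᵐ s ∂intervalMeasure, Tendsto (fun n => c (u (φ n)) s) atTop (𝓝 (c x s))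

lemma isRealization_jet {a n : ℕ} (S : Submodule ℝ (JetSpace E a n)) {j : ℕ} (hj : j ≤ n) :
    IsRealization fun x : S => jet x.1 j where
  add x y := jet_add x.1 y.1 j
  smul r x := jet_smul r x.1 j
  exists_subseq _ x h := exists_subseq_tendsto_ae_jet
    ((continuous_subtype_val.tendsto x).comp h) hj

lemma isRealization_toFun (m : ℕ) : IsRealization (toFun : evenSpace E m → ℝ → E) := by
  have := isRealization_jet (evenSpace E m) (Nat.zero_le m)
  simpa only [← toFun_eq_jet] using this

lemma isRealization_velocity (m : ℕ) : IsRealization (velocity : curveSpace (m + 1) → ℝ → ℂ) := by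
  have := isRealization_jet (curveSpace (m + 1)) (Nat.le_add_left 1 m)
  simpa only [← velocity_eq_jet] using this

lemma isRealization_Lp (k : ℕ) : IsRealization fun f : Lp E 2 (weightMeasure k) => ⇑f where
  add := coeFn_add_interval
  smul := coeFn_smul_interval
  exists_subseq _ _ h := exists_subseq_tendsto_ae h

/-- A linear operator defined pointwise between function spaces is bounded: its graph is closed. -/
lemma exists_clm_of_pointwise [CompleteSpace X] [CompleteSpace Y] {cX : X → ℝ → E₁}
    {cY : Y → ℝ → E₂} (hX : IsRealization cX) (hY : IsRealization cY)
    (inj : ∀ y y', cY y =ᵐ[intervalMeasure] cY y' → y = y') (Ψ : ℝ → E₁ →L[ℝ] E₂)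
    (hex : ∀ x, ∃ y, ∀ᵐ s ∂intervalMeasure, cY y s = Ψ s (cX x s)) :
    ∃ T : X →L[ℝ] Y, ∀ x, ∀ᵐ s ∂intervalMeasure, cY (T x) s = Ψ s (cX x s) := by
  choose T hT using hex
  let T' : X →ₗ[ℝ] Y :=
    { toFun := T
      map_add' := fun x y => inj _ _ <| by
        filter_upwards [hT (x + y), hT x, hT y, hX.add x y, hY.add (T x) (T y)]
          with s h1 h2 h3 h4 h5
        rw [h1, h5, h4, Pi.add_apply, Pi.add_apply, map_add, h2, h3]
      map_smul' := fun r x => inj _ _ <| by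
        filter_upwards [hT (r • x), hT x, hX.smul r x, hY.smul r (T x)] with s h1 h2 h3 h4
        rw [h1, RingHom.id_apply, h4, h3, Pi.smul_apply, Pi.smul_apply, map_smul, h2] }
  -- If u n → x and T (u n) → y, a common subsequence converges almost everywhere on both sides, so
  -- y and T x are the same function.
  refine ⟨⟨T', T'.continuous_of_seq_closed_graph fun u x y hu hTu => inj _ _ ?_⟩, hT⟩
  obtain ⟨φ, h1, h2⟩ := hX.exists_subseq u x hu
  obtain ⟨ψ, h3, h4⟩ := hY.exists_subseq _ y (hTu.comp h1.tendsto_atTop)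
  have h5 : ∀ᵐ s ∂intervalMeasure, ∀ n, cY (T (u (φ (ψ n)))) s = Ψ s (cX (u (φ (ψ n))) s) :=
    ae_all_iff.2 fun n => hT _
  filter_upwards [h2, h4, h5, hT x] with s k1 k2 k3 k4
  change cY y s = cY (T x) s
  rw [k4]
  refine tendsto_nhds_unique k2 ?_
  refine ((((Ψ s).continuous.tendsto _).comp k1).comp h3.tendsto_atTop).congr fun n => ?_
  exact (k3 n).symm

/-- A bilinear operation defined pointwise between function spaces is bounded. -/
lemma exists_bilin_of_pointwise [CompleteSpace X] [CompleteSpace Y] [CompleteSpace Z]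
    {cX : X → ℝ → E₁} {cY : Y → ℝ → E₂} {cZ : Z → ℝ → E₃} (hX : IsRealization cX)
    (hY : IsRealization cY) (hZ : IsRealization cZ)
    (inj : ∀ z z', cZ z =ᵐ[intervalMeasure] cZ z' → z = z') (B : E₁ →L[ℝ] E₂ →L[ℝ] E₃)
    (hex : ∀ x y, ∃ z, ∀ᵐ s ∂intervalMeasure, cZ z s = B (cX x s) (cY y s)) :
    ∃ T : X →L[ℝ] Y →L[ℝ] Z, ∀ x y, ∀ᵐ s ∂intervalMeasure,
      cZ (T x y) s = B (cX x s) (cY y s) := by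
  -- With either variable frozen the operation is bounded. The two families agree, so x ↦ T x is
  -- linear, and its graph is closed because each evaluation at y is continuous in x.
  choose T hT using fun x => exists_clm_of_pointwise hY hZ inj (fun s => B (cX x s)) (hex x)
  choose T' hT' using fun y => exists_clm_of_pointwise hX hZ inj (fun s => B.flip (cY y s))
    fun x => hex x y
  have hTT' : ∀ x y, T x y = T' y x := fun x y => inj _ _ <| by
    filter_upwards [hT x y, hT' y x] with s h1 h2
    rw [h1, h2]; rfl
  let L : X →ₗ[ℝ] Y →L[ℝ] Z :=
    { toFun := T
      map_add' := fun x y => ContinuousLinearMap.ext fun z => by simp [hTT']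
      map_smul' := fun r x => ContinuousLinearMap.ext fun z => by simp [hTT'] }
  refine ⟨⟨L, L.continuous_of_seq_closed_graph fun u x S hu hTu => ?_⟩, hT⟩
  refine ContinuousLinearMap.ext fun y => ?_
  have h1 : Tendsto (fun n => T (u n) y) atTop (𝓝 (S y)) :=
    ((ContinuousLinearMap.apply ℝ Z y).continuous.tendsto S).comp hTu
  refine tendsto_nhds_unique h1 ?_
  change Tendsto _ _ (𝓝 (T x y))
  simp only [hTT']
  exact ((T' y).continuous.tendsto x).comp hu

end FunctionSpaces

/-! ### Linear maps of the target, and constant functions -/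

section EvenMap

lemma IsWeakDeriv.clm [CompleteSpace E] [CompleteSpace E'] {f g : ℝ → E} (h : IsWeakDeriv f g)
    (L : E →L[ℝ] E') : IsWeakDeriv (fun s => L (f s)) (fun s => L (g s)) := by
  obtain ⟨F, h1, h2⟩ := h.exists_isPrimitive
  refine (h2.clm L).isWeakDeriv.congr ?_ EventuallyEq.rfl
  filter_upwards [h1] with s hs
  rw [hs]

variable [CompleteSpace E] [CompleteSpace E']

lemma exists_evenMap (m : ℕ) (L : E →L[ℝ] E') :
    ∃ T : evenSpace E m →L[ℝ] evenSpace E' m,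
      ∀ ξ, ∀ᵐ s ∂intervalMeasure, toFun (T ξ) s = L (toFun ξ s) := by
  refine exists_clm_of_pointwise (isRealization_toFun m) (isRealization_toFun m)
    (fun _ _ => evenSpace_ext) (fun _ => L) fun ξ => ?_
  obtain ⟨ζ, hζ⟩ := exists_evenSpace (fun j s => L (jet ξ.1 j s))
    (fun j _ => L.comp_memLp' (memLp_jet ξ.1 j)) (fun j hj => (isWeakDeriv_jet ξ.2.1 hj).clm L)
    (by
      filter_upwards [ae_even ξ] with s hs
      rw [toFun_eq_jet] at hs
      rw [hs])
  refine ⟨ζ, ?_⟩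
  rw [toFun_eq_jet, toFun_eq_jet]
  exact hζ 0 (Nat.zero_le m)

/-- The operator on even functions induced by a linear map of the target spaces. -/
def evenMap (m : ℕ) (L : E →L[ℝ] E') : evenSpace E m →L[ℝ] evenSpace E' m :=
  (exists_evenMap m L).choose

lemma toFun_evenMap {m : ℕ} (L : E →L[ℝ] E') (ξ : evenSpace E m) :
    ∀ᵐ s ∂intervalMeasure, toFun (evenMap m L ξ) s = L (toFun ξ s) :=
  (exists_evenMap m L).choose_spec ξ

lemma exists_evenConst (m : ℕ) (c : E) :
    ∃ ξ : evenSpace E m, ∀ᵐ s ∂intervalMeasure, toFun ξ s = c := by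
  obtain ⟨ξ, h⟩ := exists_evenSpace (m := m) (fun j _ => if j = 0 then c else 0)
    (fun j _ => by
      refine memLp_weight_iff.2 ⟨aestronglyMeasurable_const, ?_⟩
      refine MemLp.of_bound
        ((continuous_sqrtWeight.pow _).aestronglyMeasurable.smul aestronglyMeasurable_const)
        ‖if j = 0 then c else 0‖ (Eventually.of_forall fun s => ?_)
      rw [norm_smul, Real.norm_of_nonneg (pow_nonneg (sqrtWeight_nonneg s) _)]
      exact mul_le_of_le_one_left (norm_nonneg _)
        (pow_le_one₀ (sqrtWeight_nonneg s) (sqrtWeight_le_one s)))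
    (fun j _ => by
      simp only [Nat.succ_ne_zero, if_false]
      exact (IsPrimitive.const _).isWeakDeriv)
    (Eventually.of_forall fun _ => rfl)
  refine ⟨ξ, ?_⟩
  rw [toFun_eq_jet]
  exact h 0 (Nat.zero_le m)

/-- The constant functions. -/
def evenConst (m : ℕ) (c : E) : evenSpace E m := (exists_evenConst m c).choose

lemma toFun_evenConst (m : ℕ) (c : E) :
    ∀ᵐ s ∂intervalMeasure, toFun (evenConst m c) s = c := (exists_evenConst m c).choose_spec

end EvenMap

/-! ### Integrals of negative powers of the weight -/

section Weights

/-- The antiderivative is arcsin, which stays continuous up to ±1. -/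
lemma integrableOn_inv_sqrtWeight : IntegrableOn (fun s => (sqrtWeight s)⁻¹) (Ioo (-1 : ℝ) 1) := by
  have h := intervalIntegral.integrableOn_deriv_of_nonneg (a := -1) (b := 1) (g := Real.arcsin)
    (g' := fun s => (sqrtWeight s)⁻¹) Real.continuous_arcsin.continuousOn
    (fun x hx => by
      have := Real.hasDerivAt_arcsin hx.1.ne' hx.2.ne
      simpa [sqrtWeight] using this)
    (fun x _ => inv_nonneg.2 (sqrtWeight_nonneg x))
  exact h.mono_set Ioo_subset_Ioc_self

lemma hasDerivAt_sqrtWeight {s : ℝ} (hs : s ∈ Ioo (-1 : ℝ) 1) :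
    HasDerivAt sqrtWeight (-s / sqrtWeight s) s := by
  have h1 : HasDerivAt (fun t : ℝ => 1 - t ^ 2) (-(2 * s)) s := by
    simpa using (hasDerivAt_pow 2 s).const_sub 1
  have h2 := h1.sqrt (one_sub_sq_pos hs).ne'
  refine h2.congr_deriv ?_
  rw [neg_div, neg_div, mul_div_mul_left _ _ two_ne_zero]
  rfl

lemma hasDerivAt_mul_inv_sqrtWeight_pow (n : ℕ) {s : ℝ} (hs : s ∈ Ioo (-1 : ℝ) 1) :
    HasDerivAt (fun t => t * (sqrtWeight t ^ n)⁻¹)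
      ((sqrtWeight s ^ (n + 2))⁻¹ * (1 + (n - 1) * s ^ 2)) s := by
  have hp := sqrtWeight_pos hs
  have h1 := ((hasDerivAt_sqrtWeight hs).fun_pow n).fun_inv (pow_pos hp n).ne'
  have h2 := (hasDerivAt_id' s).fun_mul h1
  refine h2.congr_deriv ?_
  have e := sqrtWeight_sq hs
  cases n with
  | zero =>
    simp
    field_simp
    rw [e, sub_eq_add_neg]
  | succ n =>
    simp only [Nat.add_sub_cancel]
    field_simp
    push_cast
    linear_combination sqrtWeight s ^ (2 * n + 3) * e

lemma continuousOn_inv_sqrtWeight_pow (n : ℕ) :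
    ContinuousOn (fun t => (sqrtWeight t ^ n)⁻¹) (Ioo (-1 : ℝ) 1) :=
  (continuous_sqrtWeight.pow n).continuousOn.inv₀ fun _ hs => (pow_pos (sqrtWeight_pos hs) n).ne'

lemma one_le_inv_sqrtWeight_pow (n : ℕ) {s : ℝ} (hs : s ∈ Ioo (-1 : ℝ) 1) :
    1 ≤ (sqrtWeight s ^ n)⁻¹ :=
  (one_le_inv₀ (pow_pos (sqrtWeight_pos hs) n)).2
    (pow_le_one₀ (sqrtWeight_nonneg s) (sqrtWeight_le_one s))

/-- The function t w^{-(n+1)} has derivative w^{-(n+3)} (1 + n t²) ≥ w^{-(n+3)}, so its value at s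
dominates the integral. -/
lemma integral_inv_sqrtWeight_pow_le_of_nonneg (n : ℕ) {s : ℝ} (hs : s ∈ Ioo (-1 : ℝ) 1)
    (h0 : 0 ≤ s) :
    ∫ t in (0 : ℝ)..s, (sqrtWeight t ^ (n + 3))⁻¹ ≤ (sqrtWeight s ^ (n + 1))⁻¹ := by
  have hsub : uIcc 0 s ⊆ Ioo (-1 : ℝ) 1 := uIcc_subset_interval zero_mem_interval hs
  have hc := (continuousOn_inv_sqrtWeight_pow (n + 3)).mono hsub
  have hi1 : IntervalIntegrable (fun t => (sqrtWeight t ^ (n + 3))⁻¹) volume 0 s :=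
    hc.intervalIntegrable
  have hi2 : IntervalIntegrable (fun t => (sqrtWeight t ^ (n + 1 + 2))⁻¹ *
      (1 + (((n + 1 : ℕ) : ℝ) - 1) * t ^ 2)) volume 0 s :=
    (hc.mul (by fun_prop)).intervalIntegrable
  have h1 := intervalIntegral.integral_eq_sub_of_hasDerivAt
    (fun t ht => hasDerivAt_mul_inv_sqrtWeight_pow (n + 1) (hsub ht)) hi2
  have h2 : ∫ t in (0 : ℝ)..s, (sqrtWeight t ^ (n + 3))⁻¹ ≤
      s * (sqrtWeight s ^ (n + 1))⁻¹ - 0 * (sqrtWeight 0 ^ (n + 1))⁻¹ := by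
    rw [← h1]
    refine intervalIntegral.integral_mono_on h0 hi1 hi2 fun t ht => ?_
    refine le_mul_of_one_le_right (inv_nonneg.2 (pow_nonneg (sqrtWeight_nonneg t) _)) ?_
    push_cast
    have : (0 : ℝ) ≤ n * t ^ 2 := by positivity
    linarith
  refine h2.trans ?_
  rw [zero_mul, sub_zero]
  exact mul_le_of_le_one_left (inv_nonneg.2 (pow_nonneg (sqrtWeight_nonneg s) _)) hs.2.le

lemma integral_inv_sqrtWeight_pow_le (n : ℕ) {s : ℝ} (hs : s ∈ Ioo (-1 : ℝ) 1) :
    ∫ t in Ι 0 s, (sqrtWeight t ^ (n + 3))⁻¹ ≤ (sqrtWeight s ^ (n + 1))⁻¹ := by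
  rcases le_total 0 s with h0 | h0
  · rw [uIoc_of_le h0, ← intervalIntegral.integral_of_le h0]
    exact integral_inv_sqrtWeight_pow_le_of_nonneg n hs h0
  · have h1 := integral_inv_sqrtWeight_pow_le_of_nonneg n (neg_mem_interval hs) (by linarith)
    rw [sqrtWeight_neg] at h1
    refine le_trans (le_of_eq ?_) h1
    rw [uIoc_of_ge h0, ← intervalIntegral.integral_of_le h0]
    have := intervalIntegral.integral_comp_neg (a := s) (b := 0)
      (fun t => (sqrtWeight t ^ (n + 3))⁻¹)
    simpa only [sqrtWeight_neg, neg_zero] using this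

end Weights

/-! ### Pointwise bounds for primitives -/

section PointwiseBounds

lemma integrable_norm_sq_smul {g : ℝ → E} {k : ℕ} (hg : MemLp g 2 (weightMeasure k)) :
    IntegrableOn (fun t => ‖sqrtWeight t ^ k • g t‖ ^ 2) (Ioo (-1 : ℝ) 1) := by
  have := (memLp_weight_iff.1 hg).2.integrable_norm_pow (p := 2) two_ne_zero
  exact this

/-- Cauchy–Schwarz, obtained by integrating ‖g‖ ≤ (B/2D) w^{-2k} + (D/2B) ‖w^k g‖². -/
lemma norm_intervalIntegral_le {g : ℝ → E} {k : ℕ} (hg : MemLp g 2 (weightMeasure k)) {B D s : ℝ}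
    (hB : 0 < B) (hD : 0 < D) (hs : s ∈ Ioo (-1 : ℝ) 1)
    (h1 : ∫ t in Ioo (-1 : ℝ) 1, ‖sqrtWeight t ^ k • g t‖ ^ 2 ≤ B ^ 2)
    (h2 : ∫ t in Ι 0 s, (sqrtWeight t ^ (2 * k))⁻¹ ≤ D ^ 2) :
    ‖∫ t in (0 : ℝ)..s, g t‖ ≤ B * D := by
  have hsub : Ι 0 s ⊆ Ioo (-1 : ℝ) 1 :=
    uIoc_subset_uIcc.trans (uIcc_subset_interval zero_mem_interval hs)
  have hi1 : IntegrableOn (fun t => (sqrtWeight t ^ (2 * k))⁻¹) (Ι 0 s) :=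
    ((continuousOn_inv_sqrtWeight_pow (2 * k)).mono
      (uIcc_subset_interval zero_mem_interval hs)).intervalIntegrable.def'
  have hi2 := (integrable_norm_sq_smul hg).mono_set hsub
  have hi3 : IntegrableOn g (Ι 0 s) := (intervalIntegrable_of_locallyIntegrableOn
    (locallyIntegrableOn_of_memLp_weight hg) zero_mem_interval hs).def'
  refine intervalIntegral.norm_integral_le_integral_norm_uIoc.trans ?_
  have h3 : ∫ t in Ι 0 s, ‖g t‖ ≤ ∫ t in Ι 0 s, (B / D / 2 * (sqrtWeight t ^ (2 * k))⁻¹ +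
      D / B / 2 * ‖sqrtWeight t ^ k • g t‖ ^ 2) := by
    refine setIntegral_mono_on hi3.norm ((hi1.const_mul _).add (hi2.const_mul _))
      measurableSet_uIoc fun t ht => ?_
    have hp := pow_pos (sqrtWeight_pos (hsub ht)) k
    rw [norm_smul, Real.norm_of_nonneg hp.le, mul_comm 2 k, pow_mul]
    set a := sqrtWeight t ^ k
    have e : B / D / 2 * (a ^ 2)⁻¹ + D / B / 2 * (a * ‖g t‖) ^ 2 - ‖g t‖
        = D / B / 2 * (B / D * a⁻¹ - a * ‖g t‖) ^ 2 := by
      field_simp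
      ring
    have : 0 ≤ D / B / 2 * (B / D * a⁻¹ - a * ‖g t‖) ^ 2 := by positivity
    linarith
  refine h3.trans ?_
  rw [integral_add (hi1.const_mul _) (hi2.const_mul _), integral_const_mul, integral_const_mul]
  have h4 : ∫ t in Ι 0 s, ‖sqrtWeight t ^ k • g t‖ ^ 2 ≤ B ^ 2 :=
    (setIntegral_mono_set (integrable_norm_sq_smul hg)
      (Eventually.of_forall fun t => by positivity) hsub.eventuallyLE).trans h1
  have h5 : B / D / 2 * ∫ t in Ι 0 s, (sqrtWeight t ^ (2 * k))⁻¹ ≤ B / D / 2 * D ^ 2 := by gcongr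
  have h6 : D / B / 2 * ∫ t in Ι 0 s, ‖sqrtWeight t ^ k • g t‖ ^ 2 ≤ D / B / 2 * B ^ 2 := by gcongr
  refine (add_le_add h5 h6).trans (le_of_eq ?_)
  field_simp
  ring

/-- Here D = w(s)^{-(k+1)}, because the integral of w^{-(2k+4)} from 0 to s is at most
w(s)^{-(2k+2)} in absolute value. -/
lemma norm_intervalIntegral_le_inv_sqrtWeight_pow {g : ℝ → E} {k : ℕ}
    (hg : MemLp g 2 (weightMeasure (k + 2))) {B s : ℝ} (hB : 0 < B) (hs : s ∈ Ioo (-1 : ℝ) 1)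
    (h1 : ∫ t in Ioo (-1 : ℝ) 1, ‖sqrtWeight t ^ (k + 2) • g t‖ ^ 2 ≤ B ^ 2) :
    ‖∫ t in (0 : ℝ)..s, g t‖ ≤ B * (sqrtWeight s ^ (k + 1))⁻¹ := by
  refine norm_intervalIntegral_le hg hB (inv_pos.2 (pow_pos (sqrtWeight_pos hs) _)) hs h1 ?_
  have := integral_inv_sqrtWeight_pow_le (2 * k + 1) hs
  rw [← inv_pow, ← pow_mul]
  convert this using 3 <;> ring

lemma exists_sq_bound {g : ℝ → E} {k : ℕ} :
    ∃ B : ℝ, 0 < B ∧ ∫ t in Ioo (-1 : ℝ) 1, ‖sqrtWeight t ^ k • g t‖ ^ 2 ≤ B ^ 2 := by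
  set A := ∫ t in Ioo (-1 : ℝ) 1, ‖sqrtWeight t ^ k • g t‖ ^ 2
  have hA : 0 ≤ A := integral_nonneg fun t => by positivity
  exact ⟨A + 1, by positivity, by nlinarith⟩

namespace IsPrimitive

variable {F g : ℝ → E}

lemma norm_le_of_memLp {k : ℕ} (hF : IsPrimitive F g) (hg : MemLp g 2 (weightMeasure (k + 2))) :
    ∃ C : ℝ, 0 ≤ C ∧ ∀ s ∈ Ioo (-1 : ℝ) 1, ‖F s‖ ≤ C * (sqrtWeight s ^ (k + 1))⁻¹ := by
  obtain ⟨B, hB, h1⟩ := exists_sq_bound (g := g) (k := k + 2)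
  refine ⟨‖F 0‖ + B, by positivity, fun s hs => ?_⟩
  rw [hF.2 s hs, add_mul]
  refine (norm_add_le _ _).trans (add_le_add ?_ ?_)
  · exact le_mul_of_one_le_right (norm_nonneg _) (one_le_inv_sqrtWeight_pow _ hs)
  · exact norm_intervalIntegral_le_inv_sqrtWeight_pow hg hB hs h1

/-- Each integration improves the rate of blow-up at ±1 by two powers of w. -/
lemma norm_le_of_norm_le {C : ℝ} {n : ℕ} (hC : 0 ≤ C) (hF : IsPrimitive F g)
    (hg : ∀ s ∈ Ioo (-1 : ℝ) 1, ‖g s‖ ≤ C * (sqrtWeight s ^ (n + 3))⁻¹) :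
    ∃ C : ℝ, 0 ≤ C ∧ ∀ s ∈ Ioo (-1 : ℝ) 1, ‖F s‖ ≤ C * (sqrtWeight s ^ (n + 1))⁻¹ := by
  refine ⟨‖F 0‖ + C, by positivity, fun s hs => ?_⟩
  rw [hF.2 s hs, add_mul]
  refine (norm_add_le _ _).trans (add_le_add ?_ ?_)
  · exact le_mul_of_one_le_right (norm_nonneg _) (one_le_inv_sqrtWeight_pow _ hs)
  · refine intervalIntegral.norm_integral_le_integral_norm_uIoc.trans ?_
    have hsub : Ι 0 s ⊆ Ioo (-1 : ℝ) 1 :=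
      uIoc_subset_uIcc.trans (uIcc_subset_interval zero_mem_interval hs)
    have hi3 : IntegrableOn g (Ι 0 s) := (intervalIntegrable_of_locallyIntegrableOn
      hF.1 zero_mem_interval hs).def'
    have hi1 : IntegrableOn (fun t => (sqrtWeight t ^ (n + 3))⁻¹) (Ι 0 s) :=
      ((continuousOn_inv_sqrtWeight_pow (n + 3)).mono
        (uIcc_subset_interval zero_mem_interval hs)).intervalIntegrable.def'
    refine (setIntegral_mono_on hi3.norm (hi1.const_mul C) measurableSet_uIoc
      fun t ht => hg t (hsub ht)).trans ?_
    rw [integral_const_mul]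
    exact mul_le_mul_of_nonneg_left (integral_inv_sqrtWeight_pow_le n hs) hC

/-- Last rung of the ladder of rates: w^{-1} is integrable up to the endpoints. -/
lemma norm_le_of_norm_le_inv {C : ℝ} (hC : 0 ≤ C) (hF : IsPrimitive F g)
    (hg : ∀ s ∈ Ioo (-1 : ℝ) 1, ‖g s‖ ≤ C * (sqrtWeight s)⁻¹) :
    ∃ C : ℝ, 0 ≤ C ∧ ∀ s ∈ Ioo (-1 : ℝ) 1, ‖F s‖ ≤ C := by
  set A := ∫ s in Ioo (-1 : ℝ) 1, (sqrtWeight s)⁻¹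
  have hA : 0 ≤ A := integral_nonneg fun s => inv_nonneg.2 (sqrtWeight_nonneg s)
  refine ⟨‖F 0‖ + C * A, by positivity, fun s hs => ?_⟩
  rw [hF.2 s hs]
  refine (norm_add_le _ _).trans (add_le_add le_rfl ?_)
  refine intervalIntegral.norm_integral_le_integral_norm_uIoc.trans ?_
  have hsub : Ι 0 s ⊆ Ioo (-1 : ℝ) 1 :=
    uIoc_subset_uIcc.trans (uIcc_subset_interval zero_mem_interval hs)
  have hi3 : IntegrableOn g (Ι 0 s) := (intervalIntegrable_of_locallyIntegrableOn
    hF.1 zero_mem_interval hs).def'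
  refine (setIntegral_mono_on hi3.norm ((integrableOn_inv_sqrtWeight.mono_set hsub).const_mul C)
    measurableSet_uIoc fun t ht => hg t (hsub ht)).trans ?_
  rw [integral_const_mul]
  exact mul_le_mul_of_nonneg_left (setIntegral_mono_set integrableOn_inv_sqrtWeight
    (Eventually.of_forall fun t => inv_nonneg.2 (sqrtWeight_nonneg t)) hsub.eventuallyLE) hC

/-- A primitive of a function in `L²((1 - s ^ 2) ds)` is square integrable. -/
lemma memLp_zero (hF : IsPrimitive F g) (hg : MemLp g 2 (weightMeasure 1)) :
    MemLp F 2 (weightMeasure 0) := by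
  have hFm : AEStronglyMeasurable F intervalMeasure :=
    hF.continuousOn.aestronglyMeasurable measurableSet_Ioo
  obtain ⟨B, hB, h1⟩ := exists_sq_bound (g := g) (k := 1)
  refine memLp_weight_iff.2 ⟨hFm, ?_⟩
  simp only [pow_zero, one_smul]
  rw [memLp_two_iff_integrable_sq_norm hFm]
  refine Integrable.mono' (g := fun s => (‖F 0‖ + B) ^ 2 * (sqrtWeight s)⁻¹)
    (integrableOn_inv_sqrtWeight.const_mul _) (hFm.norm.pow 2) ?_
  filter_upwards [ae_restrict_mem measurableSet_Ioo] with s hs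
  have hp := sqrtWeight_pos hs
  have hone : 1 ≤ √((sqrtWeight s)⁻¹) := by
    rw [Real.one_le_sqrt]
    simpa using one_le_inv_sqrtWeight_pow 1 hs
  have hsub : Ι 0 s ⊆ Ioo (-1 : ℝ) 1 :=
    uIoc_subset_uIcc.trans (uIcc_subset_interval zero_mem_interval hs)
  -- The integral of w^{-2} grows logarithmically. Replacing w^{-2} by w^{-3} costs a bound w^{-1}
  -- for the square of F, which is still integrable.
  have hD : ∫ t in Ι 0 s, (sqrtWeight t ^ (2 * 1))⁻¹ ≤ √((sqrtWeight s)⁻¹) ^ 2 := by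
    rw [Real.sq_sqrt (inv_nonneg.2 hp.le)]
    have h3 := integral_inv_sqrtWeight_pow_le 0 hs
    simp only [zero_add, pow_one] at h3
    refine le_trans ?_ h3
    have hi : ∀ n, IntegrableOn (fun t => (sqrtWeight t ^ n)⁻¹) (Ι 0 s) := fun n =>
      ((continuousOn_inv_sqrtWeight_pow n).mono
        (uIcc_subset_interval zero_mem_interval hs)).intervalIntegrable.def'
    refine setIntegral_mono_on (hi _) (hi _) measurableSet_uIoc fun t ht => ?_
    have := sqrtWeight_pos (hsub ht)
    exact inv_anti₀ (by positivity)
      (pow_le_pow_of_le_one (sqrtWeight_nonneg t) (sqrtWeight_le_one t) (by norm_num))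
  have h2 := norm_intervalIntegral_le hg hB (zero_lt_one.trans_le hone) hs h1 hD
  have h3 : ‖F s‖ ≤ (‖F 0‖ + B) * √((sqrtWeight s)⁻¹) := by
    rw [hF.2 s hs, add_mul]
    exact (norm_add_le _ _).trans (add_le_add (le_mul_of_one_le_right (norm_nonneg _) hone) h2)
  rw [Real.norm_of_nonneg (by positivity)]
  calc ‖F s‖ ^ 2 ≤ ((‖F 0‖ + B) * √((sqrtWeight s)⁻¹)) ^ 2 := by gcongr
    _ = _ := by rw [mul_pow, Real.sq_sqrt (inv_nonneg.2 hp.le)]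

lemma memLp_of_bound {k : ℕ} {C : ℝ} (hF : IsPrimitive F g)
    (h : ∀ s ∈ Ioo (-1 : ℝ) 1, ‖F s‖ ≤ C * (sqrtWeight s ^ k)⁻¹) :
    MemLp F 2 (weightMeasure k) := by
  have hFm : AEStronglyMeasurable F intervalMeasure :=
    hF.continuousOn.aestronglyMeasurable measurableSet_Ioo
  refine memLp_weight_iff.2 ⟨hFm, ?_⟩
  refine MemLp.of_bound ((continuous_sqrtWeight.pow k).aestronglyMeasurable.smul hFm) C ?_
  filter_upwards [ae_restrict_mem measurableSet_Ioo] with s hs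
  have hp := pow_pos (sqrtWeight_pos hs) k
  rw [norm_smul, Real.norm_of_nonneg hp.le, mul_comm, ← le_div_iff₀ hp]
  exact h s hs

/-- A primitive of a function in `L²((1 - s ^ 2) ^ 2 ds)` is in `L²((1 - s ^ 2) ds)`. -/
lemma memLp_one (hF : IsPrimitive F g) (hg : MemLp g 2 (weightMeasure 2)) :
    MemLp F 2 (weightMeasure 1) := by
  obtain ⟨C, -, h⟩ := hF.norm_le_of_memLp (k := 0) hg
  exact hF.memLp_of_bound h

end IsPrimitive

end PointwiseBounds

/-! ### Boundedness of weighted derivatives for m ≥ 3 -/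

section Derivatives

/-- In `F^m` with `m ≥ 3`, the function `(1 - s ^ 2) ^ (i / 2) * f⁽ⁱ⁾` is bounded for
`i ≤ m - 2`. -/
lemma exists_bound_of_ladder [CompleteSpace E] {m : ℕ} (hm : 3 ≤ m) {F : ℕ → ℝ → E}
    (hF : ∀ j < m, IsPrimitive (F j) (F (j + 1)))
    (hL : ∀ j ≤ m, MemLp (F j) 2 (weightMeasure (1 + j))) {i : ℕ} (hi : i + 2 ≤ m) :
    ∃ C : ℝ, 0 ≤ C ∧ ∀ s ∈ Ioo (-1 : ℝ) 1, ‖sqrtWeight s ^ i • F i s‖ ≤ C := by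
  have key : ∃ C : ℝ, 0 ≤ C ∧ ∀ s ∈ Ioo (-1 : ℝ) 1, ‖F i s‖ ≤ C * (sqrtWeight s ^ i)⁻¹ := by
    rcases i with _ | i
    -- Order zero needs three derivatives: the rates are w^{-3} for F 2, w^{-1} for F 1, then
    -- bounded. Starting from F 2 would give w^{-2} for F 1, which is not integrable.
    · have h3 : MemLp (F 3) 2 (weightMeasure (2 + 2)) := by simpa using hL 3 hm
      obtain ⟨C2, hC2, h2⟩ := (hF 2 (by omega)).norm_le_of_memLp h3
      obtain ⟨C1, hC1, h1⟩ := (hF 1 (by omega)).norm_le_of_norm_le (n := 0) hC2 h2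
      obtain ⟨C0, hC0, h0⟩ := (hF 0 (by omega)).norm_le_of_norm_le_inv hC1 (by simpa using h1)
      exact ⟨C0, hC0, by simpa using h0⟩
    · have h3 : MemLp (F (i + 1 + 1 + 1)) 2 (weightMeasure ((i + 2) + 2)) := by
        have := hL (i + 3) (by omega)
        rwa [show 1 + (i + 3) = i + 2 + 2 by ring] at this
      obtain ⟨C2, hC2, h2⟩ := (hF (i + 1 + 1) (by omega)).norm_le_of_memLp h3
      exact (hF (i + 1) (by omega)).norm_le_of_norm_le (n := i) hC2 h2
  obtain ⟨C, hC, h⟩ := key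
  refine ⟨C, hC, fun s hs => ?_⟩
  have hp := pow_pos (sqrtWeight_pos hs) i
  rw [norm_smul, Real.norm_of_nonneg hp.le, mul_comm, ← le_div_iff₀ hp]
  exact h s hs

end Derivatives

/-! ### Differentiation as an isomorphism -/

section CurveSpace

instance neBot_ae_interval : (ae intervalMeasure).NeBot := by
  rw [ae_neBot, Ne, Measure.restrict_eq_zero]
  simp

/-- Curves with the same velocity differ by a constant, and oddness forces it to vanish. -/
lemma curveSpace_ext {m : ℕ} {η ζ : curveSpace (m + 1)}
    (h : velocity η =ᵐ[intervalMeasure] velocity ζ) : η = ζ := by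
  rw [velocity_eq_jet, velocity_eq_jet] at h
  refine Subtype.ext (ext_of_jet fun j _ => ?_)
  rcases j with _ | j
  · have h1 := (isWeakDeriv_jet η.2.1 (Nat.succ_pos m)).add
      ((isWeakDeriv_jet ζ.2.1 (Nat.succ_pos m)).smul (-1))
    have h2 : IsWeakDeriv (jet η.1 0 + (-1 : ℝ) • jet ζ.1 0) 0 := by
      refine h1.congr EventuallyEq.rfl ?_
      filter_upwards [h] with s hs
      simp [hs]
    obtain ⟨c, hc⟩ := ae_eq_const_of_isWeakDeriv_zero h2
    have p1 : ∀ᵐ s ∂intervalMeasure, jet η.1 0 (-s) = (-1 : ℝ) • jet η.1 0 s := η.2.2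
    have p2 : ∀ᵐ s ∂intervalMeasure, jet ζ.1 0 (-s) = (-1 : ℝ) • jet ζ.1 0 s := ζ.2.2
    have hc0 : c = 0 := by
      obtain ⟨s, k1, k2, k3, k4⟩ := (hc.and ((ae_comp_neg hc).and (p1.and p2))).exists
      simp only [Pi.add_apply, Pi.smul_apply] at k1 k2
      rw [k3, k4] at k2
      have : c = -c := by
        conv_lhs => rw [← k2]
        rw [← k1]
        simp only [neg_smul, one_smul]
        ring
      exact self_eq_neg.1 this
    filter_upwards [hc] with s hs
    simp only [Pi.add_apply, Pi.neg_apply, neg_smul, one_smul, hc0] at hs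
    exact add_neg_eq_zero.1 hs
  · exact jet_ae_eq η.2.1 ζ.2.1 h (j + 1) (Nat.le_add_left 1 j)

lemma exists_evenSpace_eq_velocity {m : ℕ} (η : curveSpace (m + 1)) :
    ∃ ξ : evenSpace ℂ m, ∀ᵐ s ∂intervalMeasure, toFun ξ s = velocity η s := by
  obtain ⟨ξ, h⟩ := exists_evenSpace (m := m) (fun j => jet η.1 (j + 1))
    (fun j _ => by
      have := memLp_jet η.1 (j + 1)
      rwa [show 0 + (j + 1) = 1 + j by ring] at this)
    (fun j hj => isWeakDeriv_jet η.2.1 (by omega))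
    (by
      have p1 : ∀ᵐ s ∂intervalMeasure, jet η.1 0 (-s) = (-1 : ℝ) • jet η.1 0 s := η.2.2
      filter_upwards [(isWeakDeriv_jet η.2.1 (Nat.succ_pos m)).ae_parity p1] with s hs
      rw [hs, neg_neg, one_smul])
  refine ⟨ξ, ?_⟩
  rw [toFun_eq_jet, velocity_eq_jet]
  exact h 0 (Nat.zero_le m)

/-- The curve is the integral of ξ from 0: odd because ξ is even, and square integrable by
`IsPrimitive.memLp_zero`. -/
lemma exists_curveSpace_eq {m : ℕ} (ξ : evenSpace ℂ m) :
    ∃ η : curveSpace (m + 1), ∀ᵐ s ∂intervalMeasure, velocity η s = toFun ξ s := by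
  have hl : LocallyIntegrableOn (jet ξ.1 0) (Ioo (-1 : ℝ) 1) :=
    locallyIntegrableOn_of_memLp_weight (memLp_jet ξ.1 0)
  have hp : IsPrimitive (fun s => ∫ t in (0 : ℝ)..s, jet ξ.1 0 t) (jet ξ.1 0) :=
    ⟨hl, fun s _ => by simp⟩
  have he := ae_even ξ
  rw [toFun_eq_jet] at he
  let u : ℕ → ℝ → ℂ := fun j => Nat.casesOn j (fun s => ∫ t in (0 : ℝ)..s, jet ξ.1 0 t)
    fun j => jet ξ.1 j
  obtain ⟨f, h1, h2⟩ := exists_mem_weightedSobolev (a := 0) (n := m + 1) u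
    (fun j _ => by
      rcases j with _ | j
      · exact hp.memLp_zero (memLp_jet ξ.1 0)
      · have := memLp_jet ξ.1 j
        rwa [show 1 + j = 0 + (j + 1) by ring] at this)
    (fun j hj => by
      rcases j with _ | j
      · exact hp.isWeakDeriv
      · exact isWeakDeriv_jet ξ.2.1 (by omega))
  have hodd : ∀ s ∈ Ioo (-1 : ℝ) 1, u 0 (-s) = -u 0 s := by
    intro s hs
    have h3 := (hp.comp_neg.congr_right (g' := fun s => -jet ξ.1 0 s) (by
      filter_upwards [he] with s hs
      rw [hs])).2 s hs
    have h4 : ∫ t in (0 : ℝ)..(-s), jet ξ.1 0 t = -∫ t in (0 : ℝ)..s, jet ξ.1 0 t := by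
      simpa using h3
    exact h4
  refine ⟨⟨f, h1, ?_⟩, ?_⟩
  · have h3 := h2 0 (Nat.zero_le _)
    change ∀ᵐ s ∂intervalMeasure, jet f 0 (-s) = (-1 : ℝ) • jet f 0 s
    filter_upwards [h3, ae_comp_neg h3, ae_restrict_mem measurableSet_Ioo] with s k1 k2 k3
    rw [k1, k2, hodd s k3, neg_smul, one_smul]
  · rw [velocity_eq_jet, toFun_eq_jet]
    exact h2 1 (by omega)

lemma exists_derivEquiv (m : ℕ) : ∃ T : curveSpace (m + 1) ≃L[ℝ] evenSpace ℂ m,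
    ∀ η, toFun (T η) =ᵐ[intervalMeasure] velocity η := by
  obtain ⟨T, hT⟩ := exists_clm_of_pointwise (isRealization_velocity m) (isRealization_toFun m)
    (fun _ _ => evenSpace_ext) (fun _ => ContinuousLinearMap.id ℝ ℂ) exists_evenSpace_eq_velocity
  obtain ⟨S, hS⟩ := exists_clm_of_pointwise (isRealization_toFun m) (isRealization_velocity m)
    (fun _ _ => curveSpace_ext) (fun _ => ContinuousLinearMap.id ℝ ℂ) exists_curveSpace_eq
  refine ⟨ContinuousLinearEquiv.equivOfInverse T S (fun η => curveSpace_ext ?_)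
    (fun ξ => evenSpace_ext ?_), hT⟩
  · filter_upwards [hT η, hS (T η)] with s h1 h2
    rw [h2, ContinuousLinearMap.id_apply, h1, ContinuousLinearMap.id_apply]
  · filter_upwards [hS ξ, hT (S ξ)] with s h1 h2
    rw [h2, ContinuousLinearMap.id_apply, h1, ContinuousLinearMap.id_apply]

/-- Differentiation identifies the curves in `K^(m+1)` with the even functions in `F^m[ℂ]`. -/
def derivEquiv (m : ℕ) : curveSpace (m + 1) ≃L[ℝ] evenSpace ℂ m := (exists_derivEquiv m).choose

lemma toFun_derivEquiv {m : ℕ} (η : curveSpace (m + 1)) :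
    toFun (derivEquiv m η) =ᵐ[intervalMeasure] velocity η := (exists_derivEquiv m).choose_spec η

lemma velocity_derivEquiv_symm {m : ℕ} (ξ : evenSpace ℂ m) :
    velocity ((derivEquiv m).symm ξ) =ᵐ[intervalMeasure] toFun ξ := by
  have := toFun_derivEquiv ((derivEquiv m).symm ξ)
  rw [ContinuousLinearEquiv.apply_symm_apply] at this
  exact this.symm

lemma mem_arcSpace_iff {m : ℕ} (η : curveSpace (m + 1)) :
    η ∈ arcSpace m ↔ ∀ᵐ s ∂intervalMeasure, ‖toFun (derivEquiv m η) s‖ = 1 := by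
  have h := toFun_derivEquiv η
  constructor
  · intro hη
    filter_upwards [h, hη] with s h1 h2
    rw [h1, h2]
  · intro hη
    change ∀ᵐ s ∂intervalMeasure, ‖velocity η s‖ = 1
    filter_upwards [h, hη] with s h1 h2
    rw [← h1, h2]

end CurveSpace

/-! ### The Leibniz formula and its terms -/

section Leibniz

namespace IsPrimitive

lemma const_mul {F g : ℝ → ℂ} (hF : IsPrimitive F g) (c : ℂ) :
    IsPrimitive (fun s => c * F s) (fun s => c * g s) :=
  hF.clm (ContinuousLinearMap.mul ℝ ℂ c)

lemma mul {F g G h : ℝ → ℂ} (hF : IsPrimitive F g) (hG : IsPrimitive G h) :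
    IsPrimitive (fun s => F s * G s) (fun s => F s * h s + g s * G s) :=
  hF.bilin (ContinuousLinearMap.mul ℝ ℂ) hG

lemma sum {ι : Type*} (t : Finset ι) {F g : ι → ℝ → ℂ} (h : ∀ i ∈ t, IsPrimitive (F i) (g i)) :
    IsPrimitive (fun s => ∑ i ∈ t, F i s) (fun s => ∑ i ∈ t, g i s) := by
  classical
  induction t using Finset.induction_on with
  | empty => exact IsPrimitive.const (0 : ℂ)
  | insert i t hi ih =>
    simp only [Finset.sum_insert hi]
    exact (h i (Finset.mem_insert_self i t)).add
      (ih fun j hj => h j (Finset.mem_insert_of_mem hj))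

end IsPrimitive

/-- The `j`-th derivative of the product of two functions with derivatives `F i` and `G i`. -/
def leibniz (F G : ℕ → ℝ → ℂ) (j : ℕ) (s : ℝ) : ℂ :=
  ∑ p ∈ Finset.HasAntidiagonal.antidiagonal j, (j.choose p.1 : ℂ) * (F p.1 s * G p.2 s)

/-- Pascal's rule regroups the sum of order j + 1 as the sum of the derivatives of the products of
order j. -/
lemma isPrimitive_leibniz {F G : ℕ → ℝ → ℂ} {j : ℕ}
    (hF : ∀ i ≤ j, IsPrimitive (F i) (F (i + 1))) (hG : ∀ i ≤ j, IsPrimitive (G i) (G (i + 1))) :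
    IsPrimitive (leibniz F G j) (leibniz F G (j + 1)) := by
  have h : leibniz F G (j + 1) = fun s => ∑ p ∈ Finset.HasAntidiagonal.antidiagonal j,
      (j.choose p.1 : ℂ) * (F p.1 s * G (p.2 + 1) s + F (p.1 + 1) s * G p.2 s) := by
    funext s
    rw [leibniz, Finset.sum_antidiagonal_choose_succ_mul (fun a b => F a s * G b s) j,
      ← Finset.sum_add_distrib]
    refine Finset.sum_congr rfl fun p hp => ?_
    rw [mul_add, ← Finset.HasAntidiagonal.mem_antidiagonal.1 hp, Nat.choose_symm_add]
  rw [h]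
  refine IsPrimitive.sum _ fun p hp => ?_
  have := Finset.HasAntidiagonal.mem_antidiagonal.1 hp
  exact ((hF p.1 (by omega)).mul (hG p.2 (by omega))).const_mul _

lemma memLp_mul_of_bound {F G : ℝ → ℂ} {i k : ℕ} {C : ℝ}
    (hFm : AEStronglyMeasurable F intervalMeasure)
    (hF : ∀ᵐ s ∂intervalMeasure, ‖sqrtWeight s ^ i • F s‖ ≤ C) (hG : MemLp G 2 (weightMeasure k)) :
    MemLp (fun s => F s * G s) 2 (weightMeasure (i + k)) := by
  obtain ⟨h1, h2⟩ := memLp_weight_iff.1 hG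
  refine memLp_weight_iff.2 ⟨hFm.mul h1, ?_⟩
  refine h2.of_le_mul (c := C)
    ((continuous_sqrtWeight.pow (i + k)).aestronglyMeasurable.smul (hFm.mul h1)) ?_
  filter_upwards [hF] with s hs
  have e : sqrtWeight s ^ (i + k) • (F s * G s)
      = (sqrtWeight s ^ i • F s) * (sqrtWeight s ^ k • G s) := by
    rw [smul_mul_smul_comm, pow_add]
  rw [e, norm_mul]
  gcongr

/-- The smaller of the two orders, say i, is at most m/2, hence i + 2 ≤ m because m ≥ 3. So w^i
times that factor is bounded, and the other factor carries the square integrability. -/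
lemma memLp_mul_of_ladder {m : ℕ} (hm : 3 ≤ m) {F G : ℕ → ℝ → ℂ}
    (hF : ∀ j < m, IsPrimitive (F j) (F (j + 1)))
    (hFL : ∀ j ≤ m, MemLp (F j) 2 (weightMeasure (1 + j)))
    (hG : ∀ j < m, IsPrimitive (G j) (G (j + 1)))
    (hGL : ∀ j ≤ m, MemLp (G j) 2 (weightMeasure (1 + j))) {i k : ℕ} (hik : i + k ≤ m) :
    MemLp (fun s => F i s * G k s) 2 (weightMeasure (1 + (i + k))) := by
  rcases le_total i k with h | h
  · obtain ⟨C, -, hC⟩ := exists_bound_of_ladder hm hF hFL (i := i) (by omega)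
    have := memLp_mul_of_bound (memLp_weight_iff.1 (hFL i (by omega))).1
      ((ae_restrict_mem measurableSet_Ioo).mono hC) (hGL k (by omega))
    rwa [show i + (1 + k) = 1 + (i + k) by ring] at this
  · obtain ⟨C, -, hC⟩ := exists_bound_of_ladder hm hG hGL (i := k) (by omega)
    have := memLp_mul_of_bound (memLp_weight_iff.1 (hGL k (by omega))).1
      ((ae_restrict_mem measurableSet_Ioo).mono hC) (hFL i (by omega))
    simpa only [mul_comm (G k _), show k + (1 + i) = 1 + (i + k) by ring] using this

lemma memLp_leibniz {F G : ℕ → ℝ → ℂ} {j : ℕ} {μ : Measure ℝ}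
    (h : ∀ i k, i + k = j → MemLp (fun s => F i s * G k s) 2 μ) :
    MemLp (leibniz F G j) 2 μ :=
  memLp_finsetSum _ fun p hp => (h p.1 p.2 (Finset.HasAntidiagonal.mem_antidiagonal.1 hp)).const_mul _

end Leibniz

/-! ### Multiplication on F^m[ℂ] for m ≥ 3 -/

section Multiplication

variable {m : ℕ}

lemma exists_evenMul (hm : 3 ≤ m) (ξ ζ : evenSpace ℂ m) : ∃ z : evenSpace ℂ m,
    ∀ᵐ s ∂intervalMeasure, toFun z s = ContinuousLinearMap.mul ℝ ℂ (toFun ξ s) (toFun ζ s) := by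
  obtain ⟨F, hF1, hF2⟩ := exists_representatives ξ.2.1
  obtain ⟨G, hG1, hG2⟩ := exists_representatives ζ.2.1
  have hF0 := hF1 0
  have hG0 := hG1 0
  rw [← toFun_eq_jet] at hF0 hG0
  obtain ⟨z, hz⟩ := exists_evenSpace (m := m) (leibniz F G)
    (fun j hj => memLp_leibniz fun i k hik => by
      rw [← hik] at hj ⊢
      exact memLp_mul_of_ladder hm hF2 (fun j _ => memLp_representative (hF1 j)) hG2
        (fun j _ => memLp_representative (hG1 j)) hj)
    (fun j hj => (isPrimitive_leibniz (fun i hi => hF2 i (by omega))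
      (fun i hi => hG2 i (by omega))).isWeakDeriv)
    (by
      filter_upwards [ae_even ξ, ae_even ζ, hF0, hG0, ae_comp_neg hF0, ae_comp_neg hG0]
        with s h1 h2 h3 h4 h5 h6
      simp only [leibniz, Finset.Nat.antidiagonal_zero, Finset.sum_singleton]
      rw [← h5, ← h6, h1, h2, h3, h4])
  refine ⟨z, ?_⟩
  have hz0 := hz 0 (Nat.zero_le m)
  rw [← toFun_eq_jet] at hz0
  filter_upwards [hz0, hF0, hG0] with s h1 h2 h3
  rw [h1, h2, h3]
  simp [leibniz]

lemma exists_mulOperator (hm : 3 ≤ m) :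
    ∃ T : evenSpace ℂ m →L[ℝ] evenSpace ℂ m →L[ℝ] evenSpace ℂ m, ∀ ξ ζ,
      ∀ᵐ s ∂intervalMeasure, toFun (T ξ ζ) s = toFun ξ s * toFun ζ s :=
  exists_bilin_of_pointwise (isRealization_toFun m) (isRealization_toFun m)
    (isRealization_toFun m) (fun _ _ => evenSpace_ext) (ContinuousLinearMap.mul ℝ ℂ)
    (exists_evenMul hm)

end Multiplication

/-! ### The exponential of a commuting family of operators -/

section Exponential

variable {X : Type*} [NormedAddCommGroup X] [NormedSpace ℝ X] [CompleteSpace X]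

/-- The exponential of the operator `T ξ`, applied to the vector `e`. -/
def expMap (T : X →L[ℝ] X →L[ℝ] X) (e : X) (ξ : X) : X := NormedSpace.exp (T ξ) e

variable {T : X →L[ℝ] X →L[ℝ] X} {e : X}

lemma contDiff_expMap : ContDiff ℝ ∞ (expMap T e) := by
  have h1 : ContDiff ℝ ∞ (NormedSpace.exp : (X →L[ℝ] X) → X →L[ℝ] X) :=
    contDiff_iff_contDiffAt.2 fun x => (NormedSpace.exp_analytic (𝕂 := ℝ) x).contDiffAt
  exact (h1.comp T.contDiff).clm_apply contDiff_const

lemma isUnit_exp_operator (S : X →L[ℝ] X) : IsUnit (NormedSpace.exp S) := by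
  let _ : NormedAlgebra ℚ (X →L[ℝ] X) := NormedAlgebra.restrictScalars ℚ ℝ _
  exact NormedSpace.isUnit_exp S

lemma expMap_add (hcomm : ∀ a b, Commute (T a) (T b)) (ξ ζ : X) :
    expMap T e (ξ + ζ) = NormedSpace.exp (T ξ) (expMap T e ζ) := by
  let _ : NormedAlgebra ℚ (X →L[ℝ] X) := NormedAlgebra.restrictScalars ℚ ℝ _
  rw [expMap, map_add, NormedSpace.exp_add_of_commute (hcomm ξ ζ)]
  rfl

/-- At 0 the derivative is a ↦ T a e = a. The functional equation `expMap_add` transports this to ξ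
through the operator exp (T ξ), which is invertible. -/
lemma hasFDerivAt_expMap (hcomm : ∀ a b, Commute (T a) (T b)) (he : ∀ a, T a e = a) (ξ : X) :
    HasFDerivAt (expMap T e) (NormedSpace.exp (T ξ)) ξ := by
  have h0 : HasFDerivAt (expMap T e) (ContinuousLinearMap.id ℝ X) 0 := by
    have h1 : HasFDerivAt (NormedSpace.exp : (X →L[ℝ] X) → X →L[ℝ] X)
        (1 : (X →L[ℝ] X) →L[ℝ] X →L[ℝ] X) (T 0) := by
      rw [map_zero]
      exact hasFDerivAt_exp_zero
    have h2 := (ContinuousLinearMap.apply ℝ X e).hasFDerivAt.comp (0 : X)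
      (h1.comp (0 : X) T.hasFDerivAt)
    refine h2.congr_fderiv (ContinuousLinearMap.ext fun a => ?_)
    simpa using he a
  have h3 : expMap T e = fun x => NormedSpace.exp (T ξ) (expMap T e (x - ξ)) := by
    funext x
    rw [← expMap_add hcomm, add_sub_cancel]
  rw [h3]
  have h4 : HasFDerivAt (expMap T e) (ContinuousLinearMap.id ℝ X) (ξ - ξ) := by rwa [sub_self]
  have h6 : HasFDerivAt (fun x => x - ξ) (ContinuousLinearMap.id ℝ X) ξ :=
    (hasFDerivAt_id ξ).sub_const ξ
  have h5 := (NormedSpace.exp (T ξ)).hasFDerivAt.comp ξ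
    (HasFDerivAt.comp (g := expMap T e) (f := fun x => x - ξ) ξ h4 h6)
  exact h5.congr_fderiv (ContinuousLinearMap.ext fun a => by simp)

/-- The exponential map is a local diffeomorphism. -/
lemma exists_openPartialHomeomorph_expMap (hcomm : ∀ a b, Commute (T a) (T b))
    (he : ∀ a, T a e = a) (ξ : X) :
    ∃ φ : OpenPartialHomeomorph X X, ξ ∈ φ.source ∧ ⇑φ = expMap T e ∧
      ContDiffOn ℝ ∞ φ.symm φ.target := by
  have hequiv : ∀ ζ : X, ∃ L : X ≃L[ℝ] X, (L : X →L[ℝ] X) = NormedSpace.exp (T ζ) := fun ζ => by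
    obtain ⟨u, hu⟩ := isUnit_exp_operator (T ζ)
    exact ⟨ContinuousLinearEquiv.ofUnit u, by rw [← hu]; rfl⟩
  choose L hL using hequiv
  have hd : ∀ ζ, HasFDerivAt (expMap T e) (L ζ : X →L[ℝ] X) ζ := fun ζ => by
    rw [hL]
    exact hasFDerivAt_expMap hcomm he ζ
  have hc : ∀ ζ, ContDiffAt ℝ ∞ (expMap T e) ζ := fun ζ => contDiff_expMap.contDiffAt
  refine ⟨(hc ξ).toOpenPartialHomeomorph _ (hd ξ) (by simp),
    (hc ξ).mem_toOpenPartialHomeomorph_source (hd ξ) (by simp),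
    (hc ξ).toOpenPartialHomeomorph_coe (hd ξ) (by simp), fun y hy => ?_⟩
  exact (OpenPartialHomeomorph.contDiffAt_symm _ hy (hd _) (hc _)).contDiffWithinAt

end Exponential

/-! ### Atlases from maps with fibres x + ℤ v -/

section Covering

variable {H A : Type*} [NormedAddCommGroup H] [NormedSpace ℝ H] [TopologicalSpace A]

/-- The local inverses of a map `p`. -/
def localInverses (p : H → A) : Set (OpenPartialHomeomorph A H) :=
  {φ | ∀ x ∈ φ.target, φ.symm x = p x}

/-- Distinct points of a fibre are at distance at least ‖v‖, so p is injective on balls of radius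
‖v‖/2, and a continuous open injection is an open embedding. -/
lemma isLocalHomeomorph_of_isOpenMap {p : H → A} {v : H} (hv : v ≠ 0) (hc : Continuous p)
    (ho : IsOpenMap p) (hp : ∀ x y, p x = p y → ∃ k : ℤ, y = x + k • v) :
    IsLocalHomeomorph p := by
  rw [isLocalHomeomorph_iff_isOpenEmbedding_restrict]
  intro x
  have hv0 : 0 < ‖v‖ := norm_pos_iff.2 hv
  refine ⟨Metric.ball x (‖v‖ / 2), Metric.ball_mem_nhds x (by positivity), ?_⟩
  refine Topology.IsOpenEmbedding.of_continuous_injective_isOpenMap (hc.comp continuous_subtype_val) ?_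
    (ho.comp Metric.isOpen_ball.isOpenMap_subtype_val)
  rintro ⟨y, hy⟩ ⟨z, hz⟩ hyz
  obtain ⟨k, hk⟩ := hp y z hyz
  have h1 : ‖z - y‖ < ‖v‖ := by
    rw [← dist_eq_norm]
    have := dist_triangle_right z y x
    rw [Metric.mem_ball] at hy hz
    linarith
  rw [hk, add_sub_cancel_left, norm_zsmul ℝ, Int.norm_cast_real] at h1
  have h2 : ‖k‖ < 1 := by
    by_contra hcon
    push Not at hcon
    nlinarith
  have h3 : k = 0 := by
    rw [Int.norm_eq_abs] at h2
    have : |k| < 1 := by exact_mod_cast h2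
    exact Int.abs_lt_one_iff.1 this
  simp [hk, h3]

/-- The charted space structure given by all the local inverses of a surjective local
homeomorphism. -/
@[reducible]
def localInverseChartedSpace {p : H → A} (hp : IsLocalHomeomorph p)
    (hs : Function.Surjective p) : ChartedSpace H A :=
  have h : ∀ a : A, ∃ φ : OpenPartialHomeomorph A H, a ∈ φ.source ∧ φ ∈ localInverses p := fun a => by
    obtain ⟨x, rfl⟩ := hs a
    obtain ⟨e, h1, h2⟩ := hp x
    refine ⟨e.symm, ?_, fun y _ => ?_⟩
    · rw [h2]
      exact e.map_source h1
    · rw [h2]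
      rfl
  { atlas := localInverses p
    chartAt := fun a => (h a).choose
    mem_chart_source := fun a => (h a).choose_spec.1
    chart_mem_atlas := fun a => (h a).choose_spec.2 }

/-- The transition map minus the identity is continuous with values in the discrete set ℤ v, hence
locally constant. -/
lemma contDiffOn_transition {p : H → A} {v : H} (hv : v ≠ 0)
    (hp : ∀ x y, p x = p y → ∃ k : ℤ, y = x + k • v) {φ ψ : OpenPartialHomeomorph A H}
    (hφ : φ ∈ localInverses p) (hψ : ψ ∈ localInverses p) :
    ContDiffOn ℝ ∞ (φ.symm ≫ₕ ψ) (φ.symm ≫ₕ ψ).source := by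
  have hk : ∀ x ∈ (φ.symm ≫ₕ ψ).source, ∃ k : ℤ, (φ.symm ≫ₕ ψ) x = x + k • v := by
    intro x hx
    rw [OpenPartialHomeomorph.trans_source, OpenPartialHomeomorph.symm_source] at hx
    refine hp _ _ ?_
    rw [← hφ x hx.1]
    change φ.symm x = p (ψ (φ.symm x))
    rw [← hψ _ (ψ.map_source hx.2)]
    exact (ψ.left_inv hx.2).symm
  have hv0 : 0 < ‖v‖ := norm_pos_iff.2 hv
  intro x hx
  have hopen := (φ.symm ≫ₕ ψ).open_source
  have hcont : ContinuousAt (fun y => (φ.symm ≫ₕ ψ) y - y) x :=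
    ((φ.symm ≫ₕ ψ).continuousAt hx).sub continuousAt_id
  have hev := hcont.eventually (Metric.ball_mem_nhds _ hv0)
  obtain ⟨k, hkx⟩ := hk x hx
  have heq : (φ.symm ≫ₕ ψ) =ᶠ[𝓝 x] fun y => y + k • v := by
    filter_upwards [hev, hopen.mem_nhds hx] with y hy hys
    obtain ⟨l, hl⟩ := hk y hys
    rw [hl, hkx, add_sub_cancel_left, add_sub_cancel_left, dist_eq_norm,
      ← sub_smul, norm_zsmul ℝ, Int.norm_cast_real] at hy
    have h2 : ‖l - k‖ < 1 := by
      by_contra hcon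
      push Not at hcon
      nlinarith
    have h3 : l - k = 0 := by
      rw [Int.norm_eq_abs] at h2
      have : |l - k| < 1 := by exact_mod_cast h2
      exact Int.abs_lt_one_iff.1 this
    rw [hl, sub_eq_zero.1 h3]
  exact ((contDiffAt_id.add contDiffAt_const).congr_of_eventuallyEq heq).contDiffWithinAt

lemma isManifold_localInverseChartedSpace {p : H → A} {v : H} (hv : v ≠ 0)
    (hp : ∀ x y, p x = p y → ∃ k : ℤ, y = x + k • v) (hl : IsLocalHomeomorph p)
    (hs : Function.Surjective p) :
    @IsManifold ℝ _ H _ _ H _ 𝓘(ℝ, H) ∞ A _ (localInverseChartedSpace hl hs) := by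
  let _ := localInverseChartedSpace hl hs
  refine isManifold_of_contDiffOn 𝓘(ℝ, H) ∞ A fun φ ψ hφ hψ => ?_
  simpa using contDiffOn_transition hv hp hφ hψ

end Covering

/-! ### The algebra exponential is the pointwise exponential -/

section ExponentialOfFunctions

variable {m : ℕ}

/-- Pointwise multiplication, as a bounded bilinear map on `F^m[ℂ]`, for `m ≥ 3`. -/
def mulOperator (hm : 3 ≤ m) : evenSpace ℂ m →L[ℝ] evenSpace ℂ m →L[ℝ] evenSpace ℂ m :=
  (exists_mulOperator hm).choose

lemma toFun_mulOperator (hm : 3 ≤ m) (ξ ζ : evenSpace ℂ m) :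
    ∀ᵐ s ∂intervalMeasure, toFun (mulOperator hm ξ ζ) s = toFun ξ s * toFun ζ s :=
  (exists_mulOperator hm).choose_spec ξ ζ

lemma commute_mulOperator (hm : 3 ≤ m) (ξ ζ : evenSpace ℂ m) :
    Commute (mulOperator hm ξ) (mulOperator hm ζ) := by
  refine ContinuousLinearMap.ext fun z => evenSpace_ext ?_
  filter_upwards [toFun_mulOperator hm ξ (mulOperator hm ζ z), toFun_mulOperator hm ζ z,
    toFun_mulOperator hm ζ (mulOperator hm ξ z), toFun_mulOperator hm ξ z] with s h1 h2 h3 h4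
  change toFun (mulOperator hm ξ (mulOperator hm ζ z)) s
    = toFun (mulOperator hm ζ (mulOperator hm ξ z)) s
  rw [h1, h2, h3, h4]
  ring

lemma mulOperator_one (hm : 3 ≤ m) (ξ : evenSpace ℂ m) :
    mulOperator hm ξ (evenConst m 1) = ξ := by
  refine evenSpace_ext ?_
  filter_upwards [toFun_mulOperator hm ξ (evenConst m 1), toFun_evenConst m (1 : ℂ)] with s h1 h2
  rw [h1, h2, mul_one]

/-- The exponential map of the algebra `F^m[ℂ]`, for `m ≥ 3`. -/
def evenExp (hm : 3 ≤ m) : evenSpace ℂ m → evenSpace ℂ m :=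
  expMap (mulOperator hm) (evenConst m 1)

lemma toFun_mulOperator_pow (hm : 3 ≤ m) (ξ : evenSpace ℂ m) (n : ℕ) :
    ∀ᵐ s ∂intervalMeasure,
      toFun ((mulOperator hm ξ ^ n) (evenConst m 1)) s = toFun ξ s ^ n := by
  induction n with
  | zero => simpa using toFun_evenConst m (1 : ℂ)
  | succ n ih =>
    filter_upwards [ih, toFun_mulOperator hm ξ ((mulOperator hm ξ ^ n) (evenConst m 1))]
      with s h1 h2
    rw [pow_succ', pow_succ', ← h1, ← h2]
    rfl

/-- Partial sums of the operator series converge in norm, so almost everywhere along a subsequence,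
while pointwise they are partial sums of the scalar series. -/
lemma toFun_evenExp (hm : 3 ≤ m) (ξ : evenSpace ℂ m) :
    ∀ᵐ s ∂intervalMeasure, toFun (evenExp hm ξ) s = Complex.exp (toFun ξ s) := by
  let S : ℕ → evenSpace ℂ m := fun n =>
    ∑ i ∈ Finset.range n, (i.factorial⁻¹ : ℝ) • (mulOperator hm ξ ^ i) (evenConst m 1)
  have h1 : Tendsto S atTop (𝓝 (evenExp hm ξ)) :=
    ((NormedSpace.exp_series_hasSum_exp' (𝕂 := ℝ) (mulOperator hm ξ)).mapL
      (ContinuousLinearMap.apply ℝ (evenSpace ℂ m) (evenConst m 1))).tendsto_sum_nat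
  have h2 : ∀ n : ℕ, ∀ᵐ s ∂intervalMeasure,
      toFun (S n) s = ∑ i ∈ Finset.range n, (i.factorial⁻¹ : ℝ) • toFun ξ s ^ i := by
    intro n
    induction n with
    | zero => exact coe_zero_ae
    | succ n ih =>
      have hS : S (n + 1) = S n + (n.factorial⁻¹ : ℝ) • (mulOperator hm ξ ^ n) (evenConst m 1) :=
        Finset.sum_range_succ _ _
      rw [hS]
      filter_upwards [ih, toFun_mulOperator_pow hm ξ n, coe_add_ae (S n)
        ((n.factorial⁻¹ : ℝ) • (mulOperator hm ξ ^ n) (evenConst m 1)),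
        coe_smul_ae (n.factorial⁻¹ : ℝ) ((mulOperator hm ξ ^ n) (evenConst m 1))]
        with s k1 k2 k3 k4
      rw [k3, Pi.add_apply, k1, k4, Pi.smul_apply, k2, Finset.sum_range_succ]
  obtain ⟨φ, h3, h4⟩ := (isRealization_toFun m).exists_subseq _ _ h1
  filter_upwards [h4, ae_all_iff.2 h2] with s k1 k2
  refine tendsto_nhds_unique k1 ?_
  simp only [k2]
  have h5 := (NormedSpace.exp_series_hasSum_exp' (𝕂 := ℝ) (toFun ξ s)).tendsto_sum_nat
  rw [← Complex.exp_eq_exp_ℂ] at h5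
  exact h5.comp h3.tendsto_atTop

end ExponentialOfFunctions

/-! ### Slice charts for m ≥ 3 -/

section SliceChart

variable {m : ℕ}

lemma mem_imaginarySubspace_iff (ξ : evenSpace ℂ m) :
    ξ ∈ imaginarySubspace m ↔ evenMap m Complex.reCLM ξ = 0 := by
  constructor
  · intro h
    refine evenSpace_ext ?_
    filter_upwards [h, toFun_evenMap Complex.reCLM ξ, coe_zero_ae (E := ℝ) (m := m)]
      with s h1 h2 h3
    rw [h2, h3, Complex.reCLM_apply, h1]
    rfl
  · intro h
    change ∀ᵐ s ∂intervalMeasure, (toFun ξ s).re = 0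
    filter_upwards [toFun_evenMap Complex.reCLM ξ, coe_zero_ae (E := ℝ) (m := m)] with s h1 h2
    rw [← Complex.reCLM_apply, ← h1, h, h2]
    rfl

lemma isClosed_imaginarySubspace : IsClosed (imaginarySubspace m : Set (evenSpace ℂ m)) := by
  have : (imaginarySubspace m : Set (evenSpace ℂ m)) = evenMap m Complex.reCLM ⁻¹' {0} := by
    ext ξ
    exact mem_imaginarySubspace_iff ξ
  rw [this]
  exact isClosed_singleton.preimage (evenMap m Complex.reCLM).continuous

/-- This is |e^ξ| = e^{Re ξ}. -/
lemma mem_imaginarySubspace_iff_mem_arcSpace (hm : 3 ≤ m) (ξ : evenSpace ℂ m) :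
    ξ ∈ imaginarySubspace m ↔ (derivEquiv m).symm (evenExp hm ξ) ∈ arcSpace m := by
  rw [mem_arcSpace_iff, ContinuousLinearEquiv.apply_symm_apply]
  have h := toFun_evenExp hm ξ
  constructor
  · intro hξ
    filter_upwards [h, hξ] with s h1 h2
    rw [h1, Complex.norm_exp, h2, Real.exp_zero]
  · intro hξ
    change ∀ᵐ s ∂intervalMeasure, (toFun ξ s).re = 0
    filter_upwards [h, hξ] with s h1 h2
    rwa [h1, Complex.norm_exp, Real.exp_eq_one_iff] at h2

/-- Around the curve `η` with `η' = exp ξ` there is a chart taking a curve to the logarithm of its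
derivative. -/
lemma exists_sliceChart (hm : 3 ≤ m) (ξ : evenSpace ℂ m) :
    ∃ Φ : OpenPartialHomeomorph (curveSpace (m + 1)) (evenSpace ℂ m), ξ ∈ Φ.target ∧
      IsSliceChart (arcSpace m) (imaginarySubspace m) Φ ∧
      ∀ ζ, Φ.symm ζ = (derivEquiv m).symm (evenExp hm ζ) := by
  obtain ⟨φ, h1, h2, h3⟩ := exists_openPartialHomeomorph_expMap (commute_mulOperator hm)
    (mulOperator_one hm) ξ
  let Φ := (derivEquiv m).toHomeomorph.toOpenPartialHomeomorph ≫ₕ φ.symm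
  have hsource : Φ.source = derivEquiv m ⁻¹' φ.target := by simp [Φ]
  have htarget : Φ.target = φ.source := by simp [Φ]
  have hΦ : ⇑Φ = φ.symm ∘ derivEquiv m := rfl
  have hΦs : ∀ ζ, Φ.symm ζ = (derivEquiv m).symm (evenExp hm ζ) := fun ζ => by
    change (derivEquiv m).symm (φ ζ) = _
    rw [h2]
    rfl
  refine ⟨Φ, by rwa [htarget], ⟨isClosed_imaginarySubspace, ?_, ?_, ?_⟩, hΦs⟩
  · rw [hΦ, hsource]
    exact h3.comp (derivEquiv m).contDiff.contDiffOn fun _ h => h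
  · have : ⇑Φ.symm = (derivEquiv m).symm ∘ evenExp hm := funext hΦs
    rw [this]
    exact ((derivEquiv m).symm.contDiff.comp contDiff_expMap).contDiffOn
  · refine OpenPartialHomeomorph.IsImage.image_eq fun η hη => ?_
    have := mem_imaginarySubspace_iff_mem_arcSpace hm (Φ η)
    rwa [← hΦs, Φ.left_inv hη] at this

lemma velocity_sliceChart (hm : 3 ≤ m)
    {Φ : OpenPartialHomeomorph (curveSpace (m + 1)) (evenSpace ℂ m)}
    (hΦ : ∀ ζ, Φ.symm ζ = (derivEquiv m).symm (evenExp hm ζ)) {η : curveSpace (m + 1)}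
    (hη : η ∈ Φ.source) :
    ∀ᵐ s ∂intervalMeasure, velocity η s = Complex.exp (toFun (Φ η) s) := by
  have h := hΦ (Φ η)
  rw [Φ.left_inv hη] at h
  filter_upwards [velocity_derivEquiv_symm (evenExp hm (Φ η)), toFun_evenExp hm (Φ η)]
    with s h1 h2
  rw [← h2, ← h1, ← h]

end SliceChart

/-! ### Phases of unimodular functions -/

section Phase

open ComplexConjugate

lemma IsPrimitive.conj {F g : ℝ → ℂ} (hF : IsPrimitive F g) :
    IsPrimitive (fun s => conj (F s)) (fun s => conj (g s)) :=
  hF.clm (Complex.conjCLE : ℂ →L[ℝ] ℂ)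

lemma isPrimitive_integral {g : ℝ → E} (hg : LocallyIntegrableOn g (Ioo (-1 : ℝ) 1)) :
    IsPrimitive (fun s => ∫ t in (0 : ℝ)..s, g t) g :=
  ⟨hg, fun s _ => by simp⟩

lemma IsPrimitive.const_add {F g : ℝ → E} (hF : IsPrimitive F g) (c : E) :
    IsPrimitive (fun s => c + F s) g := by
  refine ⟨hF.1, fun s hs => ?_⟩
  change c + F s = c + F 0 + _
  rw [hF.2 s hs, add_assoc]

lemma IsPrimitive.eq_of_zero {F g : ℝ → E} (hF : IsPrimitive F g)
    (hg : g =ᵐ[intervalMeasure] 0) {s : ℝ} (hs : s ∈ Ioo (-1 : ℝ) 1) : F s = F 0 := by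
  rw [(hF.congr_right hg).2 s hs]
  simp

lemma IsPrimitive.norm_eq_one {F g : ℝ → ℂ} (hF : IsPrimitive F g)
    (h : ∀ᵐ s ∂intervalMeasure, ‖F s‖ = 1) {s : ℝ} (hs : s ∈ Ioo (-1 : ℝ) 1) : ‖F s‖ = 1 :=
  Measure.eqOn_of_ae_eq (f := fun s => ‖F s‖) (g := fun _ => (1 : ℝ)) h hF.continuousOn.norm
    continuousOn_const (by rw [interior_Ioo]; exact subset_closure) hs

/-- For a function of modulus one, `F' = i ϑ F` with the real function `ϑ = Im (F' conj F)`. -/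
lemma IsPrimitive.deriv_of_norm_one {F g : ℝ → ℂ} (hF : IsPrimitive F g)
    (h : ∀ s ∈ Ioo (-1 : ℝ) 1, ‖F s‖ = 1) :
    ∀ᵐ s ∂intervalMeasure, g s = Complex.I * ((g s * conj (F s)).im : ℂ) * F s := by
  have hsq : ∀ s ∈ Ioo (-1 : ℝ) 1, F s * conj (F s) = 1 := fun s hs => by
    rw [Complex.mul_conj, Complex.normSq_eq_norm_sq, h s hs]
    simp
  have h1 := ((hF.mul hF.conj).congr_left hsq).ae_unique (IsPrimitive.const (1 : ℂ))
  filter_upwards [h1, ae_restrict_mem measurableSet_Ioo] with s hs hs'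
  have h2 : (g s * conj (F s)).re = 0 := by
    have := congrArg Complex.re hs
    simp only [Complex.add_re, Complex.mul_re, Complex.conj_re, Complex.conj_im, Pi.zero_apply,
      Complex.zero_re] at this ⊢
    linarith
  have h3 : Complex.I * ((g s * conj (F s)).im : ℂ) = g s * conj (F s) := by
    apply Complex.ext <;> simp [-Complex.mul_re, -Complex.mul_im, h2, Complex.I_mul_re, Complex.I_mul_im]
  rw [h3, mul_assoc, mul_comm (conj (F s)), hsq s hs', mul_one]

/-- Integrate θ' = Im (g conj F) from the initial value arg F(0). Then F e^{-iθ} has derivative zero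
and equals 1 at the origin. -/
lemma exists_phase {F g : ℝ → ℂ} (hF : IsPrimitive F g)
    (h : ∀ s ∈ Ioo (-1 : ℝ) 1, ‖F s‖ = 1) :
    ∃ θ : ℝ → ℝ, IsPrimitive θ (fun s => (g s * conj (F s)).im) ∧
      ∀ s ∈ Ioo (-1 : ℝ) 1, F s = Complex.exp (Complex.I * θ s) := by
  have hl : LocallyIntegrableOn (fun s => (g s * conj (F s)).im) (Ioo (-1 : ℝ) 1) :=
    ((isPrimitive_integral (IsPrimitive.locallyIntegrableOn_bilin
      (ContinuousLinearMap.mul ℝ ℂ).flip hF.conj.continuousOn hF.1)).clm Complex.imCLM).1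
  have hθ := (isPrimitive_integral hl).const_add (F 0).arg
  refine ⟨_, hθ, fun s hs => ?_⟩
  set θ : ℝ → ℝ := fun s => (F 0).arg + ∫ t in (0 : ℝ)..s, (g t * conj (F t)).im with hθd
  have h1 := ((hθ.clm Complex.ofRealCLM).const_mul (-Complex.I)).comp_exp
  have h2 := (hF.mul h1).eq_of_zero (by
    filter_upwards [hF.deriv_of_norm_one h] with s hs
    simp only [Complex.ofRealCLM_apply, Pi.zero_apply]
    rw [neg_mul Complex.I]
    linear_combination (Complex.exp (-Complex.I * (θ s : ℂ))) * hs) hs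
  have h3 : F 0 = Complex.exp (Complex.I * θ 0) := by
    have := Complex.norm_mul_exp_arg_mul_I (F 0)
    rw [h 0 zero_mem_interval] at this
    simp only [Complex.ofReal_one, one_mul] at this
    simp only [hθd, intervalIntegral.integral_same, add_zero]
    rw [mul_comm Complex.I, this]
  simp only [Complex.ofRealCLM_apply] at h2
  rw [h3, ← Complex.exp_add, neg_mul, neg_mul, add_neg_cancel, Complex.exp_zero,
    Complex.exp_neg] at h2
  rw [← div_eq_mul_inv, div_eq_one_iff_eq (Complex.exp_ne_zero _)] at h2
  exact h2

end Phase

/-! ### Surjectivity: lifting within the Sobolev spaces -/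

section Lift

open ComplexConjugate

variable {m : ℕ}

/-- The derivatives of a phase of `F`, in terms of the derivatives of `F`. -/
def phaseJet (θ : ℝ → ℝ) (F : ℕ → ℝ → ℂ) : ℕ → ℝ → ℝ
  | 0 => θ
  | j + 1 => fun s => (leibniz (fun i => F (i + 1)) (fun i s => conj (F i s)) j s).im

/-- The factor conj F has modulus one, so θ' = Im (F' conj F) is as integrable as F', and θ follows
by integration. Higher orders use the product estimates if m ≥ 3; otherwise only order two remains.
-/
lemma memLp_phaseJet (hm : 1 ≤ m) {F : ℕ → ℝ → ℂ} {θ : ℝ → ℝ}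
    (hF : ∀ j < m, IsPrimitive (F j) (F (j + 1)))
    (hL : ∀ j ≤ m, MemLp (F j) 2 (weightMeasure (1 + j)))
    (h : ∀ s ∈ Ioo (-1 : ℝ) 1, ‖F 0 s‖ = 1) (hθ : IsPrimitive θ (phaseJet θ F 1)) {j : ℕ}
    (hj : j ≤ m) : MemLp (phaseJet θ F j) 2 (weightMeasure (1 + j)) := by
  have hb : ∀ k, MemLp (F k) 2 (weightMeasure (1 + k)) →
      MemLp (fun s => F k s * conj (F 0 s)) 2 (weightMeasure (1 + k)) := fun k hk => by
    have := memLp_mul_of_bound (F := fun s => conj (F 0 s)) (i := 0) (C := 1)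
      ((hF 0 hm).conj.continuousOn.aestronglyMeasurable measurableSet_Ioo)
      ((ae_restrict_mem measurableSet_Ioo).mono fun s hs => by
        rw [pow_zero, one_smul, Complex.norm_conj, h s hs]) hk
    simpa only [mul_comm (F k _), zero_add] using this
  have hone : MemLp (phaseJet θ F 1) 2 (weightMeasure 2) := by
    have := Complex.imCLM.comp_memLp' (hb 1 (hL 1 hm))
    simpa [phaseJet, leibniz, Function.comp_def, -Complex.mul_im] using this
  rcases j with _ | j
  · exact hθ.memLp_one hone
  by_cases hm3 : 3 ≤ m
  · refine Complex.imCLM.comp_memLp' (memLp_leibniz fun i k hik => ?_)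
    have := memLp_mul_of_ladder hm3 (G := fun i s => conj (F i s)) hF hL (fun i hi => (hF i hi).conj)
      (fun i hi => (Complex.conjCLE : ℂ →L[ℝ] ℂ).comp_memLp' (hL i hi)) (i := i + 1) (k := k)
      (by omega)
    rwa [show i + 1 + k = j + 1 by omega] at this
  · have hj2 : j = 0 ∨ j = 1 := by omega
    rcases hj2 with rfl | rfl
    · exact hone
    · have := Complex.imCLM.comp_memLp' (hb 2 (hL 2 hj))
      -- The Leibniz term F' conj F' is real and disappears from the imaginary part.
      refine (memLp_congr_ae (Eventually.of_forall fun s => ?_)).1 this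
      simp [phaseJet, leibniz, Finset.Nat.antidiagonal_succ]
      ring

/-- Every even function of modulus one in `F^m[ℂ]` is `exp (i θ)` for some `θ` in `F^m[ℝ]`. -/
lemma exists_lift (hm : 1 ≤ m) (f : evenSpace ℂ m) (hf : ∀ᵐ s ∂intervalMeasure, ‖toFun f s‖ = 1) :
    ∃ θ : evenSpace ℝ m,
      ∀ᵐ s ∂intervalMeasure, toFun f s = Complex.exp (Complex.I * ((toFun θ s : ℝ) : ℂ)) := by
  obtain ⟨F, hF1, hF2⟩ := exists_representatives f.2.1
  have hF0 := hF1 0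
  rw [← toFun_eq_jet] at hF0
  have hn : ∀ s ∈ Ioo (-1 : ℝ) 1, ‖F 0 s‖ = 1 := fun s hs => (hF2 0 hm).norm_eq_one (by
    filter_upwards [hF0, hf] with s h1 h2
    rw [← h1, h2]) hs
  obtain ⟨θ, h1, h2⟩ := exists_phase (hF2 0 hm) hn
  have hp : IsPrimitive θ (phaseJet θ F 1) := by
    simpa [phaseJet, leibniz, -Complex.mul_im] using h1
  have he0 : ∀ᵐ s ∂intervalMeasure, F 0 (-s) = (1 : ℝ) • F 0 s := by
    filter_upwards [hF0, ae_comp_neg hF0, ae_even f] with s k1 k2 k3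
    rw [one_smul, ← k1, ← k2, k3]
  have he1 := (hF2 0 hm).isWeakDeriv.ae_parity he0
  -- F is even and F' odd, so θ' is odd and its integral from 0 is even.
  have heven : ∀ s ∈ Ioo (-1 : ℝ) 1, θ (-s) = θ s := fun s hs => by
    have h3 := (h1.comp_neg.congr_right (g' := fun s => (F 1 s * conj (F 0 s)).im) (by
      filter_upwards [he0, he1] with s k1 k2
      rw [zero_add] at k2
      rw [k1, k2, one_smul, neg_smul, one_smul, neg_mul, Complex.neg_im, neg_neg])).2 s hs
    rw [h1.2 s hs]
    simpa only [neg_zero] using h3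
  obtain ⟨ψ, hψ⟩ := exists_evenSpace (m := m) (phaseJet θ F)
    (fun j hj => memLp_phaseJet hm hF2 (fun j _ => memLp_representative (hF1 j)) hn hp hj)
    (fun j hj => by
      rcases j with _ | j
      · exact hp.isWeakDeriv
      · exact ((isPrimitive_leibniz (F := fun i => F (i + 1)) (G := fun i s => conj (F i s))
          (fun i hi => hF2 (i + 1) (by omega))
          (fun i hi => (hF2 i (by omega)).conj)).clm Complex.imCLM).isWeakDeriv)
    ((ae_restrict_mem measurableSet_Ioo).mono heven)
  refine ⟨ψ, ?_⟩
  have hψ0 := hψ 0 (Nat.zero_le m)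
  rw [← toFun_eq_jet] at hψ0
  filter_upwards [hψ0, hF0, ae_restrict_mem measurableSet_Ioo] with s k1 k2 k3
  rw [k1, k2, h2 s k3]
  rfl

/-- The derivatives of a phase. -/
lemma jet_phase {f : evenSpace ℂ m} {θ : evenSpace ℝ m}
    (h : ∀ᵐ s ∂intervalMeasure, toFun f s = Complex.exp (Complex.I * ((toFun θ s : ℝ) : ℂ))) :
    (1 ≤ m → ∀ᵐ s ∂intervalMeasure, jet f.1 1 s
      = Complex.exp (Complex.I * ((toFun θ s : ℝ) : ℂ)) * (Complex.I * ((jet θ.1 1 s : ℝ) : ℂ))) ∧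
    (2 ≤ m → ∀ᵐ s ∂intervalMeasure, jet f.1 2 s = Complex.exp (Complex.I * ((toFun θ s : ℝ) : ℂ))
      * (Complex.I * ((jet θ.1 2 s : ℝ) : ℂ) - ((jet θ.1 1 s : ℝ) : ℂ) ^ 2)) := by
  obtain ⟨F, hF1, hF2⟩ := exists_representatives f.2.1
  obtain ⟨Θ, hΘ1, hΘ2⟩ := exists_representatives θ.2.1
  have hF0 := hF1 0
  have hΘ0 := hΘ1 0
  rw [← toFun_eq_jet] at hF0 hΘ0
  have key : 1 ≤ m → IsPrimitive (fun s => Complex.exp (Complex.I * (Θ 0 s : ℂ)))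
      (fun s => Complex.I * (Θ 1 s : ℂ) * Complex.exp (Complex.I * (Θ 0 s : ℂ))) := fun hm =>
    (((hΘ2 0 hm).clm Complex.ofRealCLM).const_mul Complex.I).comp_exp
  have h0 : F 0 =ᵐ[intervalMeasure] fun s => Complex.exp (Complex.I * (Θ 0 s : ℂ)) := by
    filter_upwards [h, hF0, hΘ0] with s k1 k2 k3
    rw [← k2, k1, k3]
  have h1 : 1 ≤ m → F 1 =ᵐ[intervalMeasure]
      fun s => Complex.I * (Θ 1 s : ℂ) * Complex.exp (Complex.I * (Θ 0 s : ℂ)) := fun hm =>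
    (hF2 0 hm).isWeakDeriv.ae_unique (key hm).isWeakDeriv h0
  refine ⟨fun hm => ?_, fun hm => ?_⟩
  · filter_upwards [h1 hm, hF1 1, hΘ1 1, hΘ0] with s k1 k2 k3 k4
    rw [k2, k1, k3, k4]
    ring
  · have h2 := (hF2 1 hm).isWeakDeriv.ae_unique
      ((((hΘ2 1 hm).clm Complex.ofRealCLM).const_mul Complex.I).mul
        (key (by omega))).isWeakDeriv (h1 (by omega))
    filter_upwards [h2, hF1 2, hΘ1 1, hΘ1 2, hΘ0] with s k1 k2 k3 k4 k5
    rw [k2, k1, k3, k4, k5]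
    simp only [Complex.ofRealCLM_apply]
    linear_combination (Complex.exp (Complex.I * (Θ 0 s : ℂ)) * (Θ 1 s : ℂ) ^ 2) * Complex.I_sq

end Lift

/-! ### A weighted Hardy inequality -/

section Hardy

/-- A weighted Hardy inequality, in qualitative form. -/
lemma IsPrimitive.memLp_one_of_memLp {g h : ℝ → ℝ} (hg : IsPrimitive g h)
    (h2 : MemLp g 2 (weightMeasure 2)) (h3 : MemLp h 2 (weightMeasure 3)) :
    MemLp g 2 (weightMeasure 1) := by
  -- The multiplier is odd and positive for s > 0, so in the integral of (g² φ)' over [-r, r] both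
  -- boundary contributions are nonnegative and can be dropped.
  let φ : ℝ → ℝ := fun s => (1 - s ^ 2) ^ 2 * s
  have hφd : ∀ s, deriv φ s = (1 - s ^ 2) ^ 2 - 4 * s ^ 2 * (1 - s ^ 2) := fun s => by
    have h1 : HasDerivAt (fun t : ℝ => 1 - t ^ 2) (-(2 * s)) s := by
      simpa using (hasDerivAt_pow 2 s).const_sub 1
    have := ((h1.fun_pow 2).fun_mul (hasDerivAt_id' s)).deriv
    rw [show deriv φ s = _ from this]
    norm_num
    ring
  have hφ : IsPrimitive φ (deriv φ) := IsPrimitive.of_contDiff (by fun_prop)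
  have hP := (hg.bilin (ContinuousLinearMap.mul ℝ ℝ) hg).bilin (ContinuousLinearMap.mul ℝ ℝ) hφ
  simp only [ContinuousLinearMap.mul_apply'] at hP
  set p : ℝ → ℝ := fun s => g s * g s * deriv φ s + (g s * h s + h s * g s) * φ s with hp
  have hq : IntegrableOn (fun s => 3 * ‖sqrtWeight s ^ 2 • g s‖ ^ 2
      + 1 / 2 * ‖sqrtWeight s ^ 3 • h s‖ ^ 2) (Ioo (-1 : ℝ) 1) :=
    ((integrable_norm_sq_smul h2).const_mul 3).add ((integrable_norm_sq_smul h3).const_mul (1 / 2))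
  set q : ℝ → ℝ := fun s => 3 * ‖sqrtWeight s ^ 2 • g s‖ ^ 2
      + 1 / 2 * ‖sqrtWeight s ^ 3 • h s‖ ^ 2 with hqd
  have hq0 : ∀ s, 0 ≤ q s := fun s => by positivity
  have hpq : ∀ s ∈ Ioo (-1 : ℝ) 1, 2 * ‖sqrtWeight s ^ 1 • g s‖ ^ 2 ≤ q s - p s := by
    intro s hs
    have hw := one_sub_sq_pos hs
    simp only [hqd, hp, hφd, φ, smul_eq_mul, Real.norm_eq_abs, sq_abs, mul_pow, ← pow_mul]
    rw [mul_comm 1 2, mul_comm 2 2, mul_comm 3 2, pow_mul _ 2 1, pow_mul _ 2 2, pow_mul _ 2 3,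
      sqrtWeight_sq hs]
    -- With W = 1 - s², the difference q - p - 2 W g² is exactly ½ W (2 s g - W h)²; the
    -- coefficients 3 and 1/2 of q are those that complete this square.
    have key : 0 ≤ (1 - s ^ 2) * (2 * s * g s - (1 - s ^ 2) * h s) ^ 2 := by positivity
    nlinarith [key]
  have hFm : AEStronglyMeasurable g intervalMeasure :=
    hg.continuousOn.aestronglyMeasurable measurableSet_Ioo
  refine memLp_weight_iff.2 ⟨hFm, ?_⟩
  have hm : AEStronglyMeasurable (fun s => sqrtWeight s ^ 1 • g s) intervalMeasure :=
    (continuous_sqrtWeight.pow 1).aestronglyMeasurable.smul hFm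
  refine (memLp_two_iff_integrable_sq_norm hm).2 ?_
  let r : ℕ → ℝ := fun n => 1 - 1 / ((n : ℝ) + 1)
  have hr0 : ∀ n, 0 ≤ r n := fun n => by
    have : 1 / ((n : ℝ) + 1) ≤ 1 := by
      rw [div_le_one (by positivity)]
      linarith [n.cast_nonneg (α := ℝ)]
    simp only [r]
    linarith
  have hr1 : ∀ n, r n < 1 := fun n => by
    have : 0 < 1 / ((n : ℝ) + 1) := by positivity
    simp only [r]
    linarith
  have hr : Tendsto r atTop (𝓝 1) := by
    simpa [r] using (tendsto_const_nhds (x := (1 : ℝ))).sub tendsto_one_div_add_atTop_nhds_zero_nat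
  have hmem : ∀ n, r n ∈ Ioo (-1 : ℝ) 1 := fun n => ⟨by linarith [hr0 n], hr1 n⟩
  have hsub : ∀ n, Icc (-r n) (r n) ⊆ Ioo (-1 : ℝ) 1 := fun n =>
    Icc_subset_Ioo (neg_mem_interval (hmem n)).1 (hr1 n)
  have hcont : ContinuousOn (fun s => ‖sqrtWeight s ^ 1 • g s‖ ^ 2) (Ioo (-1 : ℝ) 1) :=
    (((continuous_sqrtWeight.pow 1).continuousOn.smul hg.continuousOn).norm).pow 2
  refine AECover.integrable_of_integral_bounded_of_nonneg_ae
    (aecover_Ioo_of_Icc (a := fun n => -r n) (b := r) (l := atTop) (by simpa using hr.neg) hr)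
    (∫ s in Ioo (-1 : ℝ) 1, q s) (fun n => ?_) (Eventually.of_forall fun s => by positivity)
    (Eventually.of_forall fun n => ?_)
  · exact ((hcont.mono (hsub n)).integrableOn_Icc).mono_measure Measure.restrict_le_self
  · have hle : -r n ≤ r n := by linarith [hr0 n]
    have hi : ∀ {f : ℝ → ℝ}, IntegrableOn f (Icc (-r n) (r n)) →
        IntervalIntegrable f volume (-r n) (r n) := fun hf =>
      (intervalIntegrable_iff_integrableOn_Icc_of_le hle).2 hf
    have i1 := hi ((hcont.mono (hsub n)).integrableOn_Icc)
    have i2 := hi (hq.mono_set (hsub n))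
    have i3 : IntervalIntegrable p volume (-r n) (r n) :=
      intervalIntegrable_of_locallyIntegrableOn hP.1 (neg_mem_interval (hmem n)) (hmem n)
    have e1 := intervalIntegral.integral_mono_on hle (i1.const_mul 2) (i2.sub i3)
      fun s hs => hpq s (hsub n hs)
    rw [intervalIntegral.integral_const_mul, intervalIntegral.integral_sub i2 i3,
      ← hP.sub_eq (neg_mem_interval (hmem n)) (hmem n)] at e1
    have e2 : ∫ s in (-r n)..(r n), q s ≤ ∫ s in Ioo (-1 : ℝ) 1, q s := by
      rw [intervalIntegral.integral_of_le hle]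
      exact setIntegral_mono_set hq (Eventually.of_forall hq0)
        (Ioc_subset_Icc_self.trans (hsub n)).eventuallyLE
    have e3 : 0 ≤ ∫ s in (-r n)..(r n), ‖sqrtWeight s ^ 1 • g s‖ ^ 2 :=
      intervalIntegral.integral_nonneg hle fun s _ => by positivity
    have e4 : 0 ≤ g (r n) * g (r n) * φ (r n) :=
      mul_nonneg (mul_self_nonneg _) (mul_nonneg (by positivity) (hr0 n))
    have e5 : g (-r n) * g (-r n) * φ (-r n) ≤ 0 :=
      mul_nonpos_of_nonneg_of_nonpos (mul_self_nonneg _)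
        (mul_nonpos_of_nonneg_of_nonpos (by positivity) (by linarith [hr0 n]))
    rw [Measure.restrict_restrict_of_subset (hsub n), integral_Icc_eq_integral_Ioc,
      ← intervalIntegral.integral_of_le hle]
    linarith

end Hardy

/-! ### Bounded multipliers and L² convergence -/

section Multipliers

lemma norm_sq_eq_integral {μ : Measure ℝ} (f : Lp E 2 μ) : ‖f‖ ^ 2 = ∫ s, ‖f s‖ ^ 2 ∂μ := by
  rw [← real_inner_self_eq_norm_sq, L2.inner_def]
  simp only [real_inner_self_eq_norm_sq]

lemma integral_weight_norm_sq {k : ℕ} (f : Lp E 2 (weightMeasure k)) :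
    ∫ s in Ioo (-1 : ℝ) 1, ‖sqrtWeight s ^ k • f s‖ ^ 2 = ‖f‖ ^ 2 := by
  have h := (memLp_weight_iff.1 (Lp.memLp f)).2
  have h1 : ‖h.toLp‖ = ‖f‖ := by
    rw [Lp.norm_toLp, Lp.norm_def, eLpNorm_weight]
  rw [← h1, norm_sq_eq_integral]
  refine integral_congr_ae ?_
  filter_upwards [h.coeFn_toLp] with s hs
  rw [hs]

lemma tendsto_zero_of_dominated {μ : Measure ℝ} {w : ℕ → Lp E 2 μ} {u : Lp E 2 μ} {C : ℝ}
    (hle : ∀ n, ∀ᵐ s ∂μ, ‖w n s‖ ≤ C * ‖u s‖)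
    (h : ∀ᵐ s ∂μ, Tendsto (fun n => w n s) atTop (𝓝 0)) : Tendsto w atTop (𝓝 0) := by
  have hi : Integrable (fun s => (C * ‖u s‖) ^ 2) μ := by
    simp only [mul_pow]
    exact ((Lp.memLp u).integrable_norm_pow (p := 2) two_ne_zero).const_mul _
  have h1 := tendsto_integral_of_dominated_convergence (F := fun n s => ‖w n s‖ ^ 2)
    (f := fun _ => (0 : ℝ)) _ (fun n => (Lp.aestronglyMeasurable (w n)).norm.pow 2) hi
    (fun n => by
      filter_upwards [hle n] with s hs
      rw [Real.norm_of_nonneg (by positivity)]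
      gcongr)
    (by
      filter_upwards [h] with s hs
      simpa using (hs.norm.pow 2))
  simp only [← norm_sq_eq_integral, integral_zero] at h1
  refine tendsto_zero_iff_norm_tendsto_zero.2 ?_
  have h2 := (Real.continuous_sqrt.tendsto 0).comp h1
  simpa [Function.comp_def, Real.sqrt_sq (norm_nonneg _)] using h2

/-- Products `a n * u n` converge in `L²` if `u n` does, and if the functions `a n` have modulus at
most one and converge almost everywhere. -/
lemma tendsto_mul_of_bounded {k : ℕ} {u v : ℕ → Lp ℂ 2 (weightMeasure k)}
    {u' v' : Lp ℂ 2 (weightMeasure k)} {a : ℕ → ℝ → ℂ} {a' : ℝ → ℂ}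
    (hu : Tendsto u atTop (𝓝 u')) (ham : ∀ n, AEStronglyMeasurable (a n) intervalMeasure)
    (hb : ∀ n, ∀ᵐ s ∂intervalMeasure, ‖a n s‖ ≤ 1)
    (ha : ∀ᵐ s ∂intervalMeasure, Tendsto (fun n => a n s) atTop (𝓝 (a' s)))
    (hv : ∀ n, ∀ᵐ s ∂intervalMeasure, v n s = a n s * u n s)
    (hv' : ∀ᵐ s ∂intervalMeasure, v' s = a' s * u' s) : Tendsto v atTop (𝓝 v') := by
  have hz : ∀ n, MemLp (fun s => a n s * u' s) 2 (weightMeasure k) := fun n => by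
    refine (Lp.memLp u').of_le_mul (c := 1)
      (((ham n).mono_ac (weightMeasure_ac k)).mul (Lp.aestronglyMeasurable u')) ?_
    filter_upwards [(weightMeasure_ac k).ae_le (hb n)] with s hs
    rw [norm_mul]
    gcongr
  let z : ℕ → Lp ℂ 2 (weightMeasure k) := fun n => (hz n).toLp
  have hzc : ∀ n, ∀ᵐ s ∂weightMeasure k, z n s = a n s * u' s := fun n => (hz n).coeFn_toLp
  have hb' : ∀ᵐ s ∂weightMeasure k, ∀ n, ‖a n s‖ ≤ 1 :=
    (weightMeasure_ac k).ae_le (ae_all_iff.2 hb)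
  have ha' := (weightMeasure_ac k).ae_le ha
  -- Split at z n = a n u': the bound |a n| ≤ 1 handles v n - z n, and dominated convergence with
  -- majorant 2 ‖u'‖ handles z n - v'.
  have h1 : Tendsto (fun n => v n - z n) atTop (𝓝 0) := by
    have h0 := tendsto_iff_norm_sub_tendsto_zero.1 hu
    refine squeeze_zero_norm (fun n => ?_) h0
    refine Lp.norm_le_norm_of_ae_le ?_
    filter_upwards [Lp.coeFn_sub (v n) (z n), Lp.coeFn_sub (u n) u', hzc n, hb',
      (weightMeasure_ac k).ae_le (hv n)] with s k1 k2 k3 k4 k5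
    rw [k1, k2, Pi.sub_apply, Pi.sub_apply, k3, k5, ← mul_sub, norm_mul]
    exact mul_le_of_le_one_left (norm_nonneg _) (k4 n)
  have h2 : Tendsto (fun n => z n - v') atTop (𝓝 0) := by
    have hsub : ∀ n, ∀ᵐ s ∂weightMeasure k, (z n - v') s = (a n s - a' s) * u' s := fun n => by
      filter_upwards [Lp.coeFn_sub (z n) v', hzc n, (weightMeasure_ac k).ae_le hv'] with s k1 k2 k3
      rw [k1, Pi.sub_apply, k2, k3, sub_mul]
    refine tendsto_zero_of_dominated (u := u') (C := 2) (fun n => ?_) ?_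
    · filter_upwards [hsub n, hb', ha'] with s k1 k2 k3
      rw [k1, norm_mul]
      have : ‖a' s‖ ≤ 1 := le_of_tendsto k3.norm (Eventually.of_forall k2)
      gcongr
      exact (norm_sub_le _ _).trans (by linarith [k2 n])
    · filter_upwards [ae_all_iff.2 hsub, ha'] with s k1 k2
      simp only [k1]
      simpa using (k2.sub_const (a' s)).mul_const (u' s)
  have h3 := (h1.add h2).add_const v'
  simpa using h3

end Multipliers

open ComplexConjugate

variable {m : ℕ}

/-- The unimodular function `f` is `exp (i θ)`. -/
def IsPhase (f : evenSpace ℂ m) (θ : evenSpace ℝ m) : Prop :=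
  ∀ᵐ s ∂intervalMeasure, toFun f s = Complex.exp (Complex.I * ((toFun θ s : ℝ) : ℂ))

lemma aestronglyMeasurable_toFun (f : evenSpace E m) :
    AEStronglyMeasurable (toFun f) intervalMeasure := by
  rw [toFun_eq_jet]
  exact (memLp_weight_iff.1 (memLp_jet f.1 0)).1

lemma IsPhase.norm_eq_one {f : evenSpace ℂ m} {θ : evenSpace ℝ m} (h : IsPhase f θ) :
    ∀ᵐ s ∂intervalMeasure, ‖toFun f s‖ = 1 := by
  filter_upwards [h] with s hs
  rw [hs, mul_comm, Complex.norm_exp_ofReal_mul_I]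

lemma IsPhase.eq {f g : evenSpace ℂ m} {θ : evenSpace ℝ m} (hf : IsPhase f θ) (hg : IsPhase g θ) :
    f = g :=
  evenSpace_ext (EventuallyEq.trans hf (EventuallyEq.symm hg))

/-! ### First and second derivatives of exp (iθ) -/

section Derivatives

lemma exists_imaginaryDeriv {j : ℕ} (hj : j ≤ m) :
    ∃ G : evenSpace ℝ m →L[ℝ] Lp ℂ 2 (weightMeasure (1 + j)), ∀ θ,
      ∀ᵐ s ∂intervalMeasure, G θ s = Complex.I * ((jet θ.1 j s : ℝ) : ℂ) := by
  refine exists_clm_of_pointwise (isRealization_jet (evenSpace ℝ m) hj) (isRealization_Lp (1 + j))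
    (fun f g h => Lp.ext ((weightMeasure_ac _).ae_eq h))
    (fun _ => ContinuousLinearMap.mul ℝ ℂ Complex.I ∘L Complex.ofRealCLM) fun θ => ?_
  have h := (ContinuousLinearMap.mul ℝ ℂ Complex.I ∘L Complex.ofRealCLM).comp_memLp'
    (memLp_jet θ.1 j)
  exact ⟨h.toLp, (ac_weightMeasure _).ae_eq h.coeFn_toLp⟩

/-- Since θ'' has weight 3, w² θ' is bounded, while the Hardy inequality puts ψ' in weight 1. The
product therefore has weight 2 + 1. -/
lemma memLp_deriv_mul (hm : 2 ≤ m) (θ ψ : evenSpace ℝ m) :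
    MemLp (fun s => ((jet θ.1 1 s * jet ψ.1 1 s : ℝ) : ℂ)) 2 (weightMeasure 3) := by
  obtain ⟨A, hA1, hA2⟩ := exists_representatives θ.2.1
  obtain ⟨B, hB1, hB2⟩ := exists_representatives ψ.2.1
  have mA2 := memLp_representative (hA1 2)
  have mB1 := memLp_representative (hB1 1)
  have mB2 := memLp_representative (hB1 2)
  obtain ⟨C, -, hC⟩ := (hA2 1 hm).norm_le_of_memLp (k := 1) mA2
  have h1 : MemLp (B 1) 2 (weightMeasure 1) := (hB2 1 hm).memLp_one_of_memLp mB1 mB2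
  have h2 : MemLp (fun s => (A 1 s : ℂ) * (B 1 s : ℂ)) 2 (weightMeasure (2 + 1)) :=
    memLp_mul_of_bound (C := C)
      (((hA2 1 hm).clm Complex.ofRealCLM).continuousOn.aestronglyMeasurable measurableSet_Ioo)
      ((ae_restrict_mem measurableSet_Ioo).mono fun s hs => by
        rw [norm_smul, Complex.norm_real, Real.norm_of_nonneg (pow_nonneg (sqrtWeight_nonneg s) 2)]
        have hp := pow_pos (sqrtWeight_pos hs) 2
        rw [← le_div_iff₀' hp, div_eq_mul_inv]
        exact hC s hs) (Complex.ofRealCLM.comp_memLp' h1)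
  refine (memLp_congr_ae ((weightMeasure_ac 3).ae_eq ?_)).1 h2
  filter_upwards [hA1 1, hB1 1] with s k2 k3
  rw [k2, k3, Complex.ofReal_mul]

lemma exists_derivMul (hm : 2 ≤ m) :
    ∃ B : evenSpace ℝ m →L[ℝ] evenSpace ℝ m →L[ℝ] Lp ℂ 2 (weightMeasure 3), ∀ θ ψ,
      ∀ᵐ s ∂intervalMeasure, B θ ψ s = ((jet θ.1 1 s * jet ψ.1 1 s : ℝ) : ℂ) :=
  exists_bilin_of_pointwise (isRealization_jet (evenSpace ℝ m) (by omega : 1 ≤ m))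
    (isRealization_jet (evenSpace ℝ m) (by omega : 1 ≤ m)) (isRealization_Lp 3)
    (fun f g h => Lp.ext ((weightMeasure_ac _).ae_eq h))
    (ContinuousLinearMap.compL ℝ ℝ ℝ ℂ Complex.ofRealCLM ∘L ContinuousLinearMap.mul ℝ ℝ)
    fun θ ψ => ⟨(memLp_deriv_mul hm θ ψ).toLp,
      (ac_weightMeasure _).ae_eq (memLp_deriv_mul hm θ ψ).coeFn_toLp⟩

lemma exists_secondDeriv (hm : 2 ≤ m) :
    ∃ G : evenSpace ℝ m → Lp ℂ 2 (weightMeasure 3), Continuous G ∧ ∀ θ,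
      ∀ᵐ s ∂intervalMeasure,
        G θ s = Complex.I * ((jet θ.1 2 s : ℝ) : ℂ) - ((jet θ.1 1 s : ℝ) : ℂ) ^ 2 := by
  obtain ⟨G, hG⟩ := exists_imaginaryDeriv hm
  obtain ⟨B, hB⟩ := exists_derivMul hm
  refine ⟨fun θ => G θ - B θ θ, by fun_prop, fun θ => ?_⟩
  filter_upwards [(ac_weightMeasure 3).ae_eq (Lp.coeFn_sub (G θ) (B θ θ)), hG θ, hB θ θ]
    with s h1 h2 h3
  rw [h1, Pi.sub_apply, h2, h3]
  push_cast
  ring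

end Derivatives

/-! ### Existence of exp (iθ) in F^m[ℂ] -/

section PhaseMap

/-- Up to order two the derivatives of e^{iθ} are unimodular multiples of iθ' and iθ'' - θ'², and
θ'² is the only nonlinear term. -/
lemma exists_isPhase_of_le_two (hm : 1 ≤ m) (hm2 : m ≤ 2) (θ : evenSpace ℝ m) :
    ∃ f : evenSpace ℂ m, IsPhase f θ := by
  obtain ⟨Θ, h1, h2⟩ := exists_representatives θ.2.1
  have hΘ0 := h1 0
  rw [← toFun_eq_jet] at hΘ0
  let e : ℝ → ℂ := fun s => Complex.exp (Complex.I * (Θ 0 s : ℂ))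
  have he : IsPrimitive e fun s => Complex.I * (Θ 1 s : ℂ) * e s :=
    (((h2 0 hm).clm Complex.ofRealCLM).const_mul Complex.I).comp_exp
  have hem : AEStronglyMeasurable e intervalMeasure :=
    he.continuousOn.aestronglyMeasurable measurableSet_Ioo
  have he1 : ∀ s, ‖e s‖ = 1 := fun s => by
    simp only [e]
    rw [mul_comm, Complex.norm_exp_ofReal_mul_I]
  have hmul : ∀ {k : ℕ} {g : ℝ → ℂ}, MemLp g 2 (weightMeasure k) →
      MemLp (fun s => e s * g s) 2 (weightMeasure k) := fun {k g} hg => by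
    have := memLp_mul_of_bound (i := 0) (C := 1) hem
      (Eventually.of_forall fun s => by rw [pow_zero, one_smul, he1 s]) hg
    rwa [zero_add] at this
  let u : ℕ → ℝ → ℂ := fun j => match j with
    | 0 => e
    | 1 => fun s => e s * (Complex.I * (Θ 1 s : ℂ))
    | 2 => fun s => e s * (Complex.I * (Θ 2 s : ℂ) - (Θ 1 s : ℂ) ^ 2)
    -- Default value: orders above two do not occur, since m ≤ 2.
    | _ + 3 => 0
  obtain ⟨f, hf⟩ := exists_evenSpace (m := m) u
    (fun j hj => by
      have hj3 : j = 0 ∨ j = 1 ∨ j = 2 := by omega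
      rcases hj3 with rfl | rfl | rfl
      · exact he.memLp_of_bound (C := 1) fun s hs => by
          rw [he1 s, one_mul]
          exact one_le_inv_sqrtWeight_pow _ hs
      · obtain ⟨G, hG⟩ := exists_imaginaryDeriv hj
        refine hmul ((memLp_congr_ae ((weightMeasure_ac _).ae_eq ?_)).1 (Lp.memLp (G θ)))
        filter_upwards [hG θ, h1 1] with s k1 k2
        rw [k1, k2]
      · obtain ⟨G, -, hG⟩ := exists_secondDeriv hj
        refine hmul ((memLp_congr_ae ((weightMeasure_ac _).ae_eq ?_)).1 (Lp.memLp (G θ)))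
        filter_upwards [hG θ, h1 1, h1 2] with s k1 k2 k3
        rw [k1, k2, k3])
    (fun j hj => by
      have hj3 : j = 0 ∨ j = 1 := by omega
      rcases hj3 with rfl | rfl
      · refine (he.congr_right (Eventually.of_forall fun s => ?_)).isWeakDeriv
        exact mul_comm _ _
      · refine ((he.mul (((h2 1 hj).clm Complex.ofRealCLM).const_mul Complex.I)).congr_right
          (Eventually.of_forall fun s => ?_)).isWeakDeriv
        simp only [Complex.ofRealCLM_apply, u]
        linear_combination (e s * (Θ 1 s : ℂ) ^ 2) * Complex.I_sq)
    (by
      filter_upwards [ae_even θ, hΘ0, ae_comp_neg hΘ0] with s k1 k2 k3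
      simp only [u, e]
      rw [← k2, ← k3, k1])
  refine ⟨f, ?_⟩
  have hf0 := hf 0 (Nat.zero_le m)
  rw [← toFun_eq_jet] at hf0
  filter_upwards [hf0, hΘ0] with s k1 k2
  rw [k1, k2]

lemma isPhase_evenExp (hm : 3 ≤ m) (θ : evenSpace ℝ m) :
    IsPhase (evenExp hm (evenMap m (ContinuousLinearMap.mul ℝ ℂ Complex.I ∘L Complex.ofRealCLM) θ))
      θ := by
  filter_upwards [toFun_evenExp hm
    (evenMap m (ContinuousLinearMap.mul ℝ ℂ Complex.I ∘L Complex.ofRealCLM) θ),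
    toFun_evenMap (ContinuousLinearMap.mul ℝ ℂ Complex.I ∘L Complex.ofRealCLM) θ] with s h1 h2
  rw [h1, h2]
  rfl

lemma exists_isPhase (hm : 1 ≤ m) (θ : evenSpace ℝ m) : ∃ f : evenSpace ℂ m, IsPhase f θ := by
  by_cases hm3 : 3 ≤ m
  · exact ⟨_, isPhase_evenExp hm3 θ⟩
  · exact exists_isPhase_of_le_two hm (by omega) θ

end PhaseMap

/-! ### Continuity in both directions for m ≤ 2 -/

section Convergence

lemma tendsto_evenSpace {u : ℕ → evenSpace E m} {x : evenSpace E m}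
    (h : ∀ j (hj : j < m + 1), Tendsto (fun n => (u n).1 ⟨j, hj⟩) atTop (𝓝 (x.1 ⟨j, hj⟩))) :
    Tendsto u atTop (𝓝 x) := by
  refine tendsto_subtype_rng.2 ?_
  have h1 : Tendsto (fun n => (u n).1.ofLp) atTop (𝓝 x.1.ofLp) :=
    tendsto_pi_nhds.2 fun j => h j j.2
  exact ((PiLp.continuous_toLp 2 _).tendsto _).comp h1

/-- The functions `exp (i θ)` depend continuously on `θ`, for `m ≤ 2`. -/
lemma exists_subseq_isPhase (hm2 : m ≤ 2) {θ : ℕ → evenSpace ℝ m} {θ' : evenSpace ℝ m}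
    (hθ : Tendsto θ atTop (𝓝 θ')) {f : ℕ → evenSpace ℂ m} {f' : evenSpace ℂ m}
    (hf : ∀ n, IsPhase (f n) (θ n)) (hf' : IsPhase f' θ') :
    ∃ φ : ℕ → ℕ, StrictMono φ ∧ Tendsto (fun n => f (φ n)) atTop (𝓝 f') := by
  obtain ⟨φ, h1, h2⟩ := (isRealization_toFun m).exists_subseq θ θ' hθ
  have hφ := h1.tendsto_atTop
  have hconv : ∀ᵐ s ∂intervalMeasure,
      Tendsto (fun n => toFun (f (φ n)) s) atTop (𝓝 (toFun f' s)) := by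
    filter_upwards [h2, ae_all_iff.2 hf, hf'] with s k1 k2 k3
    simp only [k2, k3]
    have hc : Continuous fun x : ℝ => Complex.exp (Complex.I * (x : ℂ)) := by fun_prop
    exact (hc.tendsto _).comp k1
  have hb : ∀ n, ∀ᵐ s ∂intervalMeasure, ‖toFun (f (φ n)) s‖ ≤ 1 := fun n =>
    (hf (φ n)).norm_eq_one.mono fun s hs => hs.le
  have hmeas := fun n => aestronglyMeasurable_toFun (f (φ n))
  refine ⟨φ, h1, tendsto_evenSpace fun j hj => ?_⟩
  have hj3 : j = 0 ∨ j = 1 ∨ j = 2 := by omega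
  rcases hj3 with rfl | rfl | rfl
  -- Order zero is the product of f with the constant function 1, so the multiplier lemma applies to
  -- a constant sequence.
  · refine tendsto_mul_of_bounded (u := fun _ => (evenConst m (1 : ℂ)).1 0)
      (a := fun n => toFun (f (φ n))) tendsto_const_nhds hmeas hb hconv (fun n => ?_) ?_
    · filter_upwards [toFun_evenConst m (1 : ℂ)] with s hs
      change toFun (f (φ n)) s = toFun (f (φ n)) s * toFun (evenConst m (1 : ℂ)) s
      rw [hs, mul_one]
    · filter_upwards [toFun_evenConst m (1 : ℂ)] with s hs
      change toFun f' s = toFun f' s * toFun (evenConst m (1 : ℂ)) s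
      rw [hs, mul_one]
  · have hm : 1 ≤ m := by omega
    obtain ⟨G, hG⟩ := exists_imaginaryDeriv hm
    have key : ∀ (g : evenSpace ℂ m) (ψ : evenSpace ℝ m), IsPhase g ψ →
        ∀ᵐ s ∂intervalMeasure, g.1 ⟨1, hj⟩ s = toFun g s * G ψ s := fun g ψ h => by
      filter_upwards [(jet_phase h).1 hm, hG ψ, h] with s k1 k2 k3
      rw [jet_of_lt _ hj] at k1
      rw [k1, k2, k3]
    exact tendsto_mul_of_bounded (u := fun n => G (θ (φ n)))
      (a := fun n => toFun (f (φ n))) (((G.continuous.tendsto θ').comp hθ).comp hφ) hmeas hb hconv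
      (fun n => key _ _ (hf _)) (key _ _ hf')
  · have hm : 2 ≤ m := by omega
    obtain ⟨G, hGc, hG⟩ := exists_secondDeriv hm
    have key : ∀ (g : evenSpace ℂ m) (ψ : evenSpace ℝ m), IsPhase g ψ →
        ∀ᵐ s ∂intervalMeasure, g.1 ⟨2, hj⟩ s = toFun g s * G ψ s := fun g ψ h => by
      filter_upwards [(jet_phase h).2 hm, hG ψ, h] with s k1 k2 k3
      rw [jet_of_lt _ hj] at k1
      rw [k1, k2, k3]
    exact tendsto_mul_of_bounded (u := fun n => G (θ (φ n)))
      (a := fun n => toFun (f (φ n))) (((hGc.tendsto θ').comp hθ).comp hφ) hmeas hb hconv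
      (fun n => key _ _ (hf _)) (key _ _ hf')

lemma conj_mul_cancel_of_norm_eq_one {z : ℂ} (hz : ‖z‖ = 1) (w : ℂ) : conj z * (z * w) = w := by
  rw [← mul_assoc, mul_comm (conj z), Complex.mul_conj, Complex.normSq_eq_norm_sq, hz]
  simp

/-- The derivatives of `θ` depend continuously on `exp (i θ)`, for `m ≤ 2`. -/
lemma exists_subseq_phase_deriv (hm2 : m ≤ 2) {θ : ℕ → evenSpace ℝ m} {θ' : evenSpace ℝ m}
    {f : ℕ → evenSpace ℂ m} {f' : evenSpace ℂ m} (hlim : Tendsto f atTop (𝓝 f'))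
    (hf : ∀ n, IsPhase (f n) (θ n)) (hf' : IsPhase f' θ') :
    ∃ φ : ℕ → ℕ, StrictMono φ ∧
      (∀ᵐ s ∂intervalMeasure, Tendsto (fun n => toFun (f (φ n)) s) atTop (𝓝 (toFun f' s))) ∧
      ∀ j (hj : j < m + 1), 0 < j →
        Tendsto (fun n => (θ (φ n)).1 ⟨j, hj⟩) atTop (𝓝 (θ'.1 ⟨j, hj⟩)) := by
  obtain ⟨φ, h1, hconv⟩ := (isRealization_toFun m).exists_subseq f f' hlim
  refine ⟨φ, h1, hconv, fun j hj hj0 => ?_⟩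
  -- Multiplying f' and f'' by conj f leaves iθ' and iθ'' - θ'²; the square is real, so the
  -- imaginary parts are θ' and θ''.
  have key : ∀ (g : evenSpace ℂ m) (ψ : evenSpace ℝ m), IsPhase g ψ →
      ∀ᵐ s ∂intervalMeasure, ψ.1 ⟨j, hj⟩ s = (conj (toFun g s) * g.1 ⟨j, hj⟩ s).im := by
    intro g ψ h
    have hj3 : j = 1 ∨ j = 2 := by omega
    rcases hj3 with rfl | rfl
    · filter_upwards [(jet_phase h).1 (by omega), h, h.norm_eq_one] with s k1 k2 k3
      rw [← k2, jet_of_lt _ hj, jet_of_lt _ hj] at k1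
      rw [k1, conj_mul_cancel_of_norm_eq_one k3]
      simp
    · filter_upwards [(jet_phase h).2 (by omega), h, h.norm_eq_one] with s k1 k2 k3
      rw [← k2, jet_of_lt _ hj, jet_of_lt _ hj] at k1
      rw [k1, conj_mul_cancel_of_norm_eq_one k3, ← Complex.ofReal_pow]
      simp [-Complex.ofReal_pow]
  have hmem : ∀ (g : evenSpace ℂ m) (ψ : evenSpace ℝ m), IsPhase g ψ →
      MemLp (fun s => conj (toFun g s) * g.1 ⟨j, hj⟩ s) 2 (weightMeasure (1 + j)) := by
    intro g ψ h
    have := memLp_mul_of_bound (F := fun s => conj (toFun g s)) (i := 0) (C := 1)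
      (Complex.continuous_conj.comp_aestronglyMeasurable (aestronglyMeasurable_toFun g))
      (h.norm_eq_one.mono fun s hs => by rw [pow_zero, one_smul, Complex.norm_conj, hs])
      (Lp.memLp (g.1 ⟨j, hj⟩))
    rwa [zero_add] at this
  have hlim' : Tendsto (fun n => (f (φ n)).1 ⟨j, hj⟩) atTop (𝓝 (f'.1 ⟨j, hj⟩)) :=
    (tendsto_jet_component ((continuous_subtype_val.tendsto f').comp hlim) ⟨j, hj⟩).comp
      h1.tendsto_atTop
  have h2 : Tendsto (fun n => (hmem _ _ (hf (φ n))).toLp) atTop (𝓝 (hmem _ _ hf').toLp) :=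
    tendsto_mul_of_bounded (a := fun n s => conj (toFun (f (φ n)) s)) (a' := fun s => conj (toFun f' s))
      hlim'
      (fun n => Complex.continuous_conj.comp_aestronglyMeasurable
        (aestronglyMeasurable_toFun (f (φ n))))
      (fun n => (hf (φ n)).norm_eq_one.mono fun s hs => by rw [Complex.norm_conj, hs])
      (hconv.mono fun s hs => (Complex.continuous_conj.tendsto _).comp hs)
      (fun n => (ac_weightMeasure _).ae_eq (hmem _ _ (hf (φ n))).coeFn_toLp)
      ((ac_weightMeasure _).ae_eq (hmem _ _ hf').coeFn_toLp)
  have h3 := ((Complex.imCLM.compLpL 2 (weightMeasure (1 + j))).continuous.tendsto _).comp h2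
  have h4 : ∀ (g : evenSpace ℂ m) (ψ : evenSpace ℝ m) (h : IsPhase g ψ),
      Complex.imCLM.compLpL 2 (weightMeasure (1 + j)) (hmem g ψ h).toLp = ψ.1 ⟨j, hj⟩ := by
    intro g ψ h
    refine Lp.ext ?_
    filter_upwards [Complex.imCLM.coeFn_compLpL (hmem g ψ h).toLp, (hmem g ψ h).coeFn_toLp,
      (weightMeasure_ac _).ae_le (key g ψ h)] with s k1 k2 k3
    rw [k1, k2, k3]
    rfl
  exact Eq.subst (motive := fun y => Tendsto _ atTop (𝓝 y)) (h4 _ _ hf')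
    (h3.congr fun n => h4 _ _ (hf (φ n)))

end Convergence

/-! ### Choosing the multiples of 2π -/

section Poincare

/-- The integers are chosen so that the remainder is the principal argument of e^{i x n}, and that
argument is continuous at 1. -/
lemma exists_int_tendsto {x : ℕ → ℝ}
    (h : Tendsto (fun n => Complex.exp (Complex.I * (x n : ℂ))) atTop (𝓝 1)) :
    ∃ k : ℕ → ℤ, Tendsto (fun n => x n - k n * (2 * Real.pi)) atTop (𝓝 0) := by
  have h1 : ∀ n, ∃ k : ℤ, x n - k * (2 * Real.pi) = (Complex.exp (Complex.I * (x n : ℂ))).arg := by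
    intro n
    have e1 := Complex.norm_mul_exp_arg_mul_I (Complex.exp (Complex.I * (x n : ℂ)))
    rw [mul_comm Complex.I, Complex.norm_exp_ofReal_mul_I, Complex.ofReal_one, one_mul] at e1
    obtain ⟨k, hk⟩ := Complex.exp_eq_exp_iff_exists_int.1 e1.symm
    refine ⟨k, ?_⟩
    have e2 : (x n : ℂ) * Complex.I = (((Complex.exp ((x n : ℂ) * Complex.I)).arg
        + k * (2 * Real.pi) : ℝ) : ℂ) * Complex.I := by
      refine hk.trans ?_
      push_cast
      ring
    have e3 := Complex.ofReal_injective (mul_right_cancel₀ Complex.I_ne_zero e2)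
    rw [mul_comm Complex.I]
    linarith
  choose k hk using h1
  refine ⟨k, ?_⟩
  simp only [hk]
  have hc := (Complex.continuousAt_arg (by simp : (1 : ℂ) ∈ Complex.slitPlane)).tendsto.comp h
  simpa [Function.comp_def] using hc

/-- The L² majorant behind `exists_int_tendsto_sub`: a derivative in L²((1 - s²)² ds) bounds
increments from 0 by a multiple of (1 - s²)^{-1/2}. -/
lemma memLp_inv_sqrtWeight : MemLp (fun s => (sqrtWeight s)⁻¹) 2 (weightMeasure 1) := by
  have hm : AEStronglyMeasurable (fun s => (sqrtWeight s)⁻¹) intervalMeasure :=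
    continuous_sqrtWeight.measurable.inv.aestronglyMeasurable
  refine memLp_weight_iff.2 ⟨hm, MemLp.of_bound
    ((continuous_sqrtWeight.pow 1).aestronglyMeasurable.smul hm) 1 ?_⟩
  filter_upwards [ae_restrict_mem measurableSet_Ioo] with s hs
  rw [pow_one, smul_eq_mul, mul_inv_cancel₀ (sqrtWeight_pos hs).ne', norm_one]

/-- Functions whose derivatives tend to zero converge to zero after subtraction of constants. -/
lemma exists_int_tendsto_sub (hm : 0 < m) {d : ℕ → evenSpace ℝ m}
    (h1 : Tendsto (fun n => (d n).1 ⟨1, Nat.succ_lt_succ hm⟩) atTop (𝓝 0))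
    (h2 : ∀ᵐ s ∂intervalMeasure,
      Tendsto (fun n => Complex.exp (Complex.I * ((toFun (d n) s : ℝ) : ℂ))) atTop (𝓝 1)) :
    ∃ k : ℕ → ℤ,
      Tendsto (fun n => (d n - k n • evenConst m (2 * Real.pi)).1 0) atTop (𝓝 0) := by
  choose D hD1 hD2 using fun n => exists_representatives (d n).2.1
  have hD0 : ∀ n, toFun (d n) =ᵐ[intervalMeasure] D n 0 := fun n => by
    rw [toFun_eq_jet]
    exact hD1 n 0
  -- Convergence at a single point s₀ fixes the integers; the bounds on the increments carry it to
  -- the whole interval.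
  obtain ⟨s₀, hs1, hs2, hs3⟩ := (h2.and ((ae_all_iff.2 hD0).and
    (ae_restrict_mem measurableSet_Ioo))).exists
  simp only [hs2] at hs1
  obtain ⟨k, hk⟩ := exists_int_tendsto hs1
  refine ⟨k, ?_⟩
  -- The summand 1/(n+1) only keeps B n positive, as the integral estimate demands.
  let B : ℕ → ℝ := fun n => ‖(d n).1 ⟨1, Nat.succ_lt_succ hm⟩‖ + 1 / ((n : ℝ) + 1)
  have hB0 : ∀ n, 0 < B n := fun n => by positivity
  have hB : Tendsto B atTop (𝓝 0) := by
    simpa [B] using (tendsto_zero_iff_norm_tendsto_zero.1 h1).add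
      tendsto_one_div_add_atTop_nhds_zero_nat
  have hbound : ∀ n, ∀ s ∈ Ioo (-1 : ℝ) 1, ‖D n 0 s - D n 0 0‖ ≤ B n * (sqrtWeight s)⁻¹ := by
    intro n s hs
    have hj : jet (d n).1 1 = (d n).1 ⟨1, Nat.succ_lt_succ hm⟩ := jet_of_lt _ _
    have e1 := ((hD2 n 0 hm).congr_right (hD1 n 1).symm).2 s hs
    rw [e1, add_sub_cancel_left, hj]
    have := norm_intervalIntegral_le_inv_sqrtWeight_pow (k := 0)
      (g := (d n).1 ⟨1, Nat.succ_lt_succ hm⟩) (Lp.memLp _) (hB0 n) hs ?_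
    · simpa using this
    · refine (integral_weight_norm_sq ((d n).1 ⟨1, Nat.succ_lt_succ hm⟩)).le.trans ?_
      have : (0 : ℝ) < 1 / ((n : ℝ) + 1) := by positivity
      exact pow_le_pow_left₀ (norm_nonneg _) (by simp only [B]; linarith) 2
  let C : ℕ → ℝ := fun n =>
    B n + (B n * (sqrtWeight s₀)⁻¹ + ‖D n 0 s₀ - k n * (2 * Real.pi)‖)
  have hC : Tendsto C atTop (𝓝 0) := by
    simpa [C] using hB.add ((hB.mul_const (sqrtWeight s₀)⁻¹).add
      (tendsto_zero_iff_norm_tendsto_zero.1 hk))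
  have hle : ∀ n, ∀ᵐ s ∂intervalMeasure,
      ‖(d n - k n • evenConst m (2 * Real.pi)).1 0 s‖ ≤ C n * ‖(sqrtWeight s)⁻¹‖ := by
    intro n
    have hsub : d n - k n • evenConst m (2 * Real.pi)
        = d n + (-(k n : ℝ)) • evenConst m (2 * Real.pi) := by
      rw [neg_smul, Int.cast_smul_eq_zsmul, sub_eq_add_neg]
    rw [hsub]
    filter_upwards [coe_add_ae (d n) ((-(k n : ℝ)) • evenConst m (2 * Real.pi)),
      coe_smul_ae (-(k n : ℝ)) (evenConst m (2 * Real.pi)), toFun_evenConst m (2 * Real.pi),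
      hD0 n, ae_restrict_mem measurableSet_Ioo] with s k1 k2 k3 k4 k5
    have e1 : toFun (d n + (-(k n : ℝ)) • evenConst m (2 * Real.pi)) s
        = (D n 0 s - D n 0 0) + (-(D n 0 s₀ - D n 0 0) + (D n 0 s₀ - k n * (2 * Real.pi))) := by
      rw [k1, Pi.add_apply, k2, Pi.smul_apply, k3, k4, smul_eq_mul]
      ring
    change ‖toFun (d n + (-(k n : ℝ)) • evenConst m (2 * Real.pi)) s‖ ≤ _
    have e2 := hbound n s k5
    have e3 := hbound n s₀ hs3
    have e4 : 1 ≤ (sqrtWeight s)⁻¹ := by simpa using one_le_inv_sqrtWeight_pow 1 k5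
    rw [e1, Real.norm_of_nonneg (by linarith : 0 ≤ (sqrtWeight s)⁻¹)]
    refine (norm_add_le _ _).trans ?_
    rw [add_mul]
    refine add_le_add e2 ((norm_add_le _ _).trans ?_)
    rw [norm_neg]
    refine (add_le_add e3 le_rfl).trans (le_mul_of_one_le_right ?_ e4)
    exact add_nonneg ((norm_nonneg _).trans e3) (norm_nonneg _)
  refine squeeze_zero_norm (a := fun n => C n * ‖memLp_inv_sqrtWeight.toLp‖) (fun n => ?_)
    (by simpa using hC.mul_const ‖memLp_inv_sqrtWeight.toLp‖)
  refine Lp.norm_le_mul_norm_of_ae_le_mul ?_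
  filter_upwards [memLp_inv_sqrtWeight.coeFn_toLp, (weightMeasure_ac 1).ae_le (hle n)]
    with s k1 k2
  have k3 : C n * ‖(sqrtWeight s)⁻¹‖ = C n * ‖memLp_inv_sqrtWeight.toLp _ s‖ := by rw [k1]
  exact k2.trans k3.le

end Poincare

/-! ### Fibres of the phase map -/

section Fibers

lemma isPhase_add_zsmul {f : evenSpace ℂ m} {θ : evenSpace ℝ m} (h : IsPhase f θ) (k : ℤ) :
    IsPhase f (θ + k • evenConst m (2 * Real.pi)) := by
  rw [← Int.cast_smul_eq_zsmul ℝ]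
  filter_upwards [h, coe_add_ae θ ((k : ℝ) • evenConst m (2 * Real.pi)),
    coe_smul_ae (k : ℝ) (evenConst m (2 * Real.pi)), toFun_evenConst m (2 * Real.pi)]
    with s h1 h2 h3 h4
  rw [h1, h2, Pi.add_apply, h3, Pi.smul_apply, h4, smul_eq_mul]
  refine Complex.exp_eq_exp_iff_exists_int.2 ⟨-k, ?_⟩
  push_cast
  ring

lemma IsPhase.jet_one_ae_eq (hm : 1 ≤ m) {f : evenSpace ℂ m} {θ ψ : evenSpace ℝ m}
    (hθ : IsPhase f θ) (hψ : IsPhase f ψ) : jet θ.1 1 =ᵐ[intervalMeasure] jet ψ.1 1 := by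
  filter_upwards [(jet_phase hθ).1 hm, (jet_phase hψ).1 hm, hθ, hψ] with s h1 h2 h3 h4
  rw [h1, ← h3, ← h4] at h2
  have h5 : toFun f s ≠ 0 := by
    rw [h3]
    exact Complex.exp_ne_zero _
  exact Complex.ofReal_injective (mul_left_cancel₀ Complex.I_ne_zero (mul_left_cancel₀ h5 h2))

/-- Phases of one function have equal derivatives, hence differ by a constant c, and e^{ic} = 1 at
one point suffices. -/
lemma IsPhase.exists_int (hm : 1 ≤ m) {f : evenSpace ℂ m} {θ ψ : evenSpace ℝ m}
    (hθ : IsPhase f θ) (hψ : IsPhase f ψ) :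
    ∃ k : ℤ, ψ = θ + k • evenConst m (2 * Real.pi) := by
  have h1 := (isWeakDeriv_jet ψ.2.1 hm).add ((isWeakDeriv_jet θ.2.1 hm).smul (-1))
  obtain ⟨c, hc⟩ := ae_eq_const_of_isWeakDeriv_zero (h1.congr EventuallyEq.rfl (g' := 0) (by
    filter_upwards [hθ.jet_one_ae_eq hm hψ] with s hs
    simp only [Pi.add_apply, Pi.smul_apply, zero_add, hs, Pi.zero_apply]
    simp))
  rw [← toFun_eq_jet, ← toFun_eq_jet] at hc
  have hc' : ∀ᵐ s ∂intervalMeasure, toFun ψ s = toFun θ s + c := by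
    filter_upwards [hc] with s hs
    simp only [Pi.add_apply, Pi.smul_apply, smul_eq_mul] at hs
    linarith
  obtain ⟨s, k1, k2, k3⟩ := (hc'.and (hθ.and hψ)).exists
  rw [k2, k1] at k3
  obtain ⟨k, hk⟩ := Complex.exp_eq_exp_iff_exists_int.1 k3.symm
  have hck : c = k * (2 * Real.pi) := by
    have : ((toFun θ s + c : ℝ) : ℂ) = ((toFun θ s + k * (2 * Real.pi) : ℝ) : ℂ) := by
      refine mul_left_cancel₀ Complex.I_ne_zero ?_
      rw [hk]
      push_cast
      ring
    exact add_left_cancel (Complex.ofReal_injective this)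
  refine ⟨k, evenSpace_ext ?_⟩
  rw [← Int.cast_smul_eq_zsmul ℝ]
  filter_upwards [hc', coe_add_ae θ ((k : ℝ) • evenConst m (2 * Real.pi)),
    coe_smul_ae (k : ℝ) (evenConst m (2 * Real.pi)), toFun_evenConst m (2 * Real.pi)]
    with s h1 h2 h3 h4
  rw [h1, h2, Pi.add_apply, h3, Pi.smul_apply, h4, smul_eq_mul, hck]

lemma evenConst_two_pi_ne_zero : evenConst m (2 * Real.pi) ≠ 0 := by
  intro h
  obtain ⟨s, h1, h2⟩ := ((toFun_evenConst m (2 * Real.pi)).and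
    (coe_zero_ae (E := ℝ) (m := m))).exists
  rw [h, h2] at h1
  exact (Real.two_pi_pos.ne h1).elim

/-- Correcting a phase by multiples of 2π therefore affects order zero only. -/
lemma evenConst_apply_of_pos (c : ℝ) {j : ℕ} (hj : j < m + 1) (hj0 : 0 < j) :
    (evenConst m c).1 ⟨j, hj⟩ = 0 := by
  have h1 := (isWeakDeriv_jet (evenConst m c).2.1 (by omega : 0 < m)).ae_unique
    (IsPrimitive.const c).isWeakDeriv (by
      rw [← toFun_eq_jet]
      exact toFun_evenConst m c)
  have hz : ∀ i, jet (0 : JetSpace ℝ 1 m) i =ᵐ[intervalMeasure] 0 := fun i => by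
    simpa using jet_smul (0 : ℝ) (0 : JetSpace ℝ 1 m) i
  have h2 := (jet_ae_eq (evenConst m c).2.1 (zero_mem _) (h1.trans (hz 1).symm) j hj0).trans (hz j)
  rw [jet_of_lt _ hj] at h2
  exact Lp.ext (((weightMeasure_ac _).ae_eq h2).trans (Lp.coeFn_zero _ _ _).symm)

end Fibers

/-! ### Lifting convergent sequences -/

section LocalLifts

/-- Arbitrary lifts already have convergent derivatives along a subsequence. Subtracting suitable
multiples of 2π makes order zero converge without changing the lifted functions or the derivatives.
-/
lemma exists_subseq_lift_of_le_two (hm : 1 ≤ m) (hm2 : m ≤ 2) {f : ℕ → evenSpace ℂ m}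
    {f' : evenSpace ℂ m} {θ' : evenSpace ℝ m} (hlim : Tendsto f atTop (𝓝 f'))
    (hf : ∀ n, ∀ᵐ s ∂intervalMeasure, ‖toFun (f n) s‖ = 1) (hf' : IsPhase f' θ') :
    ∃ φ : ℕ → ℕ, ∃ ψ : ℕ → evenSpace ℝ m, StrictMono φ ∧ Tendsto ψ atTop (𝓝 θ') ∧
      ∀ n, IsPhase (f (φ n)) (ψ n) := by
  choose θ hθ using fun n => exists_lift hm (f n) (hf n)
  obtain ⟨φ, h1, h2, h3⟩ := exists_subseq_phase_deriv hm2 hlim hθ hf'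
  obtain ⟨k, hk⟩ := exists_int_tendsto_sub hm (d := fun n => θ (φ n) - θ')
    (by
      have h4 := (h3 1 (by omega) one_pos).sub_const (θ'.1 ⟨1, by omega⟩)
      rw [sub_self] at h4
      exact h4)
    (by
      have h4 : ∀ n, ∀ᵐ s ∂intervalMeasure, toFun (θ (φ n) - θ') s
          = toFun (θ (φ n)) s - toFun θ' s := fun n => by
        filter_upwards [coe_add_ae (θ (φ n) - θ') θ'] with s hs
        rw [sub_add_cancel, Pi.add_apply] at hs
        rw [hs, add_sub_cancel_right]
      filter_upwards [h2, ae_all_iff.2 h4, ae_all_iff.2 hθ, hf'] with s k1 k2 k3 k4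
      have hne : toFun f' s ≠ 0 := by
        rw [k4]
        exact Complex.exp_ne_zero _
      have k5 := k1.div_const (toFun f' s)
      rw [div_self hne] at k5
      refine k5.congr fun n => ?_
      rw [k2, k3, k4, ← Complex.exp_sub]
      push_cast
      ring_nf)
  refine ⟨φ, fun n => θ (φ n) + (-k n) • evenConst m (2 * Real.pi), h1,
    tendsto_evenSpace fun j hj => ?_, fun n => isPhase_add_zsmul (hθ (φ n)) _⟩
  rcases Nat.eq_zero_or_pos j with rfl | hj0
  · have h5 := hk.add_const (θ'.1 0)
    rw [zero_add] at h5
    refine h5.congr fun n => ?_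
    change (θ (φ n)).1 0 - θ'.1 0 - (k n • evenConst m (2 * Real.pi)).1 0 + θ'.1 0
      = (θ (φ n)).1 0 + ((-k n) • evenConst m (2 * Real.pi)).1 0
    have : ((-k n) • evenConst m (2 * Real.pi)).1 0
        = -(k n • evenConst m (2 * Real.pi)).1 0 := by
      rw [neg_smul]
      rfl
    rw [this]
    abel
  · refine (h3 j hj hj0).congr fun n => ?_
    have : ((-k n) • evenConst m (2 * Real.pi)).1 ⟨j, hj⟩
        = (-k n) • (evenConst m (2 * Real.pi)).1 ⟨j, hj⟩ := rfl
    change _ = (θ (φ n)).1 ⟨j, hj⟩ + ((-k n) • evenConst m (2 * Real.pi)).1 ⟨j, hj⟩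
    rw [this, evenConst_apply_of_pos _ hj hj0, smul_zero, add_zero]

/-- The imaginary part of a logarithm of a unimodular function is a phase. -/
lemma isPhase_evenMap_im (hm : 3 ≤ m) {ξ : evenSpace ℂ m}
    (h : ∀ᵐ s ∂intervalMeasure, ‖toFun (evenExp hm ξ) s‖ = 1) :
    IsPhase (evenExp hm ξ) (evenMap m Complex.imCLM ξ) := by
  filter_upwards [h, toFun_evenExp hm ξ, toFun_evenMap Complex.imCLM ξ] with s h1 h2 h3
  rw [h2, Complex.norm_exp, Real.exp_eq_one_iff] at h1
  rw [h2, h3]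
  congr 1
  apply Complex.ext <;> simp [h1]

/-- Multiplication by `i`, from real functions to complex functions. -/
def mulI (m : ℕ) : evenSpace ℝ m →L[ℝ] evenSpace ℂ m :=
  evenMap m (ContinuousLinearMap.mul ℝ ℂ Complex.I ∘L Complex.ofRealCLM)

lemma toFun_mulI (θ : evenSpace ℝ m) :
    ∀ᵐ s ∂intervalMeasure, toFun (mulI m θ) s = Complex.I * ((toFun θ s : ℝ) : ℂ) :=
  toFun_evenMap _ θ

lemma im_mulI (θ : evenSpace ℝ m) : evenMap m Complex.imCLM (mulI m θ) = θ := by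
  refine evenSpace_ext ?_
  filter_upwards [toFun_mulI θ, toFun_evenMap Complex.imCLM (mulI m θ)] with s h1 h2
  rw [h2, h1]
  simp

/-- The sequential form of openness of the phase map. For m ≥ 3 the lifts are imaginary parts of a
local logarithm, available from some index on. -/
lemma exists_subseq_lift (hm : 1 ≤ m) {f : ℕ → evenSpace ℂ m}
    {f' : evenSpace ℂ m} {θ' : evenSpace ℝ m} (hlim : Tendsto f atTop (𝓝 f'))
    (hf : ∀ n, ∀ᵐ s ∂intervalMeasure, ‖toFun (f n) s‖ = 1) (hf' : IsPhase f' θ') :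
    ∃ φ : ℕ → ℕ, ∃ ψ : ℕ → evenSpace ℝ m, StrictMono φ ∧ Tendsto ψ atTop (𝓝 θ') ∧
      ∀ n, IsPhase (f (φ n)) (ψ n) := by
  by_cases hm2 : m ≤ 2
  · exact exists_subseq_lift_of_le_two hm hm2 hlim hf hf'
  have hm3 : 3 ≤ m := by omega
  obtain ⟨e, h1, h2, -⟩ := exists_openPartialHomeomorph_expMap (commute_mulOperator hm3)
    (mulOperator_one hm3) (mulI m θ')
  have he : e (mulI m θ') = f' := by
    rw [h2]
    exact (isPhase_evenExp hm3 θ').eq hf'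
  have hmem : f' ∈ e.target := he ▸ e.map_source h1
  obtain ⟨N, hN⟩ := eventually_atTop.1 (hlim.eventually (e.open_target.mem_nhds hmem))
  have hshift : StrictMono fun n : ℕ => n + N := fun a b h => by
    simpa using h
  refine ⟨fun n => n + N, fun n => evenMap m Complex.imCLM (e.symm (f (n + N))), hshift, ?_,
    fun n => ?_⟩
  · have h3 := (e.symm.continuousAt hmem).tendsto.comp (hlim.comp hshift.tendsto_atTop)
    rw [← he, e.left_inv h1] at h3
    have h4 := ((evenMap m Complex.imCLM).continuous.tendsto _).comp h3
    rw [im_mulI] at h4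
    exact h4
  · have h3 : evenExp hm3 (e.symm (f (n + N))) = f (n + N) := by
      have := e.right_inv (hN (n + N) (Nat.le_add_left N n))
      rwa [h2] at this
    have h4 := isPhase_evenMap_im hm3 (ξ := e.symm (f (n + N))) (by
      rw [h3]
      exact hf (n + N))
    rwa [h3] at h4

end LocalLifts

/-! ### The phase map is a local homeomorphism onto the arc space -/

section PhaseMap

/-- The curve in `A^(m+1)` with derivative `exp (i θ)`. -/
def phaseMap (hm : 1 ≤ m) (θ : evenSpace ℝ m) : arcSpace m :=
  ⟨(derivEquiv m).symm (exists_isPhase hm θ).choose, by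
    rw [mem_arcSpace_iff, ContinuousLinearEquiv.apply_symm_apply]
    exact (exists_isPhase hm θ).choose_spec.norm_eq_one⟩

lemma isPhase_phaseMap (hm : 1 ≤ m) (θ : evenSpace ℝ m) :
    IsPhase (derivEquiv m (phaseMap hm θ).1) θ := by
  change IsPhase (derivEquiv m ((derivEquiv m).symm (exists_isPhase hm θ).choose)) θ
  rw [ContinuousLinearEquiv.apply_symm_apply]
  exact (exists_isPhase hm θ).choose_spec

lemma eq_phaseMap (hm : 1 ≤ m) {η : arcSpace m} {θ : evenSpace ℝ m}
    (h : IsPhase (derivEquiv m η.1) θ) : η = phaseMap hm θ :=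
  Subtype.ext ((derivEquiv m).injective (h.eq (isPhase_phaseMap hm θ)))

lemma surjective_phaseMap (hm : 1 ≤ m) : Function.Surjective (phaseMap (m := m) hm) := fun η => by
  obtain ⟨θ, hθ⟩ := exists_lift hm (derivEquiv m η.1) ((mem_arcSpace_iff η.1).1 η.2)
  exact ⟨θ, (eq_phaseMap hm hθ).symm⟩

lemma phaseMap_eq_iff (hm : 1 ≤ m) (θ ψ : evenSpace ℝ m) (h : phaseMap hm θ = phaseMap hm ψ) :
    ∃ k : ℤ, ψ = θ + k • evenConst m (2 * Real.pi) := by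
  have h1 := isPhase_phaseMap hm ψ
  rw [← h] at h1
  exact (isPhase_phaseMap hm θ).exists_int hm h1

/-- For m ≥ 3 the map is a composition with the smooth exponential. For m ≤ 2 every sequence has a
subsequence with the right limit, which is enough. -/
lemma continuous_phaseMap (hm : 1 ≤ m) : Continuous (phaseMap (m := m) hm) := by
  refine Continuous.subtype_mk ((derivEquiv m).symm.continuous.comp ?_) _
  have hp := fun θ : evenSpace ℝ m => (exists_isPhase hm θ).choose_spec
  by_cases hm3 : 3 ≤ m
  · have : (fun θ : evenSpace ℝ m => (exists_isPhase hm θ).choose)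
        = fun θ => evenExp hm3 (mulI m θ) := funext fun θ => (hp θ).eq (isPhase_evenExp hm3 θ)
    rw [this]
    exact contDiff_expMap.continuous.comp (mulI m).continuous
  · refine continuous_iff_seqContinuous.2 fun u θ hu => ?_
    refine tendsto_of_subseq_tendsto fun ns hns => ?_
    obtain ⟨φ, -, h⟩ := exists_subseq_isPhase (by omega) (hu.comp hns)
      (fun n => hp (u (ns n))) (hp θ)
    exact ⟨φ, h⟩

/-- If arcs outside the image of W converged to the image of some θ in W, lifts converging to θ
would enter W. -/
lemma isOpenMap_phaseMap (hm : 1 ≤ m) : IsOpenMap (phaseMap (m := m) hm) := by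
  intro W hW
  rw [← isClosed_compl_iff]
  refine IsSeqClosed.isClosed fun u η hu h => ?_
  rintro ⟨θ, hθ, rfl⟩
  have hlim := ((derivEquiv m).continuous.tendsto _).comp
    ((continuous_subtype_val.tendsto _).comp h)
  obtain ⟨φ, ψ, h1, h2, h3⟩ := exists_subseq_lift hm hlim
    (fun n => (mem_arcSpace_iff (u n).1).1 (u n).2) (isPhase_phaseMap hm θ)
  obtain ⟨n, hn⟩ := (h2.eventually (hW.mem_nhds hθ)).exists
  exact hu (φ n) ⟨ψ n, hn, (eq_phaseMap hm (h3 n)).symm⟩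

lemma isLocalHomeomorph_phaseMap (hm : 1 ≤ m) : IsLocalHomeomorph (phaseMap (m := m) hm) :=
  isLocalHomeomorph_of_isOpenMap evenConst_two_pi_ne_zero (continuous_phaseMap hm)
    (isOpenMap_phaseMap hm) (phaseMap_eq_iff hm)

end PhaseMap

/-! ### The smooth embedding for m ≥ 3 -/

section Immersion

/-- The decomposition of a complex function into its imaginary and real parts. -/
def imReEquiv (m : ℕ) : (evenSpace ℝ m × evenSpace ℝ m) ≃L[ℝ] evenSpace ℂ m :=
  ContinuousLinearEquiv.equivOfInverse
    ((mulI m).coprod (evenMap m Complex.ofRealCLM))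
    ((evenMap m Complex.imCLM).prod (evenMap m Complex.reCLM))
    (fun ζ => by
      obtain ⟨a, b⟩ := ζ
      refine Prod.ext (evenSpace_ext ?_) (evenSpace_ext ?_)
      · filter_upwards [toFun_evenMap Complex.imCLM (mulI m a + evenMap m Complex.ofRealCLM b),
          coe_add_ae (mulI m a) (evenMap m Complex.ofRealCLM b), toFun_mulI a,
          toFun_evenMap Complex.ofRealCLM b] with s h1 h2 h3 h4
        refine h1.trans ?_
        rw [h2, Pi.add_apply, h3, h4]
        simp
      · filter_upwards [toFun_evenMap Complex.reCLM (mulI m a + evenMap m Complex.ofRealCLM b),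
          coe_add_ae (mulI m a) (evenMap m Complex.ofRealCLM b), toFun_mulI a,
          toFun_evenMap Complex.ofRealCLM b] with s h1 h2 h3 h4
        refine h1.trans ?_
        rw [h2, Pi.add_apply, h3, h4]
        simp)
    (fun ξ => by
      refine evenSpace_ext ?_
      filter_upwards [coe_add_ae (mulI m (evenMap m Complex.imCLM ξ))
        (evenMap m Complex.ofRealCLM (evenMap m Complex.reCLM ξ)),
        toFun_mulI (evenMap m Complex.imCLM ξ), toFun_evenMap Complex.imCLM ξ,
        toFun_evenMap Complex.ofRealCLM (evenMap m Complex.reCLM ξ),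
        toFun_evenMap Complex.reCLM ξ] with s h1 h2 h3 h4 h5
      refine h1.trans ?_
      rw [Pi.add_apply, h2, h3, h4, h5]
      apply Complex.ext <;> simp)

lemma imReEquiv_apply_zero (θ : evenSpace ℝ m) : imReEquiv m (θ, 0) = mulI m θ := by
  change mulI m θ + evenMap m Complex.ofRealCLM 0 = mulI m θ
  rw [map_zero, add_zero]

lemma phaseMap_eq_evenExp (hm : 1 ≤ m) (hm3 : 3 ≤ m) (θ : evenSpace ℝ m) :
    (phaseMap hm θ).1 = (derivEquiv m).symm (evenExp hm3 (mulI m θ)) := by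
  refine (derivEquiv m).injective ?_
  rw [ContinuousLinearEquiv.apply_symm_apply]
  exact (isPhase_phaseMap hm θ).eq (isPhase_evenExp hm3 θ)

lemma mem_maximalAtlas_of_contDiffOn {X : Type*} [NormedAddCommGroup X] [NormedSpace ℝ X]
    {e : OpenPartialHomeomorph X X} (h1 : ContDiffOn ℝ ∞ e e.source)
    (h2 : ContDiffOn ℝ ∞ e.symm e.target) : e ∈ IsManifold.maximalAtlas 𝓘(ℝ, X) ∞ X := by
  refine StructureGroupoid.mem_maximalAtlas_of_mem_groupoid _ ?_
  rw [contDiffGroupoid, mem_groupoid_of_pregroupoid]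
  exact ⟨by simpa [contDiffPregroupoid] using h1, by simpa [contDiffPregroupoid] using h2⟩

/-- Charts with small target are needed so that iψ stays in the target of the slice chart for all ψ
in the chart. -/
lemma exists_localInverse_subset {H A : Type*} [NormedAddCommGroup H] [NormedSpace ℝ H]
    [TopologicalSpace A] {p : H → A} (hp : IsLocalHomeomorph p) {x : H} {W : Set H}
    (hW : IsOpen W) (hx : x ∈ W) :
    ∃ φ ∈ localInverses p, p x ∈ φ.source ∧ φ.target ⊆ W := by
  obtain ⟨e, h1, h2⟩ := hp x
  refine ⟨(e.restrOpen W hW).symm, fun y _ => ?_, ?_, fun y hy => hy.2⟩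
  · rw [h2]
    rfl
  · have : x ∈ (e.restrOpen W hW).source := ⟨h1, hx⟩
    rw [h2]
    exact (e.restrOpen W hW).map_source this

/-- In a local inverse of the phase map and a slice chart the inclusion reads ψ ↦ iψ; the complement
consists of the real parts. -/
lemma isSmoothEmbedding_arcSpace (hm : 1 ≤ m) (hm3 : 3 ≤ m) :
    letI := localInverseChartedSpace (isLocalHomeomorph_phaseMap hm) (surjective_phaseMap hm)
    Manifold.IsSmoothEmbedding 𝓘(ℝ, evenSpace ℝ m) 𝓘(ℝ, curveSpace (m + 1)) ∞
      (Subtype.val : arcSpace m → curveSpace (m + 1)) := by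
  let _ := localInverseChartedSpace (isLocalHomeomorph_phaseMap hm) (surjective_phaseMap hm)
  have := isManifold_localInverseChartedSpace evenConst_two_pi_ne_zero (phaseMap_eq_iff hm)
    (isLocalHomeomorph_phaseMap hm) (surjective_phaseMap hm)
  refine ⟨?_, Topology.IsEmbedding.subtypeVal⟩
  refine Manifold.IsImmersionOfComplement.isImmersion (F := evenSpace ℝ m) fun η => ?_
  obtain ⟨θ, rfl⟩ := surjective_phaseMap hm η
  obtain ⟨Φ, h1, h2, h3⟩ := exists_sliceChart hm3 (mulI m θ)
  obtain ⟨φ, k1, k2, k3⟩ := exists_localInverse_subset (isLocalHomeomorph_phaseMap hm)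
    (Φ.open_target.preimage (mulI m).continuous) (show θ ∈ mulI m ⁻¹' Φ.target from h1)
  -- D carries the range of the slice chart back to K^{m+1}, on which the ambient space is modelled.
  let D := (derivEquiv m).symm.toHomeomorph.toOpenPartialHomeomorph
  have hval : ∀ ψ : evenSpace ℝ m, (phaseMap hm ψ).1 = Φ.symm (mulI m ψ) := fun ψ => by
    rw [phaseMap_eq_evenExp hm hm3, h3]
  refine Manifold.IsImmersionAtOfComplement.mk_of_continuousAt
    continuous_subtype_val.continuousAt ((imReEquiv m).trans (derivEquiv m).symm) φ (Φ ≫ₕ D) k2 ?_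
    (IsManifold.subset_maximalAtlas k1) (mem_maximalAtlas_of_contDiffOn ?_ ?_) ?_
  · have : (phaseMap hm θ).1 ∈ Φ.source := by
      rw [hval]
      exact Φ.map_target h1
    simpa [D] using this
  · have : (Φ ≫ₕ D).source = Φ.source := by simp [D]
    rw [this]
    exact (derivEquiv m).symm.contDiff.comp_contDiffOn h2.contDiffOn
  · have : (Φ ≫ₕ D).target = derivEquiv m ⁻¹' Φ.target := by
      simp [D]
    rw [this]
    exact h2.contDiffOn_symm.comp (derivEquiv m).contDiff.contDiffOn fun _ h => h
  · intro ψ hψ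
    have hψ' : ψ ∈ φ.target := by simpa using hψ
    have e1 : φ.symm ψ = phaseMap hm ψ := k1 ψ hψ'
    change (derivEquiv m).symm (Φ (φ.symm ψ).1) = (derivEquiv m).symm (imReEquiv m (ψ, 0))
    rw [e1, hval, Φ.right_inv (k3 hψ'), imReEquiv_apply_zero]

end Immersion

end ArcSpace

end

theorem mainTheorem4 (m : ℕ) (hm : 1 ≤ m) :
    -- the model spaces and the ambient space are Hilbert spaces
    CompleteSpace (ArcSpace.evenSpace ℝ m) ∧ CompleteSpace (ArcSpace.evenSpace ℂ m) ∧
    CompleteSpace (ArcSpace.curveSpace (m + 1)) ∧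
    -- `A^(m+1)` is a `C^∞` Hilbert manifold, with charts `η ↦ θ`, `η' = exp (i θ)`;
    -- if `m ≥ 3`, its inclusion into `K^(m+1)` is a `C^∞` embedding
    (∃ _ : ChartedSpace (ArcSpace.evenSpace ℝ m) (ArcSpace.arcSpace m),
      IsManifold 𝓘(ℝ, ArcSpace.evenSpace ℝ m) ∞ (ArcSpace.arcSpace m) ∧
      (∀ e ∈ atlas (ArcSpace.evenSpace ℝ m) (ArcSpace.arcSpace m), ∀ η ∈ e.source,
        ∀ᵐ s ∂ArcSpace.intervalMeasure,
          ArcSpace.velocity η.1 s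
            = Complex.exp (Complex.I * ((ArcSpace.toFun (e η) s : ℝ) : ℂ))) ∧
      (3 ≤ m → Manifold.IsSmoothEmbedding 𝓘(ℝ, ArcSpace.evenSpace ℝ m)
        𝓘(ℝ, ArcSpace.curveSpace (m + 1)) ∞
        (Subtype.val : ArcSpace.arcSpace m → ArcSpace.curveSpace (m + 1)))) ∧
    -- if `m ≥ 3`, then `A^(m+1)` is a `C^∞` Hilbert submanifold of `K^(m+1)`, with
    -- submanifold charts `η ↦ ξ`, `η' = exp ξ`
    (3 ≤ m → ∀ η₀ ∈ ArcSpace.arcSpace m,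
      ∃ Φ : OpenPartialHomeomorph (ArcSpace.curveSpace (m + 1)) (ArcSpace.evenSpace ℂ m),
        η₀ ∈ Φ.source ∧
        ArcSpace.IsSliceChart (ArcSpace.arcSpace m) (ArcSpace.imaginarySubspace m) Φ ∧
        ∀ η ∈ Φ.source, ∀ᵐ s ∂ArcSpace.intervalMeasure,
          ArcSpace.velocity η s = Complex.exp (ArcSpace.toFun (Φ η) s)) := by
  refine ⟨inferInstance, inferInstance, inferInstance, ?_, fun hm3 η₀ hη₀ => ?_⟩
  · refine ⟨ArcSpace.localInverseChartedSpace (ArcSpace.isLocalHomeomorph_phaseMap hm)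
      (ArcSpace.surjective_phaseMap hm), ArcSpace.isManifold_localInverseChartedSpace
      ArcSpace.evenConst_two_pi_ne_zero (ArcSpace.phaseMap_eq_iff hm) _ _, fun e he η hη => ?_,
      ArcSpace.isSmoothEmbedding_arcSpace hm⟩
    have h1 := he (e η) (e.map_source hη)
    rw [e.left_inv hη] at h1
    have h2 := ArcSpace.isPhase_phaseMap hm (e η)
    rw [← h1] at h2
    filter_upwards [h2, ArcSpace.toFun_derivEquiv η.1] with s k1 k2
    rw [← k1, k2]
  -- A phase θ of the velocity of η₀ gives the logarithm iθ around which the slice chart is built.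
  · obtain ⟨θ, hθ⟩ := ArcSpace.surjective_phaseMap hm ⟨η₀, hη₀⟩
    obtain ⟨Φ, h1, h2, h3⟩ := ArcSpace.exists_sliceChart hm3 (ArcSpace.mulI m θ)
    refine ⟨Φ, ?_, h2, fun η hη => ArcSpace.velocity_sliceChart hm3 h3 hη⟩
    have h4 : Φ.symm (ArcSpace.mulI m θ) = η₀ := by
      rw [h3, ← ArcSpace.phaseMap_eq_evenExp hm hm3, hθ]
    rw [← h4]
    exact Φ.map_target h1
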